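/- Let $X$ be a smooth projective variety over $\mathbb C$ and let $\mathcal F$ be a one-dimensional (singular) holomorphic foliation on $X$, given by a section $\xi$ of $TX\otimes\mathcal L$, for a line bundle $\mathcal L$, whose zero set $\mathrm{sing}(\mathcal F)$ has no divisorial components. Let $\mathrm{ch}(\mathcal F)\subset E(T^*X)$ be its characteristic variety, that is, the closure in the total space $E(T^*X)$ of the cotangent bundle of the set of covectors at points of $X\setminus\mathrm{sing}(\mathcal F)$ which vanish on the tangent direction of $\mathcal F$. Let $\mathcal F^{(1)}$ be its first prolongation: the foliation of $\mathrm{ch}(\mathcal F)$ which is defined, where $\mathcal F$ is generated by a vector field $\xi=\sum a_i\partial_{x_i}$, by the hamiltonian vector field $\hat\xi=\sum_i a_i\partial_{x_i}-\sum_{i,j}(\partial_{x_j}a_i)\,y_i\,\partial_{y_j}$ of the function $\sum a_iy_i$, where $y_i=\partial_{x_i}$ is viewed as a fibrewise linear function on $E(T^*X)$. Suppose that $\mathcal F$ has a non-resonant singularity $p$, that is, an isolated singularity at which the linear part of a local generator of $\mathcal F$ is invertible and has eigenvalues generating a $\mathbb Z$-module of rank $\dim X$. Suppose also that at least one separatrix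 of $\mathcal F$ through $p$ (a non-constant germ of $\mathcal F$-invariant holomorphic curve $(\mathbb C,0)\to(X,p)$) is Zariski dense in $X$. Let $Y\subsetneq\mathrm{ch}(\mathcal F)$ be an irreducible closed algebraic subvariety which dominates $X$ and is different from the zero section of $T^*X$. If $Y$ is invariant by $\mathcal F^{(1)}$, then, with $q=\dim Y-\dim X$: 1. $1\le q\le\dim X-2$, and for $x$ in a non-empty Zariski open subset of $X$ the fibre $Y_x\subset T^*_xX$ is a finite union of linear subspaces of $T^*_xX$, all of dimension $q$. 2. $\mathcal F$ is tangent to a multi-distribution of codimension $q$, whose conormal spaces at a generic point $x$ are the linear subspaces that make up $Y_x$. Here a multi-distribution of codimension $q$ is given by a rational section of $\mathrm{Sym}^k\Omega^q_X$, for some $k\ge1$, which at generic points is the product of $k$ decomposable $q$-forms defining pairwise distinct distributions of codimension $q$; $\mathcal F$ is tangent to it if its tangent direction is contained in each of these $k$ distributions. -/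

import Mathlib

open AlgebraicGeometry CategoryTheory Filter Topology

noncomputable section

namespace CharFoliation

attribute [local instance] MvPolynomial.gradedAlgebra

/-- Projective `N`-space over `ℂ`, as `Proj` of the graded ring `ℂ[x₀, …, x_N]`. -/
def ProjectiveSpace (N : ℕ) : Scheme.{0} :=
  Proj (MvPolynomial.homogeneousSubmodule (Fin (N + 1)) ℂ)

/-- The structure morphism of projective `N`-space over `ℂ`. -/
def ProjectiveSpace.toSpec (N : ℕ) : ProjectiveSpace N ⟶ Spec (.of ℂ) :=
  Proj.toSpecZero (MvPolynomial.homogeneousSubmodule (Fin (N + 1)) ℂ) ≫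
    Spec.map (CommRingCat.ofHom
      (algebraMap ℂ (MvPolynomial.homogeneousSubmodule (Fin (N + 1)) ℂ 0)))

/-- A smooth (irreducible) projective variety over `ℂ`. -/
structure SmoothProjectiveVariety where
  /-- the underlying scheme -/
  X : Scheme.{0}
  /-- the structure morphism -/
  str : X ⟶ Spec (.of ℂ)
  integral : IsIntegral X
  smooth : Smooth str
  projective : ∃ (N : ℕ) (i : X ⟶ ProjectiveSpace N),
    IsClosedImmersion i ∧ i ≫ ProjectiveSpace.toSpec N = str

variable (V : SmoothProjectiveVariety)

instance : IsIntegral V.X := V.integral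

instance : Nonempty (⊤ : V.X.Opens) := ⟨⟨genericPoint V.X, trivial⟩⟩

/-! ### Rational functions, local rings, points -/

/-- The field `ℂ(X)` of rational functions. -/
def RatFun : Type := V.X.functionField

instance : Field (RatFun V) := inferInstanceAs (Field V.X.functionField)

/-- The inclusion of the constants into the field of rational functions. -/
def constants : ℂ →+* RatFun V :=
  ((V.X.germToFunctionField ⊤).hom.comp V.str.appTop.hom).comp
    (Scheme.ΓSpecIso (.of ℂ)).inv.hom

instance : Algebra ℂ (RatFun V) := (constants V).toAlgebra

/-- The inclusion of the local ring at `x` into the field of rational functions. -/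
def stalkToRatFun (x : V.X) : V.X.presheaf.stalk x →+* RatFun V :=
  algebraMap (V.X.presheaf.stalk x) V.X.functionField

variable {V}

/-- The local ring `𝒪_{X,x}`, as a subring of the field of rational functions:
the rational functions that are regular at `x`. -/
def localRing (x : V.X) : Subalgebra ℂ (RatFun V) where
  toSubsemiring := (stalkToRatFun V x).rangeS
  algebraMap_mem' c := ⟨V.X.presheaf.germ ⊤ x trivial
      (V.str.appTop.hom ((Scheme.ΓSpecIso (.of ℂ)).inv.hom c)),
    Scheme.algebraMap_germ_eq_germToFunctionField (X := V.X) (U := ⊤) trivial _⟩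

variable (V)

/-- A (complex) point of `X`: a point of the scheme with residue field `ℂ`, together with the
evaluation of regular functions at it. -/
structure Point where
  /-- the underlying point of the scheme -/
  pt : V.X
  /-- evaluation `f ↦ f(P)` of the functions regular at the point -/
  eval : localRing pt →ₐ[ℂ] ℂ

variable {V}

open Classical in
/-- The value at `P` of a rational function; `0` if the function is not regular at `P`. -/
def Point.value (P : Point V) (f : RatFun V) : ℂ :=
  if h : f ∈ localRing P.pt then P.eval ⟨f, h⟩ else 0

/-- The ring `𝒪(U)` of regular functions on the open set `U`. -/
def regularFunctions (U : V.X.Opens) : Subalgebra ℂ (RatFun V) :=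
  ⨅ x : U, localRing x.1

theorem regularFunctions_le {U : V.X.Opens} {x : V.X} (hx : x ∈ U) {f : RatFun V}
    (hf : f ∈ regularFunctions U) : f ∈ localRing x :=
  (Algebra.mem_iInf.1 hf) ⟨x, hx⟩

theorem mem_regularFunctions {U : V.X.Opens} {f : RatFun V} :
    f ∈ regularFunctions U ↔ ∀ x ∈ U, f ∈ localRing x := by
  simp [regularFunctions, Algebra.mem_iInf]

/-! ### Tangent and cotangent spaces, vector fields -/

/-- The tangent space `T_P X`: derivations at `P` of the local ring, with values in `ℂ`. -/
def TangentSpace (P : Point V) : Submodule ℂ (localRing P.pt →ₗ[ℂ] ℂ) where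
  carrier := {v | ∀ f g, v (f * g) = P.eval f * v g + P.eval g * v f}
  add_mem' {v w} hv hw f g := by
    have h₁ := hv f g
    have h₂ := hw f g
    simp only [LinearMap.add_apply, h₁, h₂]; ring
  zero_mem' f g := by simp
  smul_mem' c v hv f g := by
    have h₁ := hv f g
    simp only [LinearMap.smul_apply, h₁, smul_eq_mul]; ring

/-- The cotangent space `T_P^* X`. -/
abbrev CotangentSpace (P : Point V) : Type := Module.Dual ℂ (TangentSpace P)

/-- The differential `d_P f ∈ T_P^* X` of a function regular at `P`. -/
def differential (P : Point V) (f : localRing P.pt) : CotangentSpace P where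
  toFun v := v.1 f
  map_add' _ _ := rfl
  map_smul' _ _ := rfl

variable (V) in
/-- Rational vector fields on `X`: derivations of the field of rational functions. -/
abbrev RatVectorField : Type := Derivation ℂ (RatFun V) (RatFun V)

/-- The vector fields on the open set `U`: the rational vector fields that are regular at every
point of `U`. They form a Lie algebra. -/
def vectorFields (U : V.X.Opens) : LieSubalgebra ℂ (RatVectorField V) where
  carrier := {D | ∀ x ∈ U, ∀ f ∈ localRing x, D f ∈ localRing x}
  add_mem' hD hE x hx f hf := (localRing x).add_mem (hD x hx f hf) (hE x hx f hf)
  zero_mem' x _ _ _ := (localRing x).zero_mem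
  smul_mem' c _ hD x hx f hf := (localRing x).smul_mem (hD x hx f hf) c
  lie_mem' {D E} hD hE x hx f hf := by
    rw [Derivation.commutator_apply]
    exact (localRing x).sub_mem (hD x hx _ (hE x hx f hf)) (hE x hx _ (hD x hx f hf))

theorem apply_mem_regularFunctions {U : V.X.Opens} {D : RatVectorField V}
    (hD : D ∈ vectorFields U) {f : RatFun V} (hf : f ∈ regularFunctions U) :
    D f ∈ regularFunctions U :=
  mem_regularFunctions.2 fun x hx ↦ hD x hx f (regularFunctions_le hx hf)

/-- The value `D(P) ∈ T_P X` at `P ∈ U` of a vector field `D` on `U`. -/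
def valueAt {U : V.X.Opens} {D : RatVectorField V} (hD : D ∈ vectorFields U) (P : Point V)
    (hP : P.pt ∈ U) : TangentSpace P :=
  ⟨{ toFun := fun f ↦ P.eval ⟨D f.1, hD _ hP _ f.2⟩
     map_add' := fun f g ↦ by
       rw [← map_add]; congr 1; exact Subtype.ext (by simp)
     map_smul' := fun c f ↦ by
       rw [RingHom.id_apply, ← map_smul]; congr 1; exact Subtype.ext (by simp) },
   fun f g ↦ by
     change P.eval ⟨D (f.1 * g.1), _⟩ =
       P.eval f * P.eval ⟨D g.1, _⟩ + P.eval g * P.eval ⟨D f.1, _⟩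
     rw [← map_mul, ← map_mul, ← map_add]
     congr 1
     exact Subtype.ext (by simp)⟩

/-! ### The total space of the cotangent bundle -/

variable (V) in
/-- The (complex points of the) total space `E(T^*X)` of the cotangent bundle. -/
structure CotangentBundle where
  /-- the base point -/
  base : Point V
  /-- the covector -/
  covector : CotangentSpace base

/-- Polynomial expressions in regular functions `f` on `U` and in vector fields `D` on `U`. A
vector field `D` is seen as the function `(P, η) ↦ η(D(P))`, linear on the fibres of `E(T^*U)`;
when `U` is affine, such expressions give exactly the regular functions on `E(T^*U)`. -/
abbrev SymbolExpr (U : V.X.Opens) : Type :=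
  MvPolynomial (regularFunctions U ⊕ vectorFields U) ℂ

/-- The value at a point of `E(T^*U)` of such an expression. -/
def evalSymbol {U : V.X.Opens} (e : CotangentBundle V) (he : e.base.pt ∈ U) :
    SymbolExpr U →ₐ[ℂ] ℂ :=
  MvPolynomial.aeval (Sum.elim
    (fun f ↦ e.base.eval ⟨f.1, regularFunctions_le he f.2⟩)
    (fun D ↦ e.covector (valueAt D.2 e.base he)))

/-- The Zariski topology of `E(T^*X)`: the non-vanishing loci of regular functions on the open
sets `E(T^*U)` are a basis of open sets. -/
instance : TopologicalSpace (CotangentBundle V) :=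
  TopologicalSpace.generateFrom
    {B | ∃ (U : V.X.Opens) (g : SymbolExpr U),
      B = {e | ∃ he : e.base.pt ∈ U, evalSymbol e he g ≠ 0}}

variable (V) in
/-- The zero section of the cotangent bundle. -/
def zeroSection : Set (CotangentBundle V) := {e | e.covector = 0}

/-- The fibre of a subset of `E(T^*X)` over `P`, as a subset of `T_P^* X`. -/
def fiber (Y : Set (CotangentBundle V)) (P : Point V) : Set (CotangentSpace P) :=
  {η | (⟨P, η⟩ : CotangentBundle V) ∈ Y}

/-- The subset `Y` of `E(T^*X)` dominates `X`. -/
def Dominates (Y : Set (CotangentBundle V)) : Prop :=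
  Dense ((fun e : CotangentBundle V ↦ e.base.pt) '' Y)

/-! ### Foliations -/

variable (V) in
/-- A one-dimensional foliation on `X`: a section of `TX ⊗ L`, for a line bundle `L`, without
divisorial components in its zero set. It is given by local generators: vector fields on the
members of an open cover, which differ by nowhere vanishing factors on the overlaps, and which do
not vanish (as tangent vectors) at any point of codimension one of the scheme `X`. -/
structure Foliation where
  /-- index set of the cover -/
  ι : Type
  /-- the open cover -/
  U : ι → V.X.Opens
  cover : ∀ x : V.X, ∃ i, x ∈ U i
  /-- the local generators -/
  gen : ι → RatVectorField V
  gen_ne_zero : ∀ i, gen i ≠ 0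
  gen_mem : ∀ i, gen i ∈ vectorFields (U i)
  compat : ∀ i j, ∃ g ∈ regularFunctions (U i ⊓ U j),
    g⁻¹ ∈ regularFunctions (U i ⊓ U j) ∧ gen i = g • gen j
  codim_two : ∀ i, ∀ x ∈ U i, ringKrullDim (localRing x) = 1 →
    ∃ f ∈ localRing x, gen i f ≠ 0 ∧ (gen i f)⁻¹ ∈ localRing x

variable (F : Foliation V)

/-- `P` is a singularity of `F`: the local generators vanish at `P`. -/
def Foliation.IsSingular (P : Point V) : Prop :=
  ∀ i, ∀ hP : P.pt ∈ F.U i, valueAt (F.gen_mem i) P hP = 0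

/-- The linear part `Dξ(P) : T_P X → T_P X` of a vector field `ξ` vanishing at `P`; as a
derivation at `P`, the image of `v` is `f ↦ v(ξ(f))`. -/
def linearPart {U : V.X.Opens} {ξ : RatVectorField V} (hξ : ξ ∈ vectorFields U) (P : Point V)
    (hP : P.pt ∈ U) (h0 : valueAt hξ P hP = 0) : TangentSpace P →ₗ[ℂ] TangentSpace P where
  toFun v := ⟨{ toFun := fun f ↦ v.1 ⟨ξ f.1, hξ _ hP _ f.2⟩
                map_add' := fun f g ↦ by
                  rw [← map_add]; congr 1; exact Subtype.ext (by simp)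
                map_smul' := fun c f ↦ by
                  rw [RingHom.id_apply, ← map_smul]; congr 1; exact Subtype.ext (by simp) },
    fun f g ↦ by
      have h (f : localRing P.pt) : P.eval ⟨ξ f.1, hξ _ hP _ f.2⟩ = 0 :=
        LinearMap.congr_fun (congrArg Subtype.val h0) f
      have e : (⟨ξ (f * g).1, hξ _ hP _ (f * g).2⟩ : localRing P.pt) =
          f * ⟨ξ g.1, hξ _ hP _ g.2⟩ + g * ⟨ξ f.1, hξ _ hP _ f.2⟩ :=
        Subtype.ext (by simp)
      change v.1 _ = P.eval f * v.1 _ + P.eval g * v.1 _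
      rw [e, map_add, v.2, v.2, h, h]; ring⟩
  map_add' _ _ := rfl
  map_smul' _ _ := rfl

/-- `P` is a non-resonant singularity of `F`: an isolated singularity such that the linear part of
a local generator is invertible, and its eigenvalues generate a `ℤ`-module of rank `dim X`. -/
def Foliation.IsNonResonant (P : Point V) : Prop :=
  F.IsSingular P ∧
  (∃ W : V.X.Opens, P.pt ∈ W ∧ ∀ Q : Point V, Q.pt ∈ W → F.IsSingular Q → Q = P) ∧
  ∃ (i : F.ι) (hP : P.pt ∈ F.U i) (h0 : valueAt (F.gen_mem i) P hP = 0),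
    Function.Bijective (linearPart (F.gen_mem i) P hP h0) ∧
    Module.finrank ℤ (Submodule.span ℤ
      {c : ℂ | Module.End.HasEigenvalue (linearPart (F.gen_mem i) P hP h0) c}) =
      Module.finrank ℂ (TangentSpace P)

/-- (The germ at `0` of) `γ` is a separatrix of `F` through `P`: a non-constant germ of
holomorphic curve `(ℂ, 0) → (X, P)` whose velocity is everywhere parallel to `F`. -/
def Foliation.IsSeparatrix (P : Point V) (γ : ℂ → Point V) : Prop :=
  γ 0 = P ∧ (¬ ∀ᶠ t in 𝓝 0, γ t = P) ∧
  ∃ (i : F.ι) (U : V.X.Opens), IsAffineOpen U ∧ U ≤ F.U i ∧ P.pt ∈ U ∧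
    (∀ᶠ t in 𝓝 0, (γ t).pt ∈ U) ∧
    (∀ f ∈ regularFunctions U, AnalyticAt ℂ (fun t ↦ (γ t).value f) 0) ∧
    ∀ f ∈ regularFunctions U, ∀ g ∈ regularFunctions U, ∀ᶠ t in 𝓝 0,
      deriv (fun s ↦ (γ s).value f) t * (γ t).value (F.gen i g) =
        deriv (fun s ↦ (γ s).value g) t * (γ t).value (F.gen i f)

/-- The germ at `0` of `γ` is Zariski dense in `X`. -/
def IsZariskiDenseGerm (γ : ℂ → Point V) : Prop :=
  ∀ W ∈ 𝓝 (0 : ℂ), Dense ((fun t ↦ (γ t).pt) '' W)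

/-- The characteristic variety `ch(F)`: the closure in `E(T^*X)` of the set of covectors at the
non-singular points of `F` which vanish on the tangent direction of `F`. -/
def Foliation.characteristicVariety : Set (CotangentBundle V) :=
  closure {e | ¬ F.IsSingular e.base ∧
    ∀ i, ∀ he : e.base.pt ∈ F.U i, e.covector (valueAt (F.gen_mem i) e.base he) = 0}

/-- The hamiltonian vector field on `E(T^*U)` of the function `(P, η) ↦ η(ξ(P))`, for the
canonical symplectic form, as a derivation: it maps a function `f` on `U` to `ξ(f)` and a vector
field `D` on `U` to `[ξ, D]`. If `ξ = ∑ aᵢ ∂/∂xᵢ` in local coordinates, and if `yⱼ` is the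
function defined by `∂/∂xⱼ`, it is `∑ aᵢ ∂/∂xᵢ - ∑ (∂aᵢ/∂xⱼ) yᵢ ∂/∂yⱼ`. -/
def prolongation {U : V.X.Opens} {ξ : RatVectorField V} (hξ : ξ ∈ vectorFields U) :
    Derivation ℂ (SymbolExpr U) (SymbolExpr U) :=
  MvPolynomial.mkDerivation ℂ (Sum.elim
    (fun f ↦ MvPolynomial.X (Sum.inl ⟨ξ f.1, apply_mem_regularFunctions hξ f.2⟩))
    (fun D ↦ MvPolynomial.X (Sum.inr ⟨⁅ξ, D.1⁆, (vectorFields U).lie_mem hξ D.2⟩)))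

/-- `Y` is invariant by the first prolongation of `F`, which is the foliation of `ch(F)` defined
by the prolongations of the local generators of `F`: over each affine open set these prolongations
preserve the ideal of the functions that vanish on `Y`.
(This is meant for `Y` irreducible, contained in `ch(F)` and not contained in the fibres
over the singularities of `F`; outside these fibres the prolongations of the local
generators do not vanish.) -/
def Foliation.IsProlongationInvariant (Y : Set (CotangentBundle V)) : Prop :=
  ∀ (i : F.ι) (U : V.X.Opens) (_ : IsAffineOpen U) (_ : U ≤ F.U i)
    (hξ : F.gen i ∈ vectorFields U) (g : SymbolExpr U),
    (∀ e ∈ Y, ∀ he : e.base.pt ∈ U, evalSymbol e he g = 0) →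
    ∀ e ∈ Y, ∀ he : e.base.pt ∈ U, evalSymbol e he (prolongation hξ g) = 0

/-! ### Multi-distributions -/

/-- Polynomial expressions in regular functions `f` on `U` and in exact `q`-forms
`dg₁ ∧ ⋯ ∧ dg_q`, with `gᵢ` regular on `U`. When `U` is affine, such expressions, evaluated by
`evalForm`, give the elements of the symmetric algebra of the module of `q`-forms on `U`. -/
abbrev FormExpr (q : ℕ) (U : V.X.Opens) : Type :=
  MvPolynomial (regularFunctions U ⊕ (Fin q → regularFunctions U)) ℂ

/-- The value of such an expression at `P ∈ U`, in the symmetric algebra of `Λ^q T_P^* X`. -/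
def evalForm {q : ℕ} {U : V.X.Opens} (P : Point V) (hP : P.pt ∈ U) :
    FormExpr q U →ₐ[ℂ] SymmetricAlgebra ℂ (⋀[ℂ]^q (CotangentSpace P)) :=
  MvPolynomial.aeval (Sum.elim
    (fun f ↦ algebraMap ℂ _ (P.eval ⟨f.1, regularFunctions_le hP f.2⟩))
    (fun g ↦ SymmetricAlgebra.ι ℂ _ (exteriorPower.ιMulti ℂ q
      (fun a ↦ differential P ⟨(g a).1, regularFunctions_le hP (g a).2⟩))))

/-- The element `ϖ` of the symmetric algebra of `Λ^q T_P^* X` is the product of `k` non-zero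
decomposable `q`-forms, the `j`-th of which is `η_{j1} ∧ ⋯ ∧ η_{jq}` with `η_{j1}, …, η_{jq}` a
basis of `L j`, where the `q`-dimensional subspaces `L j` of `T_P^* X` are pairwise distinct. -/
def IsProductOfDecomposables {q k : ℕ} {P : Point V}
    (ϖ : SymmetricAlgebra ℂ (⋀[ℂ]^q (CotangentSpace P)))
    (L : Fin k → Submodule ℂ (CotangentSpace P)) : Prop :=
  Function.Injective L ∧ ∃ η : Fin k → Fin q → CotangentSpace P,
    (∀ j, LinearIndependent ℂ (η j) ∧ Submodule.span ℂ (Set.range (η j)) = L j) ∧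
    ϖ = ∏ j, SymmetricAlgebra.ι ℂ _ (exteriorPower.ιMulti ℂ q (η j))

variable (V) in
/-- A (singular) multi-distribution of codimension `q` on `X`: a rational section of `Sym^k Ω^q_X`,
`k ≥ 1`, which at the points of a non-empty affine open set is regular and equal to a product of `k`
decomposable `q`-forms defining pairwise distinct distributions of codimension `q`. -/
structure MultiDistribution (q : ℕ) where
  /-- the open set where the section is regular and generic -/
  U : V.X.Opens
  affine : IsAffineOpen U
  nonempty : (U : Set V.X).Nonempty
  /-- the number of distributions -/
  k : ℕ
  k_pos : 0 < k
  /-- the section of `Sym^k Ω^q` -/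
  form : FormExpr q U
  decomposable : ∀ (P : Point V) (hP : P.pt ∈ U),
    ∃ L : Fin k → Submodule ℂ (CotangentSpace P), IsProductOfDecomposables (evalForm P hP form) L

/-- The conormal spaces at `P` of the distributions which form `M`. -/
def MultiDistribution.conormalSpaces {q : ℕ} (M : MultiDistribution V q) (P : Point V)
    (hP : P.pt ∈ M.U) : Set (Submodule ℂ (CotangentSpace P)) :=
  {Λ | ∃ L : Fin M.k → Submodule ℂ (CotangentSpace P),
    IsProductOfDecomposables (evalForm P hP M.form) L ∧ ∃ j, L j = Λ}

/-- `F` is tangent to `M`: the tangent direction of `F` is contained in the distributions which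
form `M`, that is, it is annihilated by their conormal spaces. -/
def Foliation.IsTangentTo {q : ℕ} (M : MultiDistribution V q) : Prop :=
  ∀ (P : Point V) (hP : P.pt ∈ M.U), ∀ Λ ∈ M.conormalSpaces P hP, ∀ η ∈ Λ,
    ∀ i, ∀ hPi : P.pt ∈ F.U i, η (valueAt (F.gen_mem i) P hPi) = 0

end CharFoliation

end

/-! The linear structure of the fibres of `Y` is read off along the separatrix. Expanding regular
functions in Taylor series along the Zariski dense separatrix embeds `𝒪(U)` into `ℂ⟦t⟧`
(`taylorHom_injective`). Since the curve is invariant, the generator `ξ` of the foliation becomes a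
formal vector field `c d/dt`, with `c = μ t + ⋯` (`exists_formal_restriction`). The leading
coefficient of the curve is an eigenvector of the linear part at `p`, so `r μ` is an eigenvalue `l
i₀`, where `r ≥ 1` is the order of the curve.

The prolongation is linear on the fibres of the cotangent bundle. Along the curve it becomes a
linear differential system with a regular singular point at `t = 0`, whose residue is diagonal with
eigenvalues independent over `ℤ`. There are no resonances, so a formal change of frame makes the
system diagonal with constant coefficients (`PowerSeries.exists_eigenvector`). The ideal of `Y`,
transported and saturated, is invariant by this diagonal derivation, for which the monomials are
weight vectors. Two monomials whose weights differ by an integral multiple of `μ` have the same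
exponents away from `i₀`. The variable of index `i₀` lies in the ideal: since `Y` is contained in
the characteristic variety, the symbol of `ξ` vanishes on `Y`, and this symbol, being a first
integral of the prolongation, becomes a multiple of that variable. Separating weights, the ideal
contains each monomial of each of its elements (`monomial_mem_of_invariant`), so its zero locus is a
finite union of coordinate subspaces. As `ℂ(X)` embeds into the field of fractions of `ℂ⟦t⟧`, the
generic fibre of `Y` over the algebraic closure of `ℂ(X)` is a finite union of linear subspaces
(`exists_zeroLocus_genericIdeal_eq`).

Because `Y` is irreducible, the ideal of its generic fibre is prime, hence it is the ideal of a
single subspace, and the Galois conjugates of this subspace fill the fibre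
(`exists_matrix_of_isPrime`, `exists_conjugates`). Over a smaller open set the conjugates have
entries integral over the regular functions and stay distinct at every point (`exists_linearModel`);
specializing them gives the fibres of `Y`. The product over the conjugates of their Plücker forms
has coefficients in `ℂ(X)` and is the required section of `Sym^k Ω^q`; tangency is the inclusion of
`Y` in the characteristic variety.

A transcendence degree count gives `dim Y = n + q`. If `q = 0`, then `Y` is the zero section; if `q
= n - 1`, then `Y` is the whole characteristic variety. Both are excluded. -/

noncomputable section

namespace CharFoliation

variable {V : SmoothProjectiveVariety}

/-! ### Regular functions on affine open sets -/

/-- The inclusion of the sections over `U` into the field of rational functions. -/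
def sectionToRatFun (U : V.X.Opens) [Nonempty U] : Γ(V.X, U) →+* RatFun V :=
  (V.X.germToFunctionField U).hom

theorem sectionToRatFun_injective (U : V.X.Opens) [Nonempty U] :
    Function.Injective (sectionToRatFun U) :=
  V.X.germToFunctionField_injective U

theorem stalkToRatFun_injective (x : V.X) : Function.Injective (stalkToRatFun V x) :=
  IsFractionRing.injective (V.X.presheaf.stalk x) V.X.functionField

theorem mem_localRing {x : V.X} {f : RatFun V} :
    f ∈ localRing x ↔ ∃ s, stalkToRatFun V x s = f := Iff.rfl

theorem stalkToRatFun_germ {U : V.X.Opens} [Nonempty U] {x : V.X} (hx : x ∈ U) (a : Γ(V.X, U)) :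
    stalkToRatFun V x (V.X.presheaf.germ U x hx a) = sectionToRatFun U a :=
  Scheme.algebraMap_germ_eq_germToFunctionField (X := V.X) hx a

theorem sectionToRatFun_mem {U : V.X.Opens} [Nonempty U] {x : V.X} (hx : x ∈ U)
    (a : Γ(V.X, U)) : sectionToRatFun U a ∈ localRing x :=
  ⟨_, stalkToRatFun_germ hx a⟩

theorem isUnit_stalk_iff {x : V.X} {s : V.X.presheaf.stalk x} (hs : stalkToRatFun V x s ≠ 0) :
    IsUnit s ↔ (stalkToRatFun V x s)⁻¹ ∈ localRing x := by
  constructor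
  · rintro ⟨u, rfl⟩
    refine ⟨(u⁻¹ : (V.X.presheaf.stalk x)ˣ), ?_⟩
    refine eq_inv_of_mul_eq_one_left ?_
    rw [← map_mul]; simp
  · rintro ⟨t, ht⟩
    refine IsUnit.of_mul_eq_one t (stalkToRatFun_injective x ?_)
    rw [map_mul, ht, map_one, mul_inv_cancel₀ hs]

theorem mem_basicOpen_iff {U : V.X.Opens} [Nonempty U] {x : V.X} (hx : x ∈ U) {b : Γ(V.X, U)}
    (hb : sectionToRatFun U b ≠ 0) :
    x ∈ V.X.basicOpen b ↔ (sectionToRatFun U b)⁻¹ ∈ localRing x := by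
  rw [Scheme.mem_basicOpen V.X b x hx, isUnit_stalk_iff, stalkToRatFun_germ]
  rwa [stalkToRatFun_germ]

theorem mem_localRing_iff_section {U : V.X.Opens} (hU : IsAffineOpen U) [Nonempty U] {x : V.X}
    (hx : x ∈ U) {f : RatFun V} : f ∈ localRing x ↔ ∃ a b : Γ(V.X, U), x ∈ V.X.basicOpen b ∧
      sectionToRatFun U b ≠ 0 ∧ f = sectionToRatFun U a / sectionToRatFun U b := by
  constructor
  · rintro ⟨s, rfl⟩
    let _hA := TopCat.Presheaf.algebra_section_stalk V.X.presheaf ⟨x, hx⟩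
    have := hU.isLocalization_stalk ⟨x, hx⟩
    obtain ⟨a, ⟨b, hb⟩, h⟩ := IsLocalization.exists_mk'_eq
      (hU.primeIdealOf ⟨x, hx⟩).asIdeal.primeCompl (s : V.X.presheaf.stalk x)
    have hbu : IsUnit (V.X.presheaf.germ U x hx b) :=
      IsLocalization.map_units (V.X.presheaf.stalk x)
        (⟨b, hb⟩ : (hU.primeIdealOf ⟨x, hx⟩).asIdeal.primeCompl)
    have hb0 : sectionToRatFun U b ≠ 0 := by
      rw [← stalkToRatFun_germ hx]
      exact (hbu.map (stalkToRatFun V x)).ne_zero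
    refine ⟨a, b, (Scheme.mem_basicOpen V.X b x hx).2 hbu, hb0, ?_⟩
    rw [eq_div_iff hb0, ← stalkToRatFun_germ hx, ← stalkToRatFun_germ hx, ← map_mul, ← h]
    congr 1
    exact IsLocalization.mk'_spec _ _ _
  · rintro ⟨a, b, hb, hb0, rfl⟩
    rw [div_eq_mul_inv]
    exact (localRing x).mul_mem (sectionToRatFun_mem hx a) ((mem_basicOpen_iff hx hb0).1 hb)

/-- The denominators of `f` form an ideal. Regularity at each point of `U` says that their basic
open sets cover `U`, so on an affine `U` this ideal contains `1`. -/
theorem mem_regularFunctions_iff_section {U : V.X.Opens} (hU : IsAffineOpen U) [Nonempty U]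
    {f : RatFun V} : f ∈ regularFunctions U ↔ ∃ a : Γ(V.X, U), sectionToRatFun U a = f := by
  rw [mem_regularFunctions]
  constructor
  · intro h
    let D : Ideal Γ(V.X, U) :=
      { carrier := {b | ∃ a, sectionToRatFun U a = sectionToRatFun U b * f}
        add_mem' := by
          rintro b c ⟨a, ha⟩ ⟨d, hd⟩
          exact ⟨a + d, by rw [map_add, map_add, ha, hd, add_mul]⟩
        zero_mem' := ⟨0, by simp⟩
        smul_mem' := by
          rintro c b ⟨a, ha⟩
          exact ⟨c * a, by rw [smul_eq_mul, map_mul, map_mul, ha, mul_assoc]⟩ }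
    have hD : Ideal.span (D : Set Γ(V.X, U)) = ⊤ := by
      rw [← hU.self_le_iSup_basicOpen_iff]
      intro x hx
      obtain ⟨a, b, hb, hb0, rfl⟩ := (mem_localRing_iff_section hU hx).1 (h x hx)
      exact TopologicalSpace.Opens.mem_iSup.2
        ⟨⟨b, a, by rw [mul_div_cancel₀ _ hb0]⟩, hb⟩
    rw [Ideal.span_eq] at hD
    obtain ⟨a, ha⟩ : (1 : Γ(V.X, U)) ∈ D := hD ▸ Submodule.mem_top
    exact ⟨a, by simpa using ha⟩
  · rintro ⟨a, rfl⟩ x hx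
    exact sectionToRatFun_mem hx a

theorem sectionToRatFun_mem_regularFunctions {U : V.X.Opens} [Nonempty U] (a : Γ(V.X, U)) :
    sectionToRatFun U a ∈ regularFunctions U :=
  mem_regularFunctions.2 fun _ hx ↦ sectionToRatFun_mem hx a

/-- The sections over an affine open set are the regular functions. -/
def sectionEquiv {U : V.X.Opens} (hU : IsAffineOpen U) [Nonempty U] :
    Γ(V.X, U) ≃+* regularFunctions U :=
  RingEquiv.ofBijective
    ((sectionToRatFun U).codRestrict (regularFunctions U) sectionToRatFun_mem_regularFunctions)
    ⟨fun _ _ h ↦ sectionToRatFun_injective U (congrArg Subtype.val h), fun f ↦ by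
      obtain ⟨a, ha⟩ := (mem_regularFunctions_iff_section hU).1 f.2
      exact ⟨a, Subtype.ext ha⟩⟩

theorem coe_sectionEquiv {U : V.X.Opens} (hU : IsAffineOpen U) [Nonempty U] (a : Γ(V.X, U)) :
    (sectionEquiv hU a : RatFun V) = sectionToRatFun U a := rfl

theorem regularFunctions_mono {U W : V.X.Opens} (h : W ≤ U) :
    regularFunctions U ≤ regularFunctions W := fun _ hf ↦
  mem_regularFunctions.2 fun _ hx ↦ regularFunctions_le (h hx) hf

theorem vectorFields_mono {U W : V.X.Opens} (h : W ≤ U) {D : RatVectorField V}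
    (hD : D ∈ vectorFields U) : D ∈ vectorFields W := fun x hx ↦ hD x (h hx)

theorem mem_localRing_iff {U : V.X.Opens} (hU : IsAffineOpen U) {x : V.X} (hx : x ∈ U)
    {f : RatFun V} : f ∈ localRing x ↔ ∃ a ∈ regularFunctions U, ∃ b ∈ regularFunctions U,
      b ≠ 0 ∧ b⁻¹ ∈ localRing x ∧ f = a / b := by
  have : Nonempty U := ⟨⟨x, hx⟩⟩
  constructor
  · intro h
    obtain ⟨a, b, hb, hb0, rfl⟩ := (mem_localRing_iff_section hU hx).1 h
    exact ⟨_, sectionToRatFun_mem_regularFunctions a, _, sectionToRatFun_mem_regularFunctions b,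
      hb0, (mem_basicOpen_iff hx hb0).1 hb, rfl⟩
  · rintro ⟨a, ha, b, hb, -, hb', rfl⟩
    rw [div_eq_mul_inv]
    exact (localRing x).mul_mem (regularFunctions_le hx ha) hb'

theorem exists_stalk_mul_eq (x : V.X) (f : RatFun V) :
    ∃ s t : V.X.presheaf.stalk x, t ≠ 0 ∧ f * stalkToRatFun V x t = stalkToRatFun V x s := by
  obtain ⟨⟨s, t⟩, hst⟩ := IsLocalization.surj
    (nonZeroDivisors (V.X.presheaf.stalk x)) (S := V.X.functionField) f
  exact ⟨s, t, nonZeroDivisors.ne_zero t.2, hst⟩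

theorem mem_localRing_genericPoint (f : RatFun V) : f ∈ localRing (genericPoint V.X) := by
  have hF : IsField (V.X.presheaf.stalk (genericPoint V.X)) := Field.toIsField V.X.functionField
  obtain ⟨s, t, ht, hst⟩ := exists_stalk_mul_eq _ f
  obtain ⟨u, hu⟩ := hF.mul_inv_cancel ht
  refine mem_localRing.2 ⟨s * u, ?_⟩
  rw [map_mul, ← hst, mul_assoc, ← map_mul, hu, map_one, mul_one]

theorem genericPoint_mem {U : V.X.Opens} (hne : (U : Set V.X).Nonempty) :
    genericPoint V.X ∈ U :=
  ((genericPoint_spec V.X).mem_open_set_iff U.isOpen).mpr (by simpa using hne)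

theorem exists_eq_div {U : V.X.Opens} (hU : IsAffineOpen U) (hne : (U : Set V.X).Nonempty)
    (f : RatFun V) : ∃ a ∈ regularFunctions U, ∃ b ∈ regularFunctions U, b ≠ 0 ∧ f = a / b := by
  obtain ⟨a, ha, b, hb, h0, -, h⟩ :=
    (mem_localRing_iff hU (genericPoint_mem hne)).1 (mem_localRing_genericPoint f)
  exact ⟨a, ha, b, hb, h0, h⟩

theorem isFractionRing_regularFunctions {U : V.X.Opens} (hU : IsAffineOpen U)
    (hne : (U : Set V.X).Nonempty) : IsFractionRing (regularFunctions U) (RatFun V) :=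
  IsFractionRing.of_field _ _ fun f ↦ by
    obtain ⟨a, ha, b, hb, -, h⟩ := exists_eq_div hU hne f
    exact ⟨⟨a, ha⟩, ⟨b, hb⟩, h⟩

/-- The principal open subset of an affine open set where a regular function does not vanish. -/
theorem exists_principal_open {U : V.X.Opens} (hU : IsAffineOpen U)
    {a : RatFun V} (ha : a ∈ regularFunctions U) (ha0 : a ≠ 0) (hne : (U : Set V.X).Nonempty) :
    ∃ D : V.X.Opens, IsAffineOpen D ∧ D ≤ U ∧ (∀ x, x ∈ D ↔ x ∈ U ∧ a⁻¹ ∈ localRing x) ∧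
      (D : Set V.X).Nonempty := by
  have : Nonempty U := hne.to_subtype
  obtain ⟨s, rfl⟩ := (mem_regularFunctions_iff_section hU).1 ha
  have key : ∀ x, x ∈ V.X.basicOpen s ↔ x ∈ U ∧ (sectionToRatFun U s)⁻¹ ∈ localRing x :=
    fun x ↦ ⟨fun h ↦ ⟨V.X.basicOpen_le s h, (mem_basicOpen_iff (V.X.basicOpen_le s h) ha0).1 h⟩,
      fun h ↦ (mem_basicOpen_iff h.1 ha0).2 h.2⟩
  refine ⟨V.X.basicOpen s, hU.basicOpen s, V.X.basicOpen_le s, key, genericPoint V.X, ?_⟩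
  exact (key _).2 ⟨genericPoint_mem hne, mem_localRing_genericPoint _⟩

theorem exists_principal_open_le {U W : V.X.Opens} (hU : IsAffineOpen U) {x : V.X} (hx : x ∈ U)
    (hxW : x ∈ W) : ∃ a ∈ regularFunctions U, a ≠ 0 ∧ a⁻¹ ∈ localRing x ∧
      ∀ y ∈ U, a⁻¹ ∈ localRing y → y ∈ W := by
  have : Nonempty U := ⟨⟨x, hx⟩⟩
  obtain ⟨f, hfW, hxf⟩ := hU.exists_basicOpen_le ⟨x, hxW⟩ hx
  have hf0 : sectionToRatFun U f ≠ 0 := by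
    rw [← stalkToRatFun_germ hx]
    exact (((Scheme.mem_basicOpen V.X f x hx).1 hxf).map (stalkToRatFun V x)).ne_zero
  exact ⟨_, sectionToRatFun_mem_regularFunctions f, hf0, (mem_basicOpen_iff hx hf0).1 hxf,
    fun y hy hya ↦ hfW ((mem_basicOpen_iff hy hf0).2 hya)⟩

theorem mem_regularFunctions_principal {U D : V.X.Opens} (hU : IsAffineOpen U)
    {a : RatFun V} (ha : a ∈ regularFunctions U) (ha0 : a ≠ 0) (hne : (U : Set V.X).Nonempty)
    (hD : ∀ x, x ∈ D ↔ x ∈ U ∧ a⁻¹ ∈ localRing x) {f : RatFun V} :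
    f ∈ regularFunctions D ↔ ∃ k : ℕ, a ^ k * f ∈ regularFunctions U := by
  have : Nonempty U := hne.to_subtype
  constructor
  · intro hf
    obtain ⟨s, rfl⟩ := (mem_regularFunctions_iff_section hU).1 ha
    obtain rfl : D = V.X.basicOpen s := by
      ext x
      rw [SetLike.mem_coe, SetLike.mem_coe, hD x]
      exact ⟨fun h ↦ (mem_basicOpen_iff h.1 ha0).2 h.2,
        fun h ↦ ⟨V.X.basicOpen_le s h, (mem_basicOpen_iff (V.X.basicOpen_le s h) ha0).1 h⟩⟩
    have : Nonempty (V.X.basicOpen s) :=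
      ⟨⟨_, (hD _).2 ⟨genericPoint_mem hne, mem_localRing_genericPoint _⟩⟩⟩
    obtain ⟨t, rfl⟩ := (mem_regularFunctions_iff_section (hU.basicOpen s)).1 hf
    have := hU.isLocalization_basicOpen s
    obtain ⟨⟨b, ⟨_, k, rfl⟩⟩, hb⟩ := IsLocalization.surj (Submonoid.powers s) t
    have res (c : Γ(V.X, U)) : sectionToRatFun (V.X.basicOpen s)
        (algebraMap Γ(V.X, U) Γ(V.X, V.X.basicOpen s) c) = sectionToRatFun U c :=
      V.X.presheaf.germ_res_apply _ _ _ c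
    refine ⟨k, (mem_regularFunctions_iff_section hU).2 ⟨b, ?_⟩⟩
    rw [← res, ← hb, map_mul, res, map_pow, mul_comm]
  · rintro ⟨k, hk⟩
    refine mem_regularFunctions.2 fun x hx ↦ ?_
    obtain ⟨hxU, hxa⟩ := (hD x).1 hx
    have : f = (a⁻¹) ^ k * (a ^ k * f) := by
      rw [← mul_assoc, ← mul_pow, inv_mul_cancel₀ ha0, one_pow, one_mul]
    rw [this]
    exact mul_mem (pow_mem hxa k) (regularFunctions_le hxU hk)

end CharFoliation

/-! ### Algebras of finite type over `ℂ` -/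

/-- The Nullstellensatz: a prime ideal of a `ℂ`-algebra of finite type is the intersection of the
kernels of the `ℂ`-points that contain it. -/
theorem Ideal.IsPrime.exists_algHom_ne_zero {A : Type*} [CommRing A] [Algebra ℂ A]
    [Algebra.FiniteType ℂ A] {I : Ideal A} (hI : I.IsPrime) {g : A} (hg : g ∉ I) :
    ∃ φ : A →ₐ[ℂ] ℂ, (∀ a ∈ I, φ a = 0) ∧ φ g ≠ 0 := by
  have : IsJacobsonRing A := isJacobsonRing_of_finiteType (A := ℂ)
  have h := this.out hI.isRadical
  rw [← h, Ideal.jacobson, Ideal.mem_sInf] at hg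
  push Not at hg
  obtain ⟨m, ⟨hIm, hm⟩, hgm⟩ := hg
  let _ := Ideal.Quotient.field m
  have : Module.Finite ℂ (A ⧸ m) := finite_of_finite_type_of_isJacobsonRing ℂ (A ⧸ m)
  let e := AlgEquiv.ofBijective (Algebra.ofId ℂ (A ⧸ m))
    (IsAlgClosed.algebraMap_bijective_of_isIntegral (k := ℂ) (K := A ⧸ m))
  refine ⟨e.symm.toAlgHom.comp (Ideal.Quotient.mkₐ ℂ m), fun a ha ↦ ?_, fun h ↦ hgm ?_⟩
  · simp [Ideal.Quotient.eq_zero_iff_mem.2 (hIm ha)]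
  · simpa [Ideal.Quotient.eq_zero_iff_mem] using h

/-! ### Complex points, and finiteness of the rings of functions -/

namespace CharFoliation

variable {V : SmoothProjectiveVariety}

instance (x : V.X) : IsLocalRing (localRing x) :=
  IsLocalRing.of_surjective' (R := V.X.presheaf.stalk x)
    ((stalkToRatFun V x).codRestrict (localRing x) fun s ↦ ⟨s, rfl⟩)
    fun f ↦ by obtain ⟨s, hs⟩ := f.2; exact ⟨s, Subtype.ext hs⟩

theorem isUnit_localRing_iff {x : V.X} {f : localRing x} :
    IsUnit f ↔ f.1 ≠ 0 ∧ (f.1)⁻¹ ∈ localRing x := by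
  constructor
  · rintro ⟨u, rfl⟩
    have h : ((u : localRing x) : RatFun V) * ((u⁻¹ : (localRing x)ˣ) : localRing x) = 1 := by
      rw [← MulMemClass.coe_mul]; simp
    exact ⟨left_ne_zero_of_mul_eq_one h, by
      rw [← eq_inv_of_mul_eq_one_right h]; exact SetLike.coe_mem _⟩
  · rintro ⟨h0, h⟩
    exact IsUnit.of_mul_eq_one ⟨_, h⟩ (Subtype.ext (mul_inv_cancel₀ h0))

/-- The kernel of the evaluation is a maximal ideal of a local ring, so its complement is the set of
units. -/
theorem Point.eval_ne_zero_iff (P : Point V) (f : localRing P.pt) :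
    P.eval f ≠ 0 ↔ f.1 ≠ 0 ∧ (f.1)⁻¹ ∈ localRing P.pt := by
  rw [← isUnit_localRing_iff]
  have hs : Function.Surjective P.eval := fun c ↦ ⟨algebraMap ℂ _ c, by simp⟩
  have hm : (RingHom.ker P.eval).IsMaximal := RingHom.ker_isMaximal_of_surjective _ hs
  have := IsLocalRing.eq_maximalIdeal hm
  rw [← not_iff_not, not_not, ← mem_nonunits_iff, ← IsLocalRing.mem_maximalIdeal, ← this,
    RingHom.mem_ker]

/-- Evaluation at `P ∈ U` of the regular functions on `U`. -/
def Point.evalOn (P : Point V) {U : V.X.Opens} (hP : P.pt ∈ U) : regularFunctions U →ₐ[ℂ] ℂ :=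
  P.eval.comp (Subalgebra.inclusion fun _ hf ↦ regularFunctions_le hP hf)

theorem Point.evalOn_apply (P : Point V) {U : V.X.Opens} (hP : P.pt ∈ U)
    (f : regularFunctions U) : P.evalOn hP f = P.eval ⟨f.1, regularFunctions_le hP f.2⟩ := rfl

theorem Point.evalOn_ne_zero_iff (P : Point V) {U : V.X.Opens} (hP : P.pt ∈ U)
    (f : regularFunctions U) : P.evalOn hP f ≠ 0 ↔ f.1 ≠ 0 ∧ (f.1)⁻¹ ∈ localRing P.pt :=
  P.eval_ne_zero_iff _

/-- The points of an affine open set correspond to the `ℂ`-points of its ring of functions. -/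
theorem exists_point {U : V.X.Opens} (hU : IsAffineOpen U) (hne : (U : Set V.X).Nonempty)
    (φ : regularFunctions U →ₐ[ℂ] ℂ) : ∃ (P : Point V) (hP : P.pt ∈ U), P.evalOn hP = φ := by
  have : Nonempty U := hne.to_subtype
  let ψ : Γ(V.X, U) →+* ℂ := (φ : regularFunctions U →+* ℂ).comp (sectionEquiv hU).toRingHom
  let y : PrimeSpectrum Γ(V.X, U) := ⟨RingHom.ker ψ, RingHom.ker_isPrime ψ⟩
  let x : V.X := hU.fromSpec y
  have hxU : x ∈ U := by
    have : x ∈ Set.range hU.fromSpec := ⟨y, rfl⟩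
    rwa [hU.range_fromSpec] at this
  have hxb (b : Γ(V.X, U)) : x ∈ V.X.basicOpen b ↔ ψ b ≠ 0 := by
    change y ∈ hU.fromSpec ⁻¹ᵁ V.X.basicOpen b ↔ _
    rw [hU.fromSpec_preimage_basicOpen]
    exact PrimeSpectrum.mem_basicOpen _ _
  have rep (f : localRing x) : ∃ a b : regularFunctions U, φ b ≠ 0 ∧ f.1 * b = a := by
    obtain ⟨a, b, hb, hb0, h⟩ := (mem_localRing_iff_section hU hxU).1 f.2
    refine ⟨sectionEquiv hU a, sectionEquiv hU b, (hxb b).1 hb, ?_⟩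
    rw [h, coe_sectionEquiv, coe_sectionEquiv, div_mul_cancel₀ _ hb0]
  choose num den hden hnum using rep
  -- The evaluation at the new point is `a / b ↦ φ a / φ b`. Numerators and denominators are chosen
  -- arbitrarily; independence of the choice then yields every axiom of an algebra homomorphism.
  have key (f : localRing x) (a b : regularFunctions U) (hb : φ b ≠ 0) (h : f.1 * b = a) :
      φ (num f) / φ (den f) = φ a / φ b := by
    rw [div_eq_div_iff (hden f) hb, ← map_mul, ← map_mul]
    congr 1
    refine Subtype.ext ?_
    change (num f).1 * b.1 = a.1 * (den f).1
    rw [← hnum, ← h]; ring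
  have h1 : φ (num 1) / φ (den 1) = 1 := by rw [key 1 1 1 (by simp) (by simp)]; simp
  have h0 : φ (num 0) / φ (den 0) = 0 := by rw [key 0 0 1 (by simp) (by simp)]; simp
  have hmul (f g) : φ (num (f * g)) / φ (den (f * g)) =
      φ (num f) / φ (den f) * (φ (num g) / φ (den g)) := by
    rw [key (f * g) (num f * num g) (den f * den g) (by simp [hden]) ?_]
    · simp [mul_div_mul_comm]
    · change f.1 * g.1 * ((den f).1 * (den g).1) = (num f).1 * (num g).1
      rw [← hnum, ← hnum]; ring
  have hadd (f g) : φ (num (f + g)) / φ (den (f + g)) =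
      φ (num f) / φ (den f) + φ (num g) / φ (den g) := by
    rw [key (f + g) (num f * den g + num g * den f) (den f * den g) (by simp [hden]) ?_]
    · have := hden f
      have := hden g
      simp only [map_add, map_mul]
      field_simp
    · change (f.1 + g.1) * ((den f).1 * (den g).1) =
        (num f).1 * (den g).1 + (num g).1 * (den f).1
      rw [← hnum, ← hnum]; ring
  have hc (c : ℂ) : φ (num (algebraMap ℂ _ c)) / φ (den (algebraMap ℂ _ c)) = c := by
    rw [key (algebraMap ℂ _ c) (algebraMap ℂ _ c) 1 (by simp) (by simp)]; simp
  let ev : localRing x →ₐ[ℂ] ℂ :=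
    { toFun := fun f ↦ φ (num f) / φ (den f)
      map_one' := h1
      map_mul' := hmul
      map_zero' := h0
      map_add' := hadd
      commutes' := hc }
  refine ⟨⟨x, ev⟩, hxU, ?_⟩
  ext f
  change φ (num _) / φ (den _) = φ f
  rw [key _ f 1 (by simp) (by simp)]; simp

instance : Smooth V.str := V.smooth

theorem algebraMap_section {U : V.X.Opens} [Nonempty U] (c : ℂ) :
    sectionToRatFun U ((V.str.appLE ⊤ U le_top).hom
      ((Scheme.ΓSpecIso (.of ℂ)).inv.hom c)) = algebraMap ℂ (RatFun V) c := by
  have h : V.str.appLE ⊤ U le_top = V.str.appTop ≫ V.X.presheaf.map (homOfLE le_top).op := by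
    rw [Scheme.Hom.appTop, Scheme.Hom.app_eq_appLE]
    exact (Scheme.Hom.appLE_map V.str (U := ⊤) (V := V.str ⁻¹ᵁ ⊤) le_rfl (homOfLE le_top).op).symm
  rw [h]
  exact V.X.presheaf.germ_res_apply _ _ _ _

theorem finiteType_regularFunctions {U : V.X.Opens} (hU : IsAffineOpen U)
    (hne : (U : Set V.X).Nonempty) : Algebra.FiniteType ℂ (regularFunctions U) := by
  have : Nonempty U := hne.to_subtype
  have hft := V.str.finiteType_appLE (isAffineOpen_top (Spec (.of ℂ))) hU le_top
  have hs : Function.Surjective (Scheme.ΓSpecIso (.of ℂ)).inv.hom :=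
    (Scheme.ΓSpecIso (.of ℂ)).symm.commRingCatIsoToRingEquiv.surjective
  have h2 := ((hft.comp_surjective (f := (V.str.appLE ⊤ U le_top).hom)
    (g := (sectionEquiv hU).toRingHom) (sectionEquiv hU).surjective).comp
    (RingHom.FiniteType.of_surjective (Scheme.ΓSpecIso (.of ℂ)).inv.hom hs))
  rw [← RingHom.finiteType_algebraMap]
  convert h2
  ext c
  exact (algebraMap_section c).symm

end CharFoliation

/-! ### Derivations -/

/-- A derivation of a domain extends to its field of fractions. -/
theorem Derivation.exists_extension_fractionRing {k A K : Type*} [CommRing k] [CommRing A]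
    [Field K] [Algebra A K] [IsFractionRing A K] [Algebra k A] [Algebra k K] [IsScalarTower k A K]
    (d : Derivation k A K) : ∃ D : Derivation k K K, ∀ a, D (algebraMap A K a) = d a := by
  -- A derivation into `K` is the same as a homomorphism to the dual numbers over `K` which lifts
  -- the inclusion. It extends to fractions because a dual number is invertible as soon as its first
  -- component is.
  let f : A →+* TrivSqZeroExt K K :=
    { toFun := fun a ↦ (algebraMap A K a, d a)
      map_one' := by rw [d.map_one_eq_zero, map_one]; rfl
      map_zero' := by rw [map_zero, map_zero]; rfl
      map_add' := fun a b ↦ by rw [map_add, map_add]; rfl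
      map_mul' := fun a b ↦ by
        refine TrivSqZeroExt.ext ?_ ?_
        · exact map_mul _ a b
        · change d (a * b) = algebraMap A K a • d b + MulOpposite.op (algebraMap A K b) • d a
          rw [d.leibniz, op_smul_eq_smul, algebraMap_smul, algebraMap_smul] }
  have hf : ∀ y : nonZeroDivisors A, IsUnit (f y) := fun y ↦ by
    rw [TrivSqZeroExt.isUnit_iff_isUnit_fst]
    exact IsLocalization.map_units K y
  let g : K →+* TrivSqZeroExt K K := IsLocalization.lift hf
  have hg (a : A) : g (algebraMap A K a) = f a := IsLocalization.lift_eq hf a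
  have hfst (z : K) : (g z).fst = z := by
    have : ((TrivSqZeroExt.fstHom K K K : TrivSqZeroExt K K →+* K).comp g) = RingHom.id K := by
      refine IsLocalization.ringHom_ext (nonZeroDivisors A) ?_
      ext a
      simp only [RingHom.comp_apply, hg]; rfl
    exact RingHom.congr_fun this z
  refine ⟨Derivation.mk'
    { toFun := fun z ↦ (g z).snd
      map_add' := fun x y ↦ by rw [map_add]; rfl
      map_smul' := fun c x ↦ ?_ } fun x y ↦ ?_, fun a ↦ ?_⟩
  · rw [Algebra.smul_def, map_mul, TrivSqZeroExt.snd_mul, hfst,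
      IsScalarTower.algebraMap_apply k A K, hg]
    change _ + MulOpposite.op _ • d (algebraMap k A c) = _
    rw [d.map_algebraMap, smul_zero, add_zero, ← IsScalarTower.algebraMap_apply,
      RingHom.id_apply, algebraMap_smul]
  · change (g (x * y)).snd = _
    rw [map_mul, TrivSqZeroExt.snd_mul, hfst, hfst, op_smul_eq_smul]; rfl
  · change (g _).snd = _
    rw [hg]; rfl

theorem Derivation.sum_apply {k A M ι : Type*} [CommRing k] [CommRing A] [AddCommGroup M]
    [Algebra k A] [Module A M] [Module k M] (s : Finset ι) (D : ι → Derivation k A M) (a : A) :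
    (∑ i ∈ s, D i) a = ∑ i ∈ s, D i a := by
  have h := map_sum (Derivation.coeFnAddMonoidHom (R := k) (A := A) (M := M)) D s
  have := congrFun h a
  rwa [Finset.sum_apply] at this

/-- A derivation is determined by its values on functions whose differentials form a basis. -/
theorem eq_sum_of_leibniz {R S M κ : Type*} [CommRing R] [CommRing S] [CommRing M] [Algebra R S]
    [Fintype κ] (x : κ → S) (B : Module.Basis κ S (Ω[S⁄R]))
    (hB : ∀ k, B k = KaehlerDifferential.D R S (x k)) (ρ : S →+* M) (d : S →+ M)
    (hd : ∀ a b, d (a * b) = ρ a * d b + ρ b * d a) (hR : ∀ r, d (algebraMap R S r) = 0) (s : S) :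
    d s = ∑ k, ρ (B.repr (KaehlerDifferential.D R S s) k) * d (x k) := by
  let _ : Module S M := Module.compHom M ρ
  let _ : Module R M := Module.compHom M (algebraMap R S)
  have : IsScalarTower R S M := ⟨fun r s m ↦ by
    change ρ (r • s) * m = ρ (algebraMap R S r) * (ρ s * m)
    rw [Algebra.smul_def, map_mul, mul_assoc]⟩
  let D : Derivation R S M := Derivation.mk'
    { toFun := d
      map_add' := map_add d
      map_smul' := fun r a ↦ by
        rw [Algebra.smul_def, hd, hR, mul_zero, add_zero]; rfl } hd
  have h1 (a : S) : d a = D.liftKaehlerDifferential (KaehlerDifferential.D R S a) := by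
    rw [Derivation.liftKaehlerDifferential_comp_D]; rfl
  rw [h1, ← B.sum_repr (KaehlerDifferential.D R S s), map_sum]
  refine Finset.sum_congr rfl fun k _ ↦ ?_
  rw [map_smul, hB, ← h1, B.sum_repr]; rfl

/-- Coordinates on a standard smooth algebra, with the dual derivations. -/
theorem exists_dual_derivations {R S k A : Type} [CommRing R] [CommRing S] [Algebra R S]
    [CommRing k] [CommRing A] [Algebra k A] [Algebra.IsStandardSmooth R S] (e : S ≃+* A)
    (hR : ∀ r : R, ∃ c : k, e (algebraMap R S r) = algebraMap k A c)
    (hk : ∀ c : k, ∃ r : R, e (algebraMap R S r) = algebraMap k A c) :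
    ∃ (n : ℕ) (y : Fin n → A) (d : Fin n → Derivation k A A),
      (∀ i j, d i (y j) = if i = j then 1 else 0) ∧
      ∀ (M : Type) [CommRing M] (ρ : A →+* M) (D : A →+ M),
        (∀ a b, D (a * b) = ρ a * D b + ρ b * D a) → (∀ c, D (algebraMap k A c) = 0) →
        ∀ a, D a = ∑ i, ρ (d i a) * D (y i) := by
  obtain ⟨ι, σ, _, _, ⟨P⟩⟩ := Algebra.IsStandardSmooth.out (R := R) (S := S)
  -- The generators outside the range of `P.map` are those not eliminated by the Jacobian minor of
  -- the relations. Their differentials form a basis, and the coefficients in this basis are the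
  -- dual derivations.
  let κ : Type := ((Set.range P.map)ᶜ : Set ι)
  have : Fintype κ := Fintype.ofFinite _
  let eκ : κ ≃ Fin (Fintype.card κ) := Fintype.equivFin κ
  let B := P.basisKaehler.reindex eκ
  let y : Fin (Fintype.card κ) → S := fun k ↦ P.val (eκ.symm k).1
  have hB (k) : B k = KaehlerDifferential.D _ _ (y k) := by simp [B, y]
  let co (k) (s : S) : S := B.repr (KaehlerDifferential.D R S s) k
  have hco_add (k s t) : co k (s + t) = co k s + co k t := by simp [co]
  have hco_mul (k s t) : co k (s * t) = s * co k t + t * co k s := by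
    simp [co, Derivation.leibniz]
  have hco_alg (k) (c : R) : co k (algebraMap _ S c) = 0 := by simp [co]
  have hco_y (k l) : co k (y l) = if k = l then 1 else 0 := by
    simp only [co]
    rw [← hB, B.repr_self, Finsupp.single_apply]
    simp only [eq_comm]
  have hconst (i) (c : k) : co i (e.symm (algebraMap k A c)) = 0 := by
    obtain ⟨r, hr⟩ := hk c
    rw [← hr, e.symm_apply_apply, hco_alg]
  refine ⟨Fintype.card κ, fun i ↦ e (y i), fun i ↦ Derivation.mk'
    { toFun := fun a ↦ e (co i (e.symm a))
      map_add' := fun a b ↦ by rw [map_add, hco_add, map_add]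
      map_smul' := fun c a ↦ by
        rw [Algebra.smul_def, map_mul, hco_mul, hconst, mul_zero, add_zero, map_mul,
          e.apply_symm_apply, RingHom.id_apply, Algebra.smul_def] } fun a b ↦ ?_,
    fun i j ↦ ?_, fun M _ ρ D hD hc a ↦ ?_⟩
  · change e (co i (e.symm (a * b))) = a * e (co i (e.symm b)) + b * e (co i (e.symm a))
    rw [map_mul, hco_mul, map_add, map_mul, map_mul, e.apply_symm_apply, e.apply_symm_apply]
  · change e (co i (e.symm (e (y j)))) = _
    rw [e.symm_apply_apply, hco_y]; split_ifs <;> simp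
  · have := eq_sum_of_leibniz y B hB (ρ.comp e.toRingHom) (D.comp (e : S →+ A))
      (fun a b ↦ (congrArg D (map_mul e a b)).trans (hD _ _)) (fun r ↦ ?_) (e.symm a)
    · simpa using this
    · obtain ⟨c, h⟩ := hR r
      exact (congrArg D h).trans (hc c)

/-! ### Local coordinates on `X` -/

namespace CharFoliation

variable {V : SmoothProjectiveVariety}

/-- A system of coordinates `x₁, …, x_n` on a non-empty affine open set, with the dual vector fields
`∂/∂x₁, …, ∂/∂x_n`. -/
structure CoordSystem (U : V.X.Opens) (n : ℕ) where
  affine : IsAffineOpen U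
  nonempty : (U : Set V.X).Nonempty
  /-- the coordinates -/
  x : Fin n → RatFun V
  x_mem : ∀ i, x i ∈ regularFunctions U
  /-- the dual vector fields -/
  d : Fin n → RatVectorField V
  d_mem : ∀ i, d i ∈ vectorFields U
  d_x : ∀ i j, d i (x j) = if i = j then 1 else 0
  eq_sum : ∀ (D : RatVectorField V) (f : RatFun V), D f = ∑ i, d i f * D (x i)
  tangent_eq_sum : ∀ (P : Point V) (hP : P.pt ∈ U) (v : TangentSpace P) (f : localRing P.pt),
    v.1 f = ∑ i, P.eval ⟨d i f.1, d_mem i _ hP _ f.2⟩ * v.1 ⟨x i, regularFunctions_le hP (x_mem i)⟩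

/-- The restriction of a system of coordinates. -/
def CoordSystem.restrict {U W : V.X.Opens} {n : ℕ} (C : CoordSystem U n) (hW : IsAffineOpen W)
    (hne : (W : Set V.X).Nonempty) (h : W ≤ U) : CoordSystem W n where
  affine := hW
  nonempty := hne
  x := C.x
  x_mem i := regularFunctions_mono h (C.x_mem i)
  d := C.d
  d_mem i := vectorFields_mono h (C.d_mem i)
  d_x := C.d_x
  eq_sum := C.eq_sum
  tangent_eq_sum P hP := C.tangent_eq_sum P (h hP)

theorem mem_vectorFields_iff {U : V.X.Opens} (hU : IsAffineOpen U) {D : RatVectorField V} :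
    D ∈ vectorFields U ↔ ∀ f ∈ regularFunctions U, D f ∈ regularFunctions U := by
  refine ⟨fun h f hf ↦ apply_mem_regularFunctions h hf, fun h x hx f hf ↦ ?_⟩
  obtain ⟨a, ha, b, hb, hb0, hbx, rfl⟩ := (mem_localRing_iff hU hx).1 hf
  have h1 := congrArg D (div_mul_cancel₀ a hb0)
  rw [D.leibniz, smul_eq_mul, smul_eq_mul] at h1
  have h2 : D (a / b) = (D a - a * b⁻¹ * D b) * b⁻¹ := by
    field_simp
    field_simp at h1
    linear_combination h1
  rw [h2]
  exact mul_mem (sub_mem (regularFunctions_le hx (h a ha))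
    (mul_mem (mul_mem (regularFunctions_le hx ha) hbx) (regularFunctions_le hx (h b hb)))) hbx

theorem RatVectorField.ext_of_regularFunctions {U : V.X.Opens} (hU : IsAffineOpen U)
    (hne : (U : Set V.X).Nonempty) {D E : RatVectorField V}
    (h : ∀ f ∈ regularFunctions U, D f = E f) : D = E := by
  ext f
  obtain ⟨a, ha, b, hb, hb0, rfl⟩ := exists_eq_div hU hne f
  have h1 := congrArg D (div_mul_cancel₀ a hb0)
  have h2 := congrArg E (div_mul_cancel₀ a hb0)
  rw [Derivation.leibniz, smul_eq_mul, smul_eq_mul, h a ha, h b hb] at h1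
  rw [Derivation.leibniz, smul_eq_mul, smul_eq_mul] at h2
  exact mul_left_cancel₀ hb0 (by linear_combination h1 - h2)

/-- A smooth morphism is locally standard smooth, and `Spec ℂ` has only one point, so nothing has to
be shrunk on the base. The last clause allows any target `M` because it is needed twice: with the
inclusion in `ℂ(X)`, for rational vector fields, and with the evaluation at a point, for tangent
vectors. -/
theorem exists_regularFunctions_derivations (x : V.X) : ∃ U : V.X.Opens, IsAffineOpen U ∧ x ∈ U ∧
    ∃ (n : ℕ) (y : Fin n → regularFunctions U)
      (d : Fin n → Derivation ℂ (regularFunctions U) (regularFunctions U)),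
      (∀ i j, d i (y j) = if i = j then 1 else 0) ∧
      ∀ (M : Type) [CommRing M] (ρ : regularFunctions U →+* M) (D : regularFunctions U →+ M),
        (∀ a b, D (a * b) = ρ a * D b + ρ b * D a) → (∀ c, D (algebraMap ℂ _ c) = 0) →
        ∀ a, D a = ∑ i, ρ (d i a) * D (y i) := by
  obtain ⟨U₀, hU₀, U, hU, hxU, e, hstd⟩ := Smooth.exists_isStandardSmooth V.str x
  have : Nonempty U := ⟨⟨x, hxU⟩⟩
  obtain rfl : U₀ = ⊤ := by
    have h : V.str x ∈ U₀ := e hxU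
    have : Subsingleton (Spec (.of ℂ)) := inferInstanceAs (Subsingleton (PrimeSpectrum ℂ))
    ext y
    simpa using (Subsingleton.elim (V.str x) y) ▸ h
  let _ : Algebra Γ(Spec (.of ℂ), ⊤) Γ(V.X, U) := (V.str.appLE ⊤ U e).hom.toAlgebra
  have := hstd.toAlgebra
  have hc (z : ℂ) : sectionEquiv hU (algebraMap Γ(Spec (.of ℂ), ⊤) Γ(V.X, U)
      ((Scheme.ΓSpecIso (.of ℂ)).inv.hom z)) = algebraMap ℂ _ z :=
    Subtype.ext (algebraMap_section z)
  refine ⟨U, hU, hxU, exists_dual_derivations (R := Γ(Spec (.of ℂ), ⊤)) (sectionEquiv hU)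
    (fun r ↦ ?_) fun z ↦ ⟨_, hc z⟩⟩
  obtain ⟨z, rfl⟩ := (Scheme.ΓSpecIso (.of ℂ)).symm.commRingCatIsoToRingEquiv.surjective r
  exact ⟨z, hc z⟩

theorem exists_coordSystem (x : V.X) : ∃ (U : V.X.Opens) (n : ℕ), x ∈ U ∧
    Nonempty (CoordSystem U n) := by
  obtain ⟨U, hU, hxU, n, y, d₀, hy, hun⟩ := exists_regularFunctions_derivations x
  have hne : (U : Set V.X).Nonempty := ⟨x, hxU⟩
  have hfr := isFractionRing_regularFunctions hU hne
  choose d hd using fun k ↦ Derivation.exists_extension_fractionRing (K := RatFun V)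
    ((IsLinearMap.mk' (algebraMap (regularFunctions U) (RatFun V)) ⟨map_add _,
      fun a b ↦ map_mul _ a b⟩ : regularFunctions U →ₗ[regularFunctions U] RatFun V).compDer
      (d₀ k))
  have hd' (k) (s : regularFunctions U) : d k s = d₀ k s := hd k s
  have hdmem (k) : d k ∈ vectorFields U := (mem_vectorFields_iff hU).2 fun f hf ↦ by
    have := hd' k ⟨f, hf⟩
    exact this ▸ (d₀ k _).2
  refine ⟨U, n, hxU, ⟨⟨hU, hne, fun k ↦ y k, fun k ↦ (y k).2, d, hdmem, fun i j ↦ ?_, fun D ↦ ?_,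
    fun P hP v g ↦ ?_⟩⟩⟩
  · rw [hd', hy]; split_ifs <;> simp
  · have : D = ∑ i, D (y i) • d i := by
      refine RatVectorField.ext_of_regularFunctions hU hne fun f hf ↦ ?_
      refine (hun (RatFun V) (regularFunctions U).subtype
        ((D : RatFun V →+ RatFun V).comp
          ((regularFunctions U).subtype : regularFunctions U →+ RatFun V))
        (fun a b ↦ D.leibniz a b) (fun c ↦ D.map_algebraMap c) ⟨f, hf⟩).trans ?_
      rw [Derivation.sum_apply]
      refine Finset.sum_congr rfl fun k _ ↦ ?_
      rw [Derivation.smul_apply, smul_eq_mul, mul_comm]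
      congr 1
      exact (hd' k ⟨f, hf⟩).symm
    intro f
    conv_lhs => rw [this]
    rw [Derivation.sum_apply]
    exact Finset.sum_congr rfl fun k _ ↦ by rw [Derivation.smul_apply, smul_eq_mul, mul_comm]
  · have hA (a : RatFun V) (ha : a ∈ regularFunctions U) :
        v.1 ⟨a, regularFunctions_le hP ha⟩ = ∑ i, P.eval ⟨d i a, hdmem i _ hP _
          (regularFunctions_le hP ha)⟩ * v.1 ⟨y i, regularFunctions_le hP (y i).2⟩ := by
      refine (hun ℂ (P.evalOn hP : regularFunctions U →+* ℂ)
        ((v.1 : localRing P.pt →+ ℂ).comp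
          ((Subalgebra.inclusion fun _ hf ↦ regularFunctions_le hP hf :
            regularFunctions U →ₐ[ℂ] localRing P.pt) : regularFunctions U →+ localRing P.pt))
        (fun a b ↦ v.2 ⟨a.1, regularFunctions_le hP a.2⟩ ⟨b.1, regularFunctions_le hP b.2⟩) (fun c ↦ ?_) ⟨a, ha⟩).trans ?_
      · have h1 : v.1 1 = 0 := by simpa using v.2 1 1
        change v.1 (algebraMap ℂ _ c) = 0
        rw [Algebra.algebraMap_eq_smul_one, map_smul, h1, smul_zero]
      · refine Finset.sum_congr rfl fun k _ ↦ ?_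
        congr 1
        exact congrArg P.eval (Subtype.ext (hd' k ⟨a, ha⟩).symm)
    -- Both `v` and `w` are derivations at `P` and they agree on `𝒪(U)`; the Leibniz rule applied to
    -- `g * b = a` carries the equality to fractions.
    let w : TangentSpace P := ∑ i, v.1 ⟨y i, regularFunctions_le hP (y i).2⟩ •
      valueAt (hdmem i) P hP
    have hw (f : localRing P.pt) : w.1 f = ∑ i, P.eval ⟨d i f.1, hdmem i _ hP _ f.2⟩ *
        v.1 ⟨y i, regularFunctions_le hP (y i).2⟩ := by
      simp only [w, AddSubmonoidClass.coe_finsetSum, LinearMap.sum_apply]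
      refine Finset.sum_congr rfl fun k _ ↦ ?_
      rw [mul_comm]; rfl
    rw [← hw]
    obtain ⟨a, ha, b, hb, hb0, hbx, hg⟩ := (mem_localRing_iff hU hP).1 g.2
    have hgb : g * ⟨b, regularFunctions_le hP hb⟩ = ⟨a, regularFunctions_le hP ha⟩ :=
      Subtype.ext (by
        change g.1 * b = a
        rw [hg, div_mul_cancel₀ _ hb0])
    have hb' : P.eval ⟨b, regularFunctions_le hP hb⟩ ≠ 0 := (P.eval_ne_zero_iff _).2 ⟨hb0, hbx⟩
    have h1 := congrArg v.1 hgb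
    have h2 := congrArg w.1 hgb
    rw [v.2, hA a ha, hA b hb, ← hw ⟨b, regularFunctions_le hP hb⟩,
      ← hw ⟨a, regularFunctions_le hP ha⟩] at h1
    rw [w.2] at h2
    exact mul_left_cancel₀ hb' (by linear_combination h1 - h2)

end CharFoliation

/-! ### Dimension and transcendence degree -/

/-- Incomparability gives one inequality, since contraction of primes is strictly monotone. Going-up
gives the other, by lifting chains one prime at a time. -/
theorem ringKrullDim_eq_of_isIntegral {A B : Type*} [CommRing A] [CommRing B] [Algebra A B]
    [Algebra.IsIntegral A B] (hinj : Function.Injective (algebraMap A B)) :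
    ringKrullDim B = ringKrullDim A := by
  refine le_antisymm ?_ ?_
  · refine Order.krullDim_le_of_strictMono (PrimeSpectrum.comap (algebraMap A B)) fun P Q h ↦ ?_
    exact Ideal.IsIntegral.comap_lt_comap (I := P.asIdeal) (J := Q.asIdeal) h
  · refine iSup_le fun p ↦ ?_
    have key : ∃ q : LTSeries (PrimeSpectrum B), q.length = p.length ∧
        PrimeSpectrum.comap (algebraMap A B) q.last = p.last := by
      induction p using RelSeries.inductionOn' with
      | singleton x =>
        obtain ⟨Q, -, hQ, h⟩ := Ideal.exists_ideal_over_prime_of_isIntegral x.asIdeal (⊥ : Ideal B)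
          (by rw [Ideal.comap_bot_of_injective _ hinj]; exact bot_le)
        exact ⟨RelSeries.singleton _ ⟨Q, hQ⟩, rfl, PrimeSpectrum.ext h⟩
      | snoc p x hx ih =>
        obtain ⟨q, hq, hqp⟩ := ih
        have hx' : p.last.asIdeal < x.asIdeal := hx
        obtain ⟨Q, hle, hQ, h⟩ := Ideal.exists_ideal_over_prime_of_isIntegral x.asIdeal
          q.last.asIdeal ((congrArg PrimeSpectrum.asIdeal hqp).trans_le hx'.le)
        have hlt : q.last.asIdeal < Q := lt_of_le_of_ne hle fun e ↦ hx'.ne <| by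
          rw [← h, ← hqp, ← e]; rfl
        refine ⟨q.snoc ⟨Q, hQ⟩ hlt, by simp [hq], ?_⟩
        rw [RelSeries.last_snoc, RelSeries.last_snoc]
        exact PrimeSpectrum.ext h
    obtain ⟨q, hq, -⟩ := key
    rw [← hq]
    exact le_iSup (fun r : LTSeries (PrimeSpectrum B) ↦ (r.length : WithBot ℕ∞)) q

/-- Noether normalization: an integral injective extension changes neither the Krull dimension nor
the transcendence degree, and both are known for polynomial rings. -/
theorem ringKrullDim_eq_of_trdeg_eq {k A : Type} [Field k] [CommRing A] [IsDomain A] [Algebra k A]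
    [Algebra.FiniteType k A] {n : ℕ} (h : Algebra.trdeg k A = n) : ringKrullDim A = n := by
  obtain ⟨s, g, hinj, hint⟩ := exists_integral_inj_algHom_of_fg k A
  let _ : Algebra (MvPolynomial (Fin s) k) A := g.toAlgebra
  have : Algebra.IsIntegral (MvPolynomial (Fin s) k) A := ⟨hint⟩
  have : IsScalarTower k (MvPolynomial (Fin s) k) A := .of_algebraMap_eq' g.comp_algebraMap.symm
  have : FaithfulSMul (MvPolynomial (Fin s) k) A := (faithfulSMul_iff_algebraMap_injective _ _).2 hinj
  have h1 := _root_.trdeg_add_eq k (MvPolynomial (Fin s) k) (A := A)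
  rw [_root_.trdeg_eq_zero (R := MvPolynomial (Fin s) k), MvPolynomial.trdeg_of_isDomain, h] at h1
  rw [ringKrullDim_eq_of_isIntegral (A := MvPolynomial (Fin s) k) hinj,
    MvPolynomial.ringKrullDim_of_isNoetherianRing, ringKrullDim_eq_zero_of_field]
  have : s = n := by simpa using h1
  simp [this]

/-- An open set that meets the smallest member of a chain of irreducible closed sets meets all of
them, and intersecting with it keeps the inclusions strict. -/
theorem topologicalKrullDim_eq_of_cover {X : Type*} [TopologicalSpace X] {d : WithBot ℕ∞}
    [Nonempty X] (h : ∀ x : X, ∃ U : Set X, IsOpen U ∧ x ∈ U ∧ topologicalKrullDim U = d) :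
    topologicalKrullDim X = d := by
  refine le_antisymm ?_ ?_
  · refine iSup_le fun p ↦ ?_
    obtain ⟨x, hx⟩ := p.head.isIrreducible.nonempty
    obtain ⟨U, hU, hxU, rfl⟩ := h x
    have hmem (i) : (((↑) : U → X) ⁻¹' (p i : Set X)).Nonempty :=
      ⟨⟨x, hxU⟩, (LTSeries.head_le p i : (p.head : Set X) ⊆ p i) hx⟩
    let e := TopologicalSpace.IrreducibleCloseds.orderIsoOfIsOpenEmbedding ((↑) : U → X)
      hU.isOpenEmbedding_subtypeVal
    let q : LTSeries (TopologicalSpace.IrreducibleCloseds U) :=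
      { length := p.length
        toFun := fun i ↦ e.symm ⟨p i, hmem i⟩
        step := fun i ↦ e.symm.strictMono (p.step i) }
    exact le_iSup (fun r : LTSeries (TopologicalSpace.IrreducibleCloseds U) ↦
      (r.length : WithBot ℕ∞)) q
  · obtain ⟨U, hU, hxU, rfl⟩ := h (Classical.arbitrary X)
    exact topologicalKrullDim_subspace_le X U

theorem Derivation.aeval_mvPolynomial {k A σ : Type*} [CommRing k] [CommRing A] [Algebra k A]
    [Fintype σ] (D : Derivation k A A) (x : σ → A) (p : MvPolynomial σ k) :
    D (MvPolynomial.aeval x p) = ∑ j, MvPolynomial.aeval x (MvPolynomial.pderiv j p) * D (x j) := by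
  induction p using MvPolynomial.induction_on with
  | C a => simp
  | add p q hp hq => simp only [map_add, hp, hq, add_mul, Finset.sum_add_distrib]
  | mul_X p i hp =>
    classical
    simp only [map_mul, D.leibniz, MvPolynomial.aeval_X, hp, Derivation.leibniz, map_add,
      smul_eq_mul, add_mul, Finset.sum_add_distrib, MvPolynomial.pderiv_X, Finset.mul_sum]
    congr 1
    · rw [Finset.sum_eq_single i]
      · simp
      · intro j _ hj; simp [hj.symm]
      · simp
    · exact Finset.sum_congr rfl fun j _ ↦ by ring

namespace CharFoliation

variable {V : SmoothProjectiveVariety}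

/-- Applying the dual vector fields to a polynomial relation shows that its partial derivatives are
relations too, of smaller degree, hence zero by induction. In characteristic zero the relation is
then a constant. -/
theorem CoordSystem.algebraicIndependent {U : V.X.Opens} {n : ℕ} (C : CoordSystem U n) :
    AlgebraicIndependent ℂ C.x := by
  rw [algebraicIndependent_iff]
  have key : ∀ N, ∀ p : MvPolynomial (Fin n) ℂ, p.totalDegree < N →
      MvPolynomial.aeval C.x p = 0 → p = 0 := by
    intro N
    induction N with
    | zero => intro p hp; simp at hp
    | succ N ih =>
      intro p hp h0
      have hd (i) : MvPolynomial.aeval C.x (MvPolynomial.pderiv i p) = 0 := by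
        have := (C.d i).aeval_mvPolynomial C.x p
        rw [h0, map_zero] at this
        simpa [C.d_x] using this.symm
      have hconst : p = MvPolynomial.C (MvPolynomial.coeff 0 p) := by
        ext m
        rw [MvPolynomial.coeff_C]
        split_ifs with hm
        · rw [hm]
        by_contra hne
        obtain ⟨i, hi⟩ : ∃ i, m i ≠ 0 := by
          by_contra h
          push Not at h
          exact hm (Finsupp.ext fun i ↦ (h i).symm)
        have hlt : (MvPolynomial.pderiv i p).totalDegree < N := by
          have hm' : ∀ b, MvPolynomial.coeff (b + Finsupp.single i 1) p ≠ 0 →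
              (b.sum fun _ e ↦ e) < N := fun b hb ↦ by
            have := MvPolynomial.le_totalDegree (MvPolynomial.mem_support_iff.2 hb)
            rw [Finsupp.sum_add_index' (fun _ ↦ rfl) (fun _ _ _ ↦ rfl),
              Finsupp.sum_single_index rfl] at this
            omega
          have hN : 0 < N := by
            refine (Nat.zero_le _).trans_lt (hm' (m - Finsupp.single i 1) ?_)
            rwa [tsub_add_cancel_of_le (Finsupp.single_le_iff.2 (Nat.one_le_iff_ne_zero.2 hi))]
          refine (Finset.sup_lt_iff hN).2 fun b hb ↦ hm' b fun h ↦ ?_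
          rw [MvPolynomial.mem_support_iff, MvPolynomial.coeff_pderiv, h, zero_mul] at hb
          exact hb rfl
        have hz := ih _ hlt (hd i)
        have := congrArg (MvPolynomial.coeff (m - Finsupp.single i 1)) hz
        rw [MvPolynomial.coeff_pderiv, tsub_add_cancel_of_le
          (Finsupp.single_le_iff.2 (Nat.one_le_iff_ne_zero.2 hi)), MvPolynomial.coeff_zero] at this
        refine (mul_ne_zero hne ?_) this
        exact Nat.cast_add_one_ne_zero _
      rw [hconst, MvPolynomial.aeval_C] at h0
      rw [hconst, (FaithfulSMul.algebraMap_eq_zero_iff ℂ (RatFun V)).1 h0, map_zero]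
  exact fun p hp ↦ key _ p (Nat.lt_succ_self _) hp

-- A derivation of `ℂ(X)` which kills the coordinates is zero. So `ℂ(X)`, essentially of finite type
-- over the field generated by the coordinates, is unramified over it, and therefore algebraic.
open IntermediateField.algebraAdjoinAdjoin in
theorem CoordSystem.trdeg_eq {U : V.X.Opens} {n : ℕ} (C : CoordSystem U n) :
    Algebra.trdeg ℂ (RatFun V) = n := by
  have hft := finiteType_regularFunctions C.affine C.nonempty
  have hfr := isFractionRing_regularFunctions C.affine C.nonempty
  have : Algebra.EssFiniteType (regularFunctions U) (RatFun V) :=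
    Algebra.EssFiniteType.of_isLocalization _ (nonZeroDivisors (regularFunctions U))
  have : Algebra.EssFiniteType ℂ (RatFun V) :=
    Algebra.EssFiniteType.comp ℂ (regularFunctions U) (RatFun V)
  let L := IntermediateField.adjoin ℂ (Set.range C.x)
  have : Algebra.EssFiniteType L (RatFun V) := Algebra.EssFiniteType.of_comp ℂ L (RatFun V)
  have hu : Algebra.FormallyUnramified L (RatFun V) := by
    have h0 (f : Ω[RatFun V⁄L] →ₗ[RatFun V] RatFun V) : f = 0 := by
      have hD : (f.compDer (KaehlerDifferential.D L (RatFun V))).restrictScalars ℂ = 0 := by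
        ext g
        rw [C.eq_sum, Derivation.zero_apply]
        refine Finset.sum_eq_zero fun i _ ↦ ?_
        have : C.x i = algebraMap L (RatFun V)
          ⟨C.x i, IntermediateField.subset_adjoin _ _ ⟨i, rfl⟩⟩ := rfl
        rw [this, Derivation.restrictScalars_apply, Derivation.map_algebraMap, mul_zero]
      ext g
      exact congrArg (fun D : RatVectorField V ↦ D g) hD
    refine ⟨⟨fun a b ↦ sub_eq_zero.1 ?_⟩⟩
    rw [← Module.forall_dual_apply_eq_zero_iff (RatFun V)]
    intro f
    rw [h0 f, LinearMap.zero_apply]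
  have hsep : Algebra.IsSeparable L (RatFun V) := Algebra.FormallyUnramified.isSeparable _ _
  have halg : Algebra.IsAlgebraic (Algebra.adjoin ℂ (Set.range C.x)) (RatFun V) := by
    exact (IsFractionRing.comap_isAlgebraic_iff (K := L)).2 inferInstance
  have hb : IsTranscendenceBasis ℂ C.x :=
    C.algebraicIndependent.isTranscendenceBasis_iff_isAlgebraic.2 halg
  have := hb.cardinalMk_eq_trdeg
  simpa using this.symm

theorem CoordSystem.eq_dim {U W : V.X.Opens} {n m : ℕ} (C : CoordSystem U n)
    (C' : CoordSystem W m) : n = m := by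
  exact_mod_cast C.trdeg_eq.symm.trans C'.trdeg_eq

theorem CoordSystem.trdeg_regularFunctions {U : V.X.Opens} {n : ℕ} (C : CoordSystem U n) :
    Algebra.trdeg ℂ (regularFunctions U) = n := by
  have hfr := isFractionRing_regularFunctions C.affine C.nonempty
  have : Algebra.IsAlgebraic (regularFunctions U) (RatFun V) :=
    (IsFractionRing.comap_isAlgebraic_iff (K := RatFun V)).2 inferInstance
  have : FaithfulSMul (regularFunctions U) (RatFun V) :=
    (faithfulSMul_iff_algebraMap_injective _ _).2 Subtype.val_injective
  have : FaithfulSMul ℂ (regularFunctions U) :=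
    (faithfulSMul_iff_algebraMap_injective _ _).2 (algebraMap ℂ _).injective
  have h := _root_.trdeg_add_eq ℂ (regularFunctions U) (A := RatFun V)
  rwa [_root_.trdeg_eq_zero (R := regularFunctions U), add_zero, C.trdeg_eq] at h

/-- The number of coordinates is the transcendence degree of `ℂ(X)`, hence the same for all the
coordinate charts that cover `X`. -/
theorem topologicalKrullDim_eq {U : V.X.Opens} {n : ℕ} (C : CoordSystem U n) :
    topologicalKrullDim V.X = n := by
  have : Nonempty V.X := ⟨genericPoint V.X⟩
  refine topologicalKrullDim_eq_of_cover fun x ↦ ?_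
  obtain ⟨W, m, hx, ⟨C'⟩⟩ := exists_coordSystem x
  refine ⟨W, W.isOpen, hx, ?_⟩
  have hft := finiteType_regularFunctions C'.affine C'.nonempty
  have hfr := isFractionRing_regularFunctions C'.affine C'.nonempty
  have : Nonempty W := C'.nonempty.to_subtype
  have htr := C'.trdeg_regularFunctions
  rw [C'.eq_dim C] at htr
  refine ((Scheme.homeoOfIso C'.affine.isoSpec).isHomeomorph.topologicalKrullDim_eq).trans ?_
  refine (PrimeSpectrum.topologicalKrullDim_eq_ringKrullDim _).trans ?_
  rw [ringKrullDim_eq_of_ringEquiv (sectionEquiv C'.affine)]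
  exact ringKrullDim_eq_of_trdeg_eq htr

end CharFoliation

/-- A derivation of the ring of coefficients extends to the ring of polynomials, with arbitrary
values on the variables. -/
theorem MvPolynomial.exists_derivation {k A σ : Type*} [CommRing k] [CommRing A] [Algebra k A]
    (d : Derivation k A A) (b : σ → MvPolynomial σ A) :
    ∃ D : Derivation k (MvPolynomial σ A) (MvPolynomial σ A),
      (∀ a, D (C a) = C (d a)) ∧ ∀ j, D (X j) = b j := by
  let f : A →+* TrivSqZeroExt (MvPolynomial σ A) (MvPolynomial σ A) :=
    { toFun := fun a ↦ (C a, C (d a))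
      map_one' := by rw [d.map_one_eq_zero, map_one, map_zero]; rfl
      map_zero' := by rw [map_zero, map_zero, map_zero]; rfl
      map_add' := fun a b ↦ by rw [map_add, map_add, map_add]; rfl
      map_mul' := fun a b ↦ by
        refine TrivSqZeroExt.ext (map_mul _ a b) ?_
        change C (d (a * b)) = C a • C (d b) + MulOpposite.op (C b) • C (d a)
        rw [d.leibniz, op_smul_eq_smul, map_add, smul_eq_mul, smul_eq_mul, map_mul, map_mul]
        rfl }
  let g : MvPolynomial σ A →+* TrivSqZeroExt (MvPolynomial σ A) (MvPolynomial σ A) :=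
    eval₂Hom f fun j ↦ (X j, b j)
  have hgC (a : A) : g (C a) = f a := eval₂Hom_C _ _ _
  have hgX (j : σ) : g (X j) = ((X j, b j) : TrivSqZeroExt _ _) := eval₂Hom_X' _ _ _
  have hfst (z : MvPolynomial σ A) : (g z).fst = z := by
    have : ((TrivSqZeroExt.fstHom (MvPolynomial σ A) (MvPolynomial σ A) (MvPolynomial σ A) :
        TrivSqZeroExt (MvPolynomial σ A) (MvPolynomial σ A) →+* MvPolynomial σ A).comp g) =
        RingHom.id _ := by
      refine MvPolynomial.ringHom_ext (fun a ↦ ?_) fun j ↦ ?_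
      · rw [RingHom.comp_apply, hgC]; rfl
      · rw [RingHom.comp_apply, hgX]; rfl
    exact RingHom.congr_fun this z
  refine ⟨Derivation.mk'
    { toFun := fun z ↦ (g z).snd
      map_add' := fun x y ↦ by rw [map_add]; rfl
      map_smul' := fun c x ↦ ?_ } fun x y ↦ ?_, fun a ↦ ?_, fun j ↦ ?_⟩
  · rw [Algebra.smul_def, map_mul, TrivSqZeroExt.snd_mul, hfst, MvPolynomial.algebraMap_apply, hgC]
    change _ + MulOpposite.op _ • C (d (algebraMap k A c)) = _
    rw [d.map_algebraMap, map_zero, smul_zero, add_zero, ← MvPolynomial.algebraMap_apply,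
      RingHom.id_apply, algebraMap_smul]
  · change (g (x * y)).snd = _
    rw [map_mul, TrivSqZeroExt.snd_mul, hfst, hfst, op_smul_eq_smul]; rfl
  · change (g _).snd = _
    rw [hgC]; rfl
  · change (g _).snd = _
    rw [hgX]; rfl

namespace CharFoliation

variable {V : SmoothProjectiveVariety} {U : V.X.Opens} {n : ℕ}

namespace CoordSystem

variable (C : CoordSystem U n)

/-! ### The cotangent bundle in coordinates -/

theorem tangent_eq (P : Point V) (hP : P.pt ∈ U) (v : TangentSpace P) :
    v = ∑ i, v.1 ⟨C.x i, regularFunctions_le hP (C.x_mem i)⟩ • valueAt (C.d_mem i) P hP := by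
  refine Subtype.ext (LinearMap.ext fun f ↦ ?_)
  rw [C.tangent_eq_sum P hP v f, AddSubmonoidClass.coe_finsetSum, LinearMap.sum_apply]
  exact Finset.sum_congr rfl fun i _ ↦ mul_comm _ _

theorem valueAt_d_x (P : Point V) (hP : P.pt ∈ U) (i j : Fin n) :
    (valueAt (C.d_mem i) P hP).1 ⟨C.x j, regularFunctions_le hP (C.x_mem j)⟩ =
      if i = j then 1 else 0 := by
  have : (⟨C.d i (C.x j), C.d_mem i _ hP _ (regularFunctions_le hP (C.x_mem j))⟩ :
      localRing P.pt) = if i = j then 1 else 0 := by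
    refine Subtype.ext ?_
    change C.d i (C.x j) = _
    rw [C.d_x]; split_ifs <;> rfl
  refine (congrArg P.eval this).trans ?_
  split_ifs <;> simp

/-- The linear coordinates on `T_P^* X`. -/
def cotangentEquiv (P : Point V) (hP : P.pt ∈ U) : CotangentSpace P ≃ₗ[ℂ] (Fin n → ℂ) where
  toFun η i := η (valueAt (C.d_mem i) P hP)
  map_add' _ _ := rfl
  map_smul' _ _ := rfl
  invFun a := ∑ i, a i • differential P ⟨C.x i, regularFunctions_le hP (C.x_mem i)⟩
  left_inv η := by
    ext v
    conv_rhs => rw [C.tangent_eq P hP v, map_sum]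
    rw [LinearMap.sum_apply]
    refine Finset.sum_congr rfl fun i _ ↦ ?_
    rw [map_smul, smul_eq_mul, mul_comm]; rfl
  right_inv a := by
    ext i
    change (∑ j, a j • differential P ⟨C.x j, regularFunctions_le hP (C.x_mem j)⟩)
      (valueAt (C.d_mem i) P hP) = a i
    rw [LinearMap.sum_apply, Finset.sum_eq_single i]
    · change a i * (valueAt (C.d_mem i) P hP).1 _ = _
      rw [C.valueAt_d_x, if_pos rfl, mul_one]
    · intro j _ hj
      change a j * (valueAt (C.d_mem i) P hP).1 _ = _
      rw [C.valueAt_d_x, if_neg hj.symm, mul_zero]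
    · simp

theorem cotangentEquiv_apply (P : Point V) (hP : P.pt ∈ U) (η : CotangentSpace P) (i : Fin n) :
    C.cotangentEquiv P hP η i = η (valueAt (C.d_mem i) P hP) := rfl

theorem cotangentEquiv_symm_apply (P : Point V) (hP : P.pt ∈ U) (a : Fin n → ℂ) :
    (C.cotangentEquiv P hP).symm a =
      ∑ i, a i • differential P ⟨C.x i, regularFunctions_le hP (C.x_mem i)⟩ := rfl

/-- Polynomials in the linear coordinates on the fibres, with coefficients in `𝒪(U)`: the regular
functions on `E(T^*U)`. -/
def evalPoly (e : CotangentBundle V) (he : e.base.pt ∈ U) :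
    MvPolynomial (Fin n) (regularFunctions U) →ₐ[ℂ] ℂ :=
  MvPolynomial.aevalTower (e.base.evalOn he) (C.cotangentEquiv e.base he e.covector)

theorem evalPoly_C (e : CotangentBundle V) (he : e.base.pt ∈ U) (a : regularFunctions U) :
    C.evalPoly e he (MvPolynomial.C a) = e.base.evalOn he a :=
  MvPolynomial.aevalTower_C _ _ _

theorem evalPoly_X (e : CotangentBundle V) (he : e.base.pt ∈ U) (i : Fin n) :
    C.evalPoly e he (MvPolynomial.X i) = e.covector (valueAt (C.d_mem i) e.base he) :=
  MvPolynomial.aevalTower_X _ _ _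

/-- The function on `E(T^*U)`, linear on the fibres, defined by a vector field. -/
def linearForm {D : RatVectorField V} (hD : D ∈ vectorFields U) :
    MvPolynomial (Fin n) (regularFunctions U) :=
  ∑ i, MvPolynomial.C ⟨D (C.x i), apply_mem_regularFunctions hD (C.x_mem i)⟩ * MvPolynomial.X i

theorem evalPoly_linearForm {D : RatVectorField V} (hD : D ∈ vectorFields U)
    (e : CotangentBundle V) (he : e.base.pt ∈ U) :
    C.evalPoly e he (C.linearForm hD) = e.covector (valueAt hD e.base he) := by
  conv_rhs => rw [C.tangent_eq e.base he (valueAt hD e.base he), map_sum]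
  rw [linearForm, map_sum]
  refine Finset.sum_congr rfl fun i _ ↦ ?_
  rw [map_mul, evalPoly_C, evalPoly_X, map_smul]; rfl

/-- The polynomial defined by a symbol. -/
def symbol : SymbolExpr U →ₐ[ℂ] MvPolynomial (Fin n) (regularFunctions U) :=
  MvPolynomial.aeval (Sum.elim (fun f ↦ MvPolynomial.C f) fun D ↦ C.linearForm D.2)

theorem symbol_inl (f : regularFunctions U) :
    C.symbol (MvPolynomial.X (Sum.inl f)) = MvPolynomial.C f := MvPolynomial.aeval_X _ _

theorem symbol_inr (D : vectorFields U) :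
    C.symbol (MvPolynomial.X (Sum.inr D)) = C.linearForm D.2 := MvPolynomial.aeval_X _ _

theorem evalPoly_symbol (e : CotangentBundle V) (he : e.base.pt ∈ U) (g : SymbolExpr U) :
    C.evalPoly e he (C.symbol g) = evalSymbol e he g := by
  have : (C.evalPoly e he).comp C.symbol = evalSymbol e he := by
    refine MvPolynomial.algHom_ext fun s ↦ ?_
    rw [AlgHom.comp_apply, evalSymbol, MvPolynomial.aeval_X]
    rcases s with f | D
    · rw [symbol_inl, evalPoly_C]; rfl
    · rw [symbol_inr, evalPoly_linearForm]; rfl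
  exact DFunLike.congr_fun this g

theorem linearForm_d (i : Fin n) : C.linearForm (C.d_mem i) = MvPolynomial.X i := by
  rw [linearForm, Finset.sum_eq_single i]
  · have : (⟨C.d i (C.x i), apply_mem_regularFunctions (C.d_mem i) (C.x_mem i)⟩ :
        regularFunctions U) = 1 := Subtype.ext ((C.d_x i i).trans (if_pos rfl))
    rw [this, map_one, one_mul]
  · intro j _ hj
    have : (⟨C.d i (C.x j), apply_mem_regularFunctions (C.d_mem i) (C.x_mem j)⟩ :
        regularFunctions U) = 0 := Subtype.ext ((C.d_x i j).trans (if_neg hj.symm))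
    rw [this, map_zero, zero_mul]
  · simp

/-- The variables are the symbols of the dual vector fields. Hence the conditions on `Y` stated with
symbol expressions can be transferred to polynomials in the fibre coordinates. -/
theorem symbol_surjective : Function.Surjective C.symbol := fun p ↦ by
  induction p using MvPolynomial.induction_on with
  | C a => exact ⟨_, C.symbol_inl a⟩
  | add p q hp hq =>
    obtain ⟨a, rfl⟩ := hp
    obtain ⟨b, rfl⟩ := hq
    exact ⟨a + b, map_add _ _ _⟩
  | mul_X p i hp =>
    obtain ⟨a, rfl⟩ := hp
    refine ⟨a * MvPolynomial.X (Sum.inr ⟨C.d i, C.d_mem i⟩), ?_⟩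
    rw [map_mul, symbol_inr, linearForm_d]

theorem isOpen_evalPoly_ne_zero (s : MvPolynomial (Fin n) (regularFunctions U)) :
    IsOpen {e : CotangentBundle V | ∃ he : e.base.pt ∈ U, C.evalPoly e he s ≠ 0} := by
  obtain ⟨g, rfl⟩ := C.symbol_surjective s
  refine TopologicalSpace.isOpen_generateFrom_of_mem ⟨U, g, ?_⟩
  simp only [evalPoly_symbol]

/-- In the coordinates of `U`, a symbol over `W` has coefficients that are regular only on `U ⊓ W`.
Near the base point of `e` they are fractions of functions on `U`, and `b` is a common denominator.
-/
theorem exists_evalPoly_eq_mul_evalSymbol (e : CotangentBundle V) (he : e.base.pt ∈ U)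
    {W : V.X.Opens} (heW : e.base.pt ∈ W) (g : SymbolExpr W) :
    ∃ (b : regularFunctions U) (s : MvPolynomial (Fin n) (regularFunctions U)),
      e.base.evalOn he b ≠ 0 ∧ ∀ (e' : CotangentBundle V) (he' : e'.base.pt ∈ U)
        (heW' : e'.base.pt ∈ W),
        C.evalPoly e' he' s = e'.base.evalOn he' b * evalSymbol e' heW' g := by
  have hreg (f : RatFun V) (hf : f ∈ regularFunctions (U ⊓ W)) :
      ∃ (b a : regularFunctions U), e.base.evalOn he b ≠ 0 ∧ ∀ (e' : CotangentBundle V)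
        (he' : e'.base.pt ∈ U) (heW' : e'.base.pt ∈ W), e'.base.evalOn he' a =
          e'.base.evalOn he' b * e'.base.eval ⟨f, regularFunctions_le (U := U ⊓ W) ⟨he', heW'⟩ hf⟩ := by
    obtain ⟨a, ha, b, hb, hb0, hbx, rfl⟩ :=
      (mem_localRing_iff C.affine he).1 (regularFunctions_le (U := U ⊓ W) ⟨he, heW⟩ hf)
    refine ⟨⟨b, hb⟩, ⟨a, ha⟩, (e.base.evalOn_ne_zero_iff he ⟨b, hb⟩).2 ⟨hb0, hbx⟩,
      fun e' he' heW' ↦ ?_⟩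
    rw [Point.evalOn_apply, Point.evalOn_apply, ← map_mul]
    exact congrArg _ (Subtype.ext (mul_div_cancel₀ a hb0).symm)
  have hsum {ι : Type} (S : Finset ι)
      (φ : ι → ∀ e' : CotangentBundle V, e'.base.pt ∈ U → e'.base.pt ∈ W → ℂ)
      (h : ∀ i, ∃ (b : regularFunctions U) (s : MvPolynomial (Fin n) (regularFunctions U)),
        e.base.evalOn he b ≠ 0 ∧ ∀ (e' : CotangentBundle V) (he' : e'.base.pt ∈ U)
          (heW' : e'.base.pt ∈ W),
          C.evalPoly e' he' s = e'.base.evalOn he' b * φ i e' he' heW') :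
      ∃ (b : regularFunctions U) (s : MvPolynomial (Fin n) (regularFunctions U)),
        e.base.evalOn he b ≠ 0 ∧ ∀ (e' : CotangentBundle V) (he' : e'.base.pt ∈ U)
          (heW' : e'.base.pt ∈ W),
          C.evalPoly e' he' s = e'.base.evalOn he' b * ∑ i ∈ S, φ i e' he' heW' := by
    classical
    induction S using Finset.induction_on with
    | empty => exact ⟨1, 0, by simp, by simp⟩
    | insert i S hi ih =>
      obtain ⟨b, s, hb, hs⟩ := ih
      obtain ⟨b', s', hb', hs'⟩ := h i
      refine ⟨b * b', MvPolynomial.C b * s' + MvPolynomial.C b' * s, by simp [hb, hb'],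
        fun e' he' heW' ↦ ?_⟩
      rw [map_add, map_mul, map_mul, hs e' he' heW', hs' e' he' heW', evalPoly_C, evalPoly_C,
        Finset.sum_insert hi, map_mul]
      ring
  induction g using MvPolynomial.induction_on with
  | C a => exact ⟨1, MvPolynomial.C (algebraMap ℂ _ a), by simp, fun e' he' heW' ↦ by
      rw [evalPoly_C, AlgHom.commutes, map_one, one_mul]
      exact ((evalSymbol e' heW').commutes a).symm⟩
  | add p q hp hq =>
    obtain ⟨b, s, hb, hs⟩ := hp
    obtain ⟨b', s', hb', hs'⟩ := hq
    refine ⟨b * b', MvPolynomial.C b * s' + MvPolynomial.C b' * s, by simp [hb, hb'],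
      fun e' he' heW' ↦ ?_⟩
    rw [map_add, map_mul, map_mul, hs e' he' heW', hs' e' he' heW', evalPoly_C, evalPoly_C,
      map_add, map_mul]
    ring
  | mul_X p i hp =>
    obtain ⟨b, s, hb, hs⟩ := hp
    obtain ⟨b', s', hb', hs'⟩ : ∃ (b : regularFunctions U)
        (s : MvPolynomial (Fin n) (regularFunctions U)),
        e.base.evalOn he b ≠ 0 ∧ ∀ (e' : CotangentBundle V) (he' : e'.base.pt ∈ U)
          (heW' : e'.base.pt ∈ W), C.evalPoly e' he' s =
            e'.base.evalOn he' b * evalSymbol e' heW' (MvPolynomial.X i) := by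
      rcases i with f | D
      · obtain ⟨b, a, hb, h⟩ := hreg f.1 (regularFunctions_mono inf_le_right f.2)
        refine ⟨b, MvPolynomial.C a, hb, fun e' he' heW' ↦ ?_⟩
        rw [evalPoly_C, h e' he' heW', evalSymbol, MvPolynomial.aeval_X]; rfl
      · have hD (i) : D.1 (C.x i) ∈ regularFunctions (U ⊓ W) :=
          apply_mem_regularFunctions (vectorFields_mono inf_le_right D.2)
            (regularFunctions_mono inf_le_left (C.x_mem i))
        obtain ⟨b, s, hb, h⟩ := hsum Finset.univ (fun i e' he' heW' ↦
          e'.base.eval ⟨_, regularFunctions_le (U := U ⊓ W) ⟨he', heW'⟩ (hD i)⟩ *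
            e'.covector (valueAt (C.d_mem i) e'.base he')) fun i ↦ by
          obtain ⟨b, a, hb, h⟩ := hreg _ (hD i)
          refine ⟨b, MvPolynomial.C a * MvPolynomial.X i, hb, fun e' he' heW' ↦ ?_⟩
          rw [map_mul, evalPoly_C, evalPoly_X, h e' he' heW', mul_assoc]
        refine ⟨b, s, hb, fun e' he' heW' ↦ ?_⟩
        rw [h e' he' heW', evalSymbol, MvPolynomial.aeval_X]
        congr 1
        change _ = e'.covector (valueAt D.2 e'.base heW')
        conv_rhs => rw [C.tangent_eq e'.base he' (valueAt D.2 e'.base heW'), map_sum]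
        refine Finset.sum_congr rfl fun i _ ↦ ?_
        rw [map_smul]; rfl
    refine ⟨b * b', s * s', by simp [hb, hb'], fun e' he' heW' ↦ ?_⟩
    rw [map_mul, map_mul, map_mul, hs e' he' heW', hs' e' he' heW']
    ring

/-- Over `U` the topology generated by all symbols is the Zariski topology of the polynomial ring.
The proof follows the generation of the open set; a product of polynomials takes care of an
intersection. -/
theorem exists_evalPoly_ne_zero_subset {O : Set (CotangentBundle V)} (hO : IsOpen O)
    {e : CotangentBundle V} (heO : e ∈ O) (he : e.base.pt ∈ U) :
    ∃ s : MvPolynomial (Fin n) (regularFunctions U), C.evalPoly e he s ≠ 0 ∧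
      ∀ (e' : CotangentBundle V) (he' : e'.base.pt ∈ U), C.evalPoly e' he' s ≠ 0 → e' ∈ O := by
  induction hO with
  | basic B hB =>
    obtain ⟨W, g, rfl⟩ := hB
    obtain ⟨heW, hg⟩ := heO
    obtain ⟨a, ha, ha0, hae, haW⟩ := exists_principal_open_le C.affine he heW
    obtain ⟨b, s, hb, hs⟩ := C.exists_evalPoly_eq_mul_evalSymbol e he heW g
    refine ⟨MvPolynomial.C ⟨a, ha⟩ * s, ?_, fun e' he' hne ↦ ?_⟩
    · rw [map_mul, evalPoly_C, hs e he heW]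
      exact mul_ne_zero ((e.base.evalOn_ne_zero_iff he ⟨a, ha⟩).2 ⟨ha0, hae⟩) (mul_ne_zero hb hg)
    · rw [map_mul, evalPoly_C] at hne
      have heW' := haW _ he' ((e'.base.evalOn_ne_zero_iff he' ⟨a, ha⟩).1
        (left_ne_zero_of_mul hne)).2
      rw [hs e' he' heW'] at hne
      exact ⟨heW', right_ne_zero_of_mul (right_ne_zero_of_mul hne)⟩
  | univ => exact ⟨1, by simp, fun _ _ _ ↦ trivial⟩
  | inter S T _ _ hS hT =>
    obtain ⟨s, hs, hs'⟩ := hS heO.1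
    obtain ⟨t, ht, ht'⟩ := hT heO.2
    refine ⟨s * t, by rw [map_mul]; exact mul_ne_zero hs ht, fun e' he' hne ↦ ?_⟩
    rw [map_mul] at hne
    exact ⟨hs' e' he' (left_ne_zero_of_mul hne), ht' e' he' (right_ne_zero_of_mul hne)⟩
  | sUnion S _ hS =>
    obtain ⟨T, hT, heT⟩ := heO
    obtain ⟨s, hs, hs'⟩ := hS T hT heT
    exact ⟨s, hs, fun e' he' hne ↦ ⟨T, hT, hs' e' he' hne⟩⟩

theorem isOpen_base_mem (C : CoordSystem U n) : IsOpen {e : CotangentBundle V | e.base.pt ∈ U} := by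
  have := C.isOpen_evalPoly_ne_zero 1
  simpa using this

/-- The ideal of the functions on `E(T^*U)` that vanish on `Y`. -/
def vanishing (Y : Set (CotangentBundle V)) : Ideal (MvPolynomial (Fin n) (regularFunctions U)) where
  carrier := {g | ∀ e ∈ Y, ∀ he : e.base.pt ∈ U, C.evalPoly e he g = 0}
  add_mem' ha hb e heY he := by rw [map_add, ha e heY he, hb e heY he, add_zero]
  zero_mem' e _ he := map_zero _
  smul_mem' c g hg e heY he := by rw [smul_eq_mul, map_mul, hg e heY he, mul_zero]

theorem mem_vanishing {Y : Set (CotangentBundle V)} {g : MvPolynomial (Fin n) (regularFunctions U)} :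
    g ∈ C.vanishing Y ↔ ∀ e ∈ Y, ∀ he : e.base.pt ∈ U, C.evalPoly e he g = 0 := Iff.rfl

theorem mem_of_isClosed {Y : Set (CotangentBundle V)} (hY : IsClosed Y) {e : CotangentBundle V}
    (he : e.base.pt ∈ U) (h : ∀ g ∈ C.vanishing Y, C.evalPoly e he g = 0) : e ∈ Y := by
  by_contra heY
  obtain ⟨s, hs, hs'⟩ := C.exists_evalPoly_ne_zero_subset hY.isOpen_compl heY he
  exact hs (h s fun e' heY' he' ↦ by_contra fun hne ↦ hs' e' he' hne heY')

theorem vanishing_isPrime {Y : Set (CotangentBundle V)} (hY : IsIrreducible Y)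
    {e : CotangentBundle V} (heY : e ∈ Y) (he : e.base.pt ∈ U) : (C.vanishing Y).IsPrime := by
  refine ⟨fun h ↦ ?_, fun {s t} hst ↦ ?_⟩
  · have : (1 : MvPolynomial (Fin n) (regularFunctions U)) ∈ C.vanishing Y := h ▸ Submodule.mem_top
    simpa using this e heY he
  · by_contra h
    push Not at h
    simp only [mem_vanishing] at h
    push Not at h
    obtain ⟨⟨e₁, h₁, he₁, hs⟩, e₂, h₂, he₂, ht⟩ := h
    obtain ⟨e', he'Y, ⟨he', hs'⟩, _, ht'⟩ := hY.isPreirreducible _ _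
      (C.isOpen_evalPoly_ne_zero s) (C.isOpen_evalPoly_ne_zero t) ⟨e₁, h₁, he₁, hs⟩
      ⟨e₂, h₂, he₂, ht⟩
    have := hst e' he'Y he'
    rw [map_mul] at this
    exact (mul_ne_zero hs' ht') this

theorem exists_mem_ne_zero (C : CoordSystem U n) {Y : Set (CotangentBundle V)} (hY : Dominates Y)
    {a : regularFunctions U} (ha : a ≠ 0) : ∃ e ∈ Y, ∃ he : e.base.pt ∈ U,
      e.base.evalOn he a ≠ 0 := by
  have ha' : a.1 ≠ 0 := fun h ↦ ha (Subtype.ext h)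
  obtain ⟨D, -, -, hD, hne⟩ := exists_principal_open C.affine a.2 ha' C.nonempty
  obtain ⟨_, hx, e, heY, rfl⟩ := hY.inter_open_nonempty D D.isOpen hne
  obtain ⟨he, hae⟩ := (hD _).1 hx
  exact ⟨e, heY, he, (e.base.evalOn_ne_zero_iff he a).2 ⟨ha', hae⟩⟩

/-- The algebraic form of dominance, which is what permits the passage to the generic fibre. -/
theorem C_mem_vanishing_iff {Y : Set (CotangentBundle V)} (hY : Dominates Y)
    {a : regularFunctions U} : MvPolynomial.C a ∈ C.vanishing Y ↔ a = 0 := by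
  refine ⟨fun h ↦ by_contra fun ha ↦ ?_, fun h ↦ by rw [h, map_zero]; exact Ideal.zero_mem _⟩
  obtain ⟨e, heY, he, hne⟩ := C.exists_mem_ne_zero hY ha
  exact hne ((C.evalPoly_C e he a).symm.trans (h e heY he))

/-! ### The prolongation in coordinates -/

/-- On the symbol of a vector field `D`, the compatibility of `δ` with the prolongation is the
coordinate formula `[ξ, D](xᵢ) = ξ(D(xᵢ)) - ∑ⱼ D(xⱼ) ∂ⱼ(ξ(xᵢ))`. The rest follows from the Leibniz
rule. -/
theorem exists_derivation_symbol {ξ : RatVectorField V} (hξ : ξ ∈ vectorFields U) :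
    ∃ δ : Derivation ℂ (MvPolynomial (Fin n) (regularFunctions U))
        (MvPolynomial (Fin n) (regularFunctions U)),
      (∀ f : regularFunctions U, δ (MvPolynomial.C f) =
        MvPolynomial.C ⟨ξ f.1, apply_mem_regularFunctions hξ f.2⟩) ∧
      (∀ j, δ (MvPolynomial.X j) = -∑ i, MvPolynomial.C
        ⟨C.d j (ξ (C.x i)), apply_mem_regularFunctions (C.d_mem j)
          (apply_mem_regularFunctions hξ (C.x_mem i))⟩ * MvPolynomial.X i) ∧
      ∀ g, C.symbol (prolongation hξ g) = δ (C.symbol g) := by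
  let ξA : Derivation ℂ (regularFunctions U) (regularFunctions U) := Derivation.mk'
    { toFun := fun f ↦ ⟨ξ f.1, apply_mem_regularFunctions hξ f.2⟩
      map_add' := fun f g ↦ Subtype.ext (map_add ξ f.1 g.1)
      map_smul' := fun c f ↦ Subtype.ext (ξ.map_smul c f.1) } fun f g ↦
        Subtype.ext (ξ.leibniz f.1 g.1)
  obtain ⟨δ, h1, h2⟩ := MvPolynomial.exists_derivation ξA fun j ↦ -∑ i, MvPolynomial.C
        ⟨C.d j (ξ (C.x i)), apply_mem_regularFunctions (C.d_mem j)
          (apply_mem_regularFunctions hξ (C.x_mem i))⟩ * MvPolynomial.X i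
  refine ⟨δ, h1, h2, fun g ↦ ?_⟩
  induction g using MvPolynomial.induction_on with
  | C a =>
    rw [← MvPolynomial.algebraMap_eq, Derivation.map_algebraMap, AlgHom.commutes,
      Derivation.map_algebraMap, map_zero]
  | add p q hp hq => simp only [map_add, hp, hq]
  | mul_X p i hp =>
    have hX : C.symbol (prolongation hξ (MvPolynomial.X i)) = δ (C.symbol (MvPolynomial.X i)) := by
      rw [prolongation, MvPolynomial.mkDerivation_X]
      rcases i with f | D
      · rw [Sum.elim_inl, symbol_inl, symbol_inl, h1]; rfl
      · rw [Sum.elim_inr, symbol_inr, symbol_inr, linearForm, linearForm, map_sum]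
        simp only [Derivation.leibniz, h1, h2, smul_eq_mul]
        rw [Finset.sum_add_distrib]
        simp only [mul_neg, Finset.sum_neg_distrib, Finset.mul_sum]
        rw [Finset.sum_comm, ← sub_eq_neg_add, ← Finset.sum_sub_distrib]
        refine Finset.sum_congr rfl fun i _ ↦ ?_
        simp only [← mul_assoc, ← map_mul, ← Finset.sum_mul, ← map_sum]
        rw [mul_comm (MvPolynomial.X i), ← sub_mul, ← map_sub]
        congr 2
        refine Subtype.ext ?_
        change ⁅ξ, D.1⁆ (C.x i) = ξ (D.1 (C.x i)) - _
        rw [Derivation.commutator_apply, C.eq_sum D.1 (ξ (C.x i))]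
        congr 1
        rw [AddSubmonoidClass.coe_finsetSum]
        exact Finset.sum_congr rfl fun j _ ↦ mul_comm _ _
    simp only [Derivation.leibniz, map_mul, map_add, smul_eq_mul, hp, hX]

theorem derivation_mem_vanishing {F : Foliation V} {Y : Set (CotangentBundle V)}
    (hY : F.IsProlongationInvariant Y) {i : F.ι} (hU : U ≤ F.U i)
    (hξ : F.gen i ∈ vectorFields U)
    (δ : Derivation ℂ (MvPolynomial (Fin n) (regularFunctions U))
        (MvPolynomial (Fin n) (regularFunctions U)))
    (hδ : ∀ g, C.symbol (prolongation hξ g) = δ (C.symbol g))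
    {g : MvPolynomial (Fin n) (regularFunctions U)} (hg : g ∈ C.vanishing Y) :
    δ g ∈ C.vanishing Y := by
  obtain ⟨g, rfl⟩ := C.symbol_surjective g
  intro e heY he
  rw [← hδ, evalPoly_symbol]
  exact hY i U C.affine hU hξ g (fun e' heY' he' ↦ by
    rw [← C.evalPoly_symbol]; exact hg e' heY' he') e heY he

end CoordSystem

end CharFoliation

/-! ### Ideals of polynomials over a domain and over its field of fractions -/

section FractionRing

attribute [local instance] MvPolynomial.algebraMvPolynomial

variable {A K σ : Type*} [CommRing A] [IsDomain A] [Field K] [Algebra A K] [IsFractionRing A K]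

theorem MvPolynomial.exists_map_eq_C_mul (g : MvPolynomial σ K) :
    ∃ b : A, b ≠ 0 ∧ ∃ g' : MvPolynomial σ A,
      map (algebraMap A K) g' = C (algebraMap A K b) * g := by
  obtain ⟨⟨g', ⟨_, b, hb, rfl⟩⟩, h⟩ := IsLocalization.surj
    ((nonZeroDivisors A).map (C (σ := σ) : A →+* MvPolynomial σ A)) g
  refine ⟨b, nonZeroDivisors.ne_zero hb, g', ?_⟩
  have h' : g * map (algebraMap A K) (C b) = map (algebraMap A K) g' := h
  rw [← h', map_C, mul_comm]

theorem MvPolynomial.mem_map_ideal_iff {I : Ideal (MvPolynomial σ A)} {g : MvPolynomial σ K} :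
    g ∈ I.map (map (algebraMap A K)) ↔
      ∃ b : A, b ≠ 0 ∧ ∃ g' ∈ I, map (algebraMap A K) g' = C (algebraMap A K b) * g := by
  refine (IsLocalization.mem_map_algebraMap_iff
    ((nonZeroDivisors A).map (C (σ := σ) : A →+* MvPolynomial σ A)) (MvPolynomial σ K)).trans
    ⟨?_, ?_⟩
  · rintro ⟨⟨⟨g', hg'⟩, ⟨_, b, hb, rfl⟩⟩, h⟩
    refine ⟨b, nonZeroDivisors.ne_zero hb, g', hg', ?_⟩
    have h' : g * map (algebraMap A K) (C b) = map (algebraMap A K) g' := h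
    rw [← h', map_C, mul_comm]
  · rintro ⟨b, hb, g', hg', h⟩
    refine ⟨⟨⟨g', hg'⟩, ⟨_, b, mem_nonZeroDivisors_of_ne_zero hb, rfl⟩⟩, ?_⟩
    change g * map (algebraMap A K) (C b) = map (algebraMap A K) g'
    rw [h, map_C, mul_comm]

variable {I : Ideal (MvPolynomial σ A)}

/-- A prime ideal without non-zero constants is saturated: the denominator can be cancelled. -/
theorem MvPolynomial.map_mem_map_ideal_iff (hI : I.IsPrime) (h0 : ∀ a, C a ∈ I → a = 0)
    {g : MvPolynomial σ A} : map (algebraMap A K) g ∈ I.map (map (algebraMap A K)) ↔ g ∈ I := by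
  refine ⟨fun h ↦ ?_, Ideal.mem_map_of_mem _⟩
  obtain ⟨b, hb, g', hg', h⟩ := mem_map_ideal_iff.1 h
  rw [← map_C, ← map_mul] at h
  rw [map_injective _ (IsFractionRing.injective A K) h] at hg'
  exact (hI.mem_or_mem hg').resolve_left fun h ↦ hb (h0 b h)

theorem MvPolynomial.map_ideal_isPrime (hI : I.IsPrime) (h0 : ∀ a, C a ∈ I → a = 0) :
    (I.map (map (algebraMap A K))).IsPrime := by
  change (I.map (algebraMap (MvPolynomial σ A) (MvPolynomial σ K))).IsPrime
  refine IsLocalization.isPrime_of_isPrime_disjoint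
    ((nonZeroDivisors A).map (C (σ := σ) : A →+* MvPolynomial σ A)) (MvPolynomial σ K) I hI ?_
  rw [Set.disjoint_left]
  rintro _ ⟨b, hb, rfl⟩ h
  exact nonZeroDivisors.ne_zero hb (h0 b h)

end FractionRing

/-! ### The ideal of the generic fibre of `Y` -/

namespace CharFoliation

variable {V : SmoothProjectiveVariety} {U : V.X.Opens} {n : ℕ}

theorem Foliation.apply_covector_eq_zero (F : Foliation V) {e : CotangentBundle V} {i j : F.ι}
    (hi : e.base.pt ∈ F.U i) (hj : e.base.pt ∈ F.U j)
    (h : e.covector (valueAt (F.gen_mem i) e.base hi) = 0) :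
    e.covector (valueAt (F.gen_mem j) e.base hj) = 0 := by
  obtain ⟨g, hg, -, hij⟩ := F.compat j i
  have hge := regularFunctions_le (U := F.U j ⊓ F.U i) (x := e.base.pt) ⟨hj, hi⟩ hg
  have : valueAt (F.gen_mem j) e.base hj =
      e.base.eval ⟨g, hge⟩ • valueAt (F.gen_mem i) e.base hi := by
    refine Subtype.ext (LinearMap.ext fun f ↦ ?_)
    change e.base.eval _ = e.base.eval _ * e.base.eval _
    rw [← map_mul]
    refine congrArg _ (Subtype.ext ?_)
    change F.gen j f.1 = g * F.gen i f.1
    rw [hij]; rfl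
  rw [this, map_smul, h, smul_zero]

/-- The non-vanishing locus of the symbol of a local generator is open and misses the covectors
whose closure is the characteristic variety. -/
theorem Foliation.apply_covector_eq_zero_of_mem (F : Foliation V) {e : CotangentBundle V}
    (he : e ∈ F.characteristicVariety) {i : F.ι} (hi : e.base.pt ∈ F.U i) :
    e.covector (valueAt (F.gen_mem i) e.base hi) = 0 := by
  by_contra hne
  have hO : IsOpen {e : CotangentBundle V | ∃ he : e.base.pt ∈ F.U i, evalSymbol e he
      (MvPolynomial.X (Sum.inr ⟨F.gen i, F.gen_mem i⟩)) ≠ 0} :=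
    TopologicalSpace.isOpen_generateFrom_of_mem ⟨_, _, rfl⟩
  obtain ⟨e', ⟨he', hne'⟩, -, h⟩ := mem_closure_iff.1 he _ hO ⟨hi, by
    rw [evalSymbol, MvPolynomial.aeval_X]; exact hne⟩
  rw [evalSymbol, MvPolynomial.aeval_X] at hne'
  exact hne' (h i he')

namespace CoordSystem

variable (C : CoordSystem U n) {Y : Set (CotangentBundle V)}

theorem exists_mem (hY : Dominates Y) (C : CoordSystem U n) : ∃ e ∈ Y, e.base.pt ∈ U := by
  have := isFractionRing_regularFunctions C.affine C.nonempty
  obtain ⟨e, he, h, -⟩ := C.exists_mem_ne_zero hY one_ne_zero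
  exact ⟨e, he, h⟩

theorem vanishing_isPrime_of_dominates (hY : IsIrreducible Y) (hd : Dominates Y) :
    (C.vanishing Y).IsPrime := by
  obtain ⟨e, he, h⟩ := C.exists_mem hd
  exact C.vanishing_isPrime hY he h

theorem linearForm_mem_vanishing {F : Foliation V} (hY : Y ⊆ F.characteristicVariety) {i : F.ι}
    (hU : U ≤ F.U i) (hξ : F.gen i ∈ vectorFields U) : C.linearForm hξ ∈ C.vanishing Y := by
  intro e he heU
  rw [evalPoly_linearForm]
  exact F.apply_covector_eq_zero_of_mem (hY he) (hU heU)

/-- The ideal of the generic fibre of `Y`. -/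
def genericIdeal (Y : Set (CotangentBundle V)) : Ideal (MvPolynomial (Fin n) (RatFun V)) :=
  (C.vanishing Y).map (MvPolynomial.map (algebraMap (regularFunctions U) (RatFun V)))

theorem mem_genericIdeal_iff {g : MvPolynomial (Fin n) (RatFun V)} :
    g ∈ C.genericIdeal Y ↔ ∃ b : regularFunctions U, b ≠ 0 ∧ ∃ g' ∈ C.vanishing Y,
      MvPolynomial.map (algebraMap (regularFunctions U) (RatFun V)) g' =
        MvPolynomial.C b.1 * g := by
  have := isFractionRing_regularFunctions C.affine C.nonempty
  exact MvPolynomial.mem_map_ideal_iff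

theorem map_mem_genericIdeal_iff (hY : IsIrreducible Y) (hd : Dominates Y)
    {g : MvPolynomial (Fin n) (regularFunctions U)} :
    MvPolynomial.map (algebraMap (regularFunctions U) (RatFun V)) g ∈ C.genericIdeal Y ↔
      g ∈ C.vanishing Y := by
  have := isFractionRing_regularFunctions C.affine C.nonempty
  exact MvPolynomial.map_mem_map_ideal_iff (C.vanishing_isPrime_of_dominates hY hd)
    fun a ↦ (C.C_mem_vanishing_iff hd).1

theorem genericIdeal_isPrime (hY : IsIrreducible Y) (hd : Dominates Y) :
    (C.genericIdeal Y).IsPrime := by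
  have := isFractionRing_regularFunctions C.affine C.nonempty
  exact MvPolynomial.map_ideal_isPrime (C.vanishing_isPrime_of_dominates hY hd)
    fun a ↦ (C.C_mem_vanishing_iff hd).1

section Restrict

variable {W : V.X.Opens} (hW : IsAffineOpen W) (hne : (W : Set V.X).Nonempty) (h : W ≤ U)

/-- The restriction of functions from `E(T^*U)` to `E(T^*W)`. -/
def res (n : ℕ) (h : W ≤ U) : MvPolynomial (Fin n) (regularFunctions U) →+*
    MvPolynomial (Fin n) (regularFunctions W) :=
  MvPolynomial.map (Subalgebra.inclusion (regularFunctions_mono h)).toRingHom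

theorem map_res (g : MvPolynomial (Fin n) (regularFunctions U)) :
    MvPolynomial.map (algebraMap (regularFunctions W) (RatFun V)) (res n h g) =
      MvPolynomial.map (algebraMap (regularFunctions U) (RatFun V)) g := by
  rw [res, MvPolynomial.map_map]; rfl

theorem evalPoly_res (e : CotangentBundle V) (he : e.base.pt ∈ W)
    (g : MvPolynomial (Fin n) (regularFunctions U)) :
    (C.restrict hW hne h).evalPoly e he (res n h g) = C.evalPoly e (h he) g := by
  induction g using MvPolynomial.induction_on with
  | C a => rw [res, MvPolynomial.map_C, evalPoly_C, evalPoly_C]; rfl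
  | add p q hp hq => rw [map_add, map_add, map_add, hp, hq]
  | mul_X p i hp =>
    rw [map_mul, map_mul, map_mul, hp, evalPoly_X, res, MvPolynomial.map_X, evalPoly_X]; rfl

/-- If `g` vanishes on the part of `Y` over `W`, then `a * g` vanishes on `Y` over `U` for a
function `a ≠ 0` whose principal open set lies in `W`. The ideal is prime and contains no non-zero
function of the base, so `a` can be dropped. -/
theorem res_mem_vanishing_iff (hY : IsIrreducible Y) (hd : Dominates Y)
    {g : MvPolynomial (Fin n) (regularFunctions U)} :
    res n h g ∈ (C.restrict hW hne h).vanishing Y ↔ g ∈ C.vanishing Y := by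
  refine ⟨fun hg ↦ ?_, fun hg e heY he ↦ ?_⟩
  · obtain ⟨x, hx⟩ := hne
    obtain ⟨a, ha, ha0, -, haW⟩ := exists_principal_open_le C.affine (h hx) hx
    have : MvPolynomial.C (⟨a, ha⟩ : regularFunctions U) * g ∈ C.vanishing Y := by
      intro e heY he
      rw [map_mul, evalPoly_C]
      by_cases h0 : e.base.evalOn he ⟨a, ha⟩ = 0
      · rw [h0, zero_mul]
      · have heW := haW _ he ((e.base.evalOn_ne_zero_iff he _).1 h0).2
        rw [← C.evalPoly_res hW ⟨x, hx⟩ h e heW g, hg e heY heW, mul_zero]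
    refine ((C.vanishing_isPrime_of_dominates hY hd).mem_or_mem this).resolve_left fun h0 ↦ ha0 ?_
    exact congrArg Subtype.val ((C.C_mem_vanishing_iff hd).1 h0)
  · rw [evalPoly_res]
    exact hg e heY _

theorem genericIdeal_restrict (hY : IsIrreducible Y) (hd : Dominates Y) :
    (C.restrict hW hne h).genericIdeal Y = C.genericIdeal Y := by
  have := isFractionRing_regularFunctions C.affine C.nonempty
  apply le_antisymm
  · rw [genericIdeal, Ideal.map_le_iff_le_comap]
    intro g hg
    obtain ⟨b, hb, g', hg'⟩ := MvPolynomial.exists_map_eq_C_mul (A := regularFunctions U)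
      (MvPolynomial.map (algebraMap (regularFunctions W) (RatFun V)) g)
    refine C.mem_genericIdeal_iff.2 ⟨b, hb, g', ?_, hg'⟩
    rw [← C.res_mem_vanishing_iff hW hne h hY hd]
    have : res n h g' = MvPolynomial.C ⟨b.1, regularFunctions_mono h b.2⟩ * g := by
      apply MvPolynomial.map_injective (algebraMap (regularFunctions W) (RatFun V))
        Subtype.val_injective
      rw [map_res, hg', map_mul, MvPolynomial.map_C]; rfl
    rw [this]
    exact Ideal.mul_mem_left _ _ hg
  · rw [genericIdeal, Ideal.map_le_iff_le_comap]
    intro g hg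
    rw [Ideal.mem_comap, ← map_res h]
    exact Ideal.mem_map_of_mem _ ((C.res_mem_vanishing_iff hW hne h hY hd).2 hg)

end Restrict

end CoordSystem

end CharFoliation

/-! ### Linear differential equations with a regular singular point -/

theorem exists_seq_eq_of_strong_recursion {α : Type*} (F : (k : ℕ) → (∀ b < k, α) → α) :
    ∃ s : ℕ → α, ∀ k, s k = F k fun b _ ↦ s b :=
  ⟨fun k ↦ Nat.strongRec F k, fun k ↦ Nat.strongRec_eq F k⟩

namespace PowerSeries

theorem exists_X_mul_of_coeff_zero {c : PowerSeries ℂ} (h : coeff 0 c = 0) :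
    ∃ c₁ : PowerSeries ℂ, c = X * c₁ ∧ coeff 0 c₁ = coeff 1 c := by
  obtain ⟨c₁, rfl⟩ := X_dvd_iff.2 ((coeff_zero_eq_constantCoeff_apply c).symm.trans h)
  exact ⟨c₁, rfl, by rw [← zero_add 1, coeff_succ_X_mul]⟩

theorem coeff_X_mul_derivative (w : PowerSeries ℂ) (k : ℕ) :
    coeff k (X * derivative ℂ w) = k * coeff k w := by
  cases k with
  | zero => simp
  | succ k =>
    rw [coeff_succ_X_mul, coeff_derivative, mul_comm]
    push_cast; rfl

theorem coeff_mul_eq_sum_range (f g : PowerSeries ℂ) (k : ℕ) :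
    coeff k (f * g) = ∑ b ∈ Finset.range k, coeff (k - b) f * coeff b g + coeff 0 f * coeff k g := by
  rw [mul_comm, coeff_mul, Finset.Nat.sum_antidiagonal_eq_sum_range_succ_mk,
    Finset.sum_range_succ, Nat.sub_self, mul_comm (coeff k g)]
  exact congrArg (· + _) (Finset.sum_congr rfl fun b _ ↦ mul_comm _ _)

/-- Existence of an eigenvector `w` of the operator `w ↦ c w' + B w`, with given initial value. -/
theorem exists_eigenvector {n : ℕ} {c : PowerSeries ℂ} {μ : ℂ} (hc0 : coeff 0 c = 0)
    (hc1 : coeff 1 c = μ) (B : Fin n → Fin n → PowerSeries ℂ) (l : Fin n → ℂ)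
    (hB : ∀ i j, coeff 0 (B i j) = if i = j then l i else 0) (j : Fin n)
    (hl : ∀ k : ℕ, k ≠ 0 → ∀ i, k * μ + l i - l j ≠ 0) :
    ∃ w : Fin n → PowerSeries ℂ, (∀ i, coeff 0 (w i) = if i = j then 1 else 0) ∧
      ∀ i, c * derivative ℂ (w i) + ∑ k, B i k * w k = C (l j) * w i := by
  obtain ⟨c₁, rfl, hc₁⟩ := exists_X_mul_of_coeff_zero hc0
  rw [hc1] at hc₁
  -- The coefficient of `t ^ k` in the equation reads `(k μ + l i - l j) s k i = -(terms with b <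
  -- k)`, because `t d/dt` multiplies `t ^ b` by `b`. For `k = 0` the equation holds with the
  -- prescribed initial value.
  obtain ⟨s, hs⟩ := exists_seq_eq_of_strong_recursion (α := Fin n → ℂ) fun k s i ↦
    if k = 0 then if i = j then 1 else 0 else
      -(∑ b : Fin k, (coeff (k - b.1) c₁ * (b.1 * s b.1 b.2 i) +
        ∑ m, coeff (k - b.1) (B i m) * s b.1 b.2 m)) / (k * μ + l i - l j)
  have h0 (i) : s 0 i = if i = j then 1 else 0 := (congrFun (hs 0) i).trans (if_pos rfl)
  refine ⟨fun i ↦ mk fun k ↦ s k i, fun i ↦ by rw [coeff_mk, h0], fun i ↦ ?_⟩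
  ext k
  have e1 : X * c₁ * derivative ℂ (mk fun k ↦ s k i) =
      c₁ * (X * derivative ℂ (mk fun k ↦ s k i)) := by ring
  rw [e1, map_add, coeff_mul_eq_sum_range, map_sum, coeff_C_mul]
  simp only [coeff_mul_eq_sum_range (B _ _), coeff_X_mul_derivative, hB, hc₁, coeff_mk, ite_mul,
    zero_mul, Finset.sum_add_distrib, Finset.sum_ite_eq, Finset.mem_univ, if_true]
  rcases eq_or_ne k 0 with rfl | hk
  · simp only [Finset.range_zero, Finset.sum_empty, Finset.sum_const_zero, h0]
    split_ifs with h
    · rw [h]; simp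
    · simp
  · have h1 : s k i * (k * μ + l i - l j) = -(∑ b : Fin k, (coeff (k - b.1) c₁ * (b.1 * s b.1 i) +
        ∑ m, coeff (k - b.1) (B i m) * s b.1 m)) := by
      rw [(congrFun (hs k) i).trans (if_neg hk), div_mul_cancel₀ _ (hl k hk i)]
    rw [Fin.sum_univ_eq_sum_range (fun b ↦ coeff (k - b) c₁ * (b * s b i) +
        ∑ m, coeff (k - b) (B i m) * s b m), Finset.sum_add_distrib, Finset.sum_comm] at h1
    linear_combination h1

theorem exists_eq_X_pow_mul {b : PowerSeries ℂ} (hb : b ≠ 0) :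
    ∃ (k : ℕ) (u : PowerSeries ℂ), b = X ^ k * u ∧ coeff 0 u ≠ 0 := by
  refine ⟨b.order.toNat, b.divXPowOrder, b.X_pow_order_mul_divXPowOrder.symm, ?_⟩
  rw [coeff_zero_eq_constantCoeff_apply]
  exact b.constantCoeff_divXPowOrder_eq_zero_iff.not.2 hb

/-- The exponents of the solutions of `c u' = ν u` are integers. -/
theorem exists_eq_int_mul {c b b₁ : PowerSeries ℂ} {μ ν : ℂ} (hc0 : coeff 0 c = 0)
    (hc1 : coeff 1 c = μ) (hb : b ≠ 0) (hb₁ : b₁ ≠ 0)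
    (h : c * (b * derivative ℂ b₁ - derivative ℂ b * b₁) = C ν * (b * b₁)) :
    ∃ e : ℤ, ν = e * μ := by
  obtain ⟨c₁, rfl, hc₁⟩ := exists_X_mul_of_coeff_zero hc0
  rw [hc1] at hc₁
  -- The equation says that `b₁ / b` solves `c u' = ν u`. If `b` and `b₁` have orders `k` and `l`,
  -- comparison of the leading coefficients gives `(l - k) μ = ν`.
  obtain ⟨k, u, rfl, hu⟩ := exists_eq_X_pow_mul hb
  obtain ⟨l, v, rfl, hv⟩ := exists_eq_X_pow_mul hb₁
  have hd (k : ℕ) (u : PowerSeries ℂ) : X * derivative ℂ (X ^ k * u) =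
      X ^ k * (C (k : ℂ) * u + X * derivative ℂ u) := by
    have hC : (C (k : ℂ) : PowerSeries ℂ) = (k : PowerSeries ℂ) := map_natCast C k
    rw [hC]
    cases k with
    | zero => simp
    | succ k =>
      rw [Derivation.leibniz, Derivation.leibniz_pow, derivative_X]
      simp only [smul_eq_mul, nsmul_eq_mul, Nat.add_sub_cancel]
      ring
  have h1 : X ^ (k + l) * (c₁ * (u * (C (l : ℂ) * v + X * derivative ℂ v) -
      (C (k : ℂ) * u + X * derivative ℂ u) * v)) = X ^ (k + l) * (C ν * (u * v)) := by
    have h2 := hd k u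
    have h3 := hd l v
    rw [pow_add]
    linear_combination h + c₁ * X ^ l * v * h2 - c₁ * X ^ k * u * h3
  have h2 := congrArg (coeff 0) (mul_left_cancel₀ (pow_ne_zero _ X_ne_zero) h1)
  simp only [coeff_zero_eq_constantCoeff_apply, map_mul, map_sub, map_add, constantCoeff_C,
    constantCoeff_X, zero_mul, add_zero] at h2 hc₁ hu hv
  refine ⟨l - k, mul_right_cancel₀ (mul_ne_zero hu hv) ?_⟩
  rw [← h2, hc₁]; push_cast; ring

end PowerSeries

/-! ### Invariant ideals in diagonal form -/

section Diagonal

open MvPolynomial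

variable {n : ℕ} {c : PowerSeries ℂ} {l : Fin n → ℂ}

/-- Monomials are weight vectors: the derivation acts on the coefficient of each one separately,
with the weight of the monomial subtracted. -/
theorem coeff_diagonal_derivation
    (δ : Derivation ℂ (MvPolynomial (Fin n) (PowerSeries ℂ)) (MvPolynomial (Fin n) (PowerSeries ℂ)))
    (hC : ∀ a, δ (C a) = C (c * PowerSeries.derivative ℂ a))
    (hX : ∀ j, δ (X j) = -(C (PowerSeries.C (l j)) * X j))
    (f : MvPolynomial (Fin n) (PowerSeries ℂ)) (m : Fin n →₀ ℕ) :
    coeff m (δ f) = c * PowerSeries.derivative ℂ (coeff m f) -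
      PowerSeries.C (∑ j, m j * l j) * coeff m f := by
  induction f using MvPolynomial.induction_on generalizing m with
  | C a =>
    rw [hC, coeff_C, coeff_C]
    split_ifs with h
    · rw [← h]; simp
    · simp
  | add p q hp hq =>
    rw [map_add, coeff_add, coeff_add, hp, hq, map_add]; ring
  | mul_X p i hp =>
    have e : δ (p * X i) = (-(C (PowerSeries.C (l i)) * p) + δ p) * X i := by
      rw [δ.leibniz, hX, smul_eq_mul, smul_eq_mul]; ring
    rw [e, coeff_mul_X', coeff_mul_X']
    split_ifs with h
    · rw [coeff_add, hp, coeff_neg, coeff_C_mul]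
      have h1 : ∑ j, (m j : ℂ) * l j =
          ∑ j, (((m - Finsupp.single i 1 : Fin n →₀ ℕ) j : ℕ) : ℂ) * l j + l i := by
        have h2 : l i = ∑ j, (Finsupp.single i 1 j : ℕ) * l j := by
          rw [Finset.sum_eq_single i]
          · simp
          · intro b _ hb; simp [hb.symm]
          · simp
        rw [h2, ← Finset.sum_add_distrib]
        refine Finset.sum_congr rfl fun j _ ↦ ?_
        rw [← add_mul, ← Nat.cast_add, Finsupp.tsub_apply, Nat.sub_add_cancel]
        rw [Finsupp.single_apply]
        split_ifs with hij
        · rw [← hij]; exact Nat.one_le_iff_ne_zero.2 (Finsupp.mem_support_iff.1 h)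
        · exact Nat.zero_le _
      rw [h1, map_add]; ring
    · simp

variable {i₀ : Fin n} {μ : ℂ} {r : ℕ}

/-- After multiplication by `r` the relation involves only the `l j`, since `r μ = l i₀`.
Independence kills every coefficient except that of index `i₀`, which may be compensated by `e`. -/
theorem eq_zero_of_resonance (hl : LinearIndependent ℤ l) (hr : r ≠ 0) (hμ : r * μ = l i₀)
    {a : Fin n → ℤ} {e : ℤ} (h : ∑ j, (a j : ℂ) * l j = e * μ) {j : Fin n} (hj : j ≠ i₀) :
    a j = 0 := by
  have h1 : ∑ j, (r * a j - if j = i₀ then e else 0 : ℤ) • l j = 0 := by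
    have : ∀ j, (r * a j - if j = i₀ then e else 0 : ℤ) • l j =
        r * (a j * l j) - if j = i₀ then e * l j else 0 := fun j ↦ by
      rw [zsmul_eq_mul]
      split_ifs <;> push_cast <;> ring
    rw [Finset.sum_congr rfl fun j _ ↦ this j, Finset.sum_sub_distrib, ← Finset.mul_sum, h,
      Finset.sum_ite_eq', if_pos (Finset.mem_univ _), ← hμ]
    ring
  have h2 := Fintype.linearIndependent_iff.1 hl _ h1 j
  rw [if_neg hj, sub_zero] at h2
  exact (mul_eq_zero.1 h2).resolve_left (by exact_mod_cast hr)

variable {I : Ideal (MvPolynomial (Fin n) (PowerSeries ℂ))}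

/-- A saturated ideal, invariant by a diagonal derivation without resonances, is generated by
monomials. -/
theorem monomial_mem_of_invariant (hl : LinearIndependent ℤ l) (hr : r ≠ 0) (hμ : r * μ = l i₀)
    (hc0 : PowerSeries.coeff 0 c = 0) (hc1 : PowerSeries.coeff 1 c = μ)
    (δ : Derivation ℂ (MvPolynomial (Fin n) (PowerSeries ℂ)) (MvPolynomial (Fin n) (PowerSeries ℂ)))
    (hC : ∀ a, δ (C a) = C (c * PowerSeries.derivative ℂ a))
    (hX : ∀ j, δ (X j) = -(C (PowerSeries.C (l j)) * X j))
    (hI : ∀ f ∈ I, δ f ∈ I) (hsat : ∀ d f, d ≠ 0 → C d * f ∈ I → f ∈ I) (hi₀ : X i₀ ∈ I)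
    {f : MvPolynomial (Fin n) (PowerSeries ℂ)} (hf : f ∈ I) {m : Fin n →₀ ℕ}
    (hm : m ∈ f.support) : monomial m 1 ∈ I := by
  have hmon {m : Fin n →₀ ℕ} {b : PowerSeries ℂ} (hb : b ≠ 0) (h : monomial m b ∈ I) :
      monomial m 1 ∈ I := hsat b _ hb (by rwa [C_mul_monomial, mul_one])
  have hmi {m : Fin n →₀ ℕ} (h : m i₀ ≠ 0) : monomial m 1 ∈ I := by
    rw [monomial_eq, Finsupp.prod, ← Finset.mul_prod_erase _ _ (Finsupp.mem_support_iff.2 h)]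
    exact I.mul_mem_left _ (I.mul_mem_right _ (I.pow_mem_of_mem hi₀ _ (Nat.pos_of_ne_zero h)))
  -- Induction on the number of terms. Every other monomial `m₁` of `f` either is in the ideal
  -- already or occurs in an element of the ideal with fewer terms; once all of them are in the
  -- ideal, so is the term of `m`.
  induction hk : f.support.card using Nat.strong_induction_on generalizing f m with
  | _ k ih =>
    have key : ∀ m₁ ∈ f.support, m₁ ≠ m → monomial m₁ 1 ∈ I := by
      intro m₁ hm₁ hne
      by_cases h1 : m₁ i₀ = 0
      swap
      · exact hmi h1
      by_cases h0 : m i₀ = 0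
      swap
      · -- remove the monomial `m`, which is in the ideal
        refine ih _ ?_ (f := f - monomial m (coeff m f)) (I.sub_mem hf ?_) ?_ rfl
        · rw [← hk]
          refine Finset.card_lt_card ((Finset.ssubset_iff_of_subset fun x hx ↦ ?_).2 ⟨m, hm, ?_⟩)
          · rw [mem_support_iff, coeff_sub, coeff_monomial] at hx
            rw [mem_support_iff]
            intro h
            split_ifs at hx with hmx
            · rw [hmx, sub_self] at hx; exact hx rfl
            · rw [h, sub_zero] at hx; exact hx rfl
          · simp [mem_support_iff, coeff_monomial]
        · rw [← mul_one (coeff m f), ← C_mul_monomial]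
          exact I.mul_mem_left _ (hmi h0)
        · rw [mem_support_iff, coeff_sub, coeff_monomial, if_neg hne.symm, sub_zero]
          exact mem_support_iff.1 hm₁
      -- This combination of `f` and `δ f` cancels the monomial `m` and creates no new one.
      let g := C (coeff m f) * δ f - C (c * PowerSeries.derivative ℂ (coeff m f) -
        PowerSeries.C (∑ j, m j * l j) * coeff m f) * f
      have hg (x) : coeff x g = coeff m f * (c * PowerSeries.derivative ℂ (coeff x f) -
          PowerSeries.C (∑ j, x j * l j) * coeff x f) -
            (c * PowerSeries.derivative ℂ (coeff m f) -
        PowerSeries.C (∑ j, m j * l j) * coeff m f) * coeff x f := by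
        rw [coeff_sub, coeff_C_mul, coeff_C_mul, coeff_diagonal_derivation δ hC hX]
      refine ih _ ?_ (f := g) (I.sub_mem (I.mul_mem_left _ (hI f hf)) (I.mul_mem_left _ hf))
        ?_ rfl
      · rw [← hk]
        refine Finset.card_lt_card ((Finset.ssubset_iff_of_subset fun x hx ↦ ?_).2 ⟨m, hm, ?_⟩)
        · rw [mem_support_iff, hg] at hx
          rw [mem_support_iff]
          intro h
          simp [h] at hx
        · rw [mem_support_iff, hg, not_not]; ring
      · rw [mem_support_iff, hg]
        intro h
        -- If `m₁` were cancelled too, the quotient of the two coefficients would solve `c u' = ν u`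
        -- with `ν` the difference of the weights, so `ν` would be an integral multiple of `μ`. Then
        -- `m` and `m₁` agree away from `i₀`, and both have exponent zero at `i₀`.
        obtain ⟨e, he⟩ := PowerSeries.exists_eq_int_mul (ν := ∑ j, (m₁ j : ℂ) * l j -
          ∑ j, (m j : ℂ) * l j) hc0 hc1 (mem_support_iff.1 hm) (mem_support_iff.1 hm₁) (by
            rw [map_sub]; linear_combination h)
        refine hne (Finsupp.ext fun j ↦ ?_)
        by_cases hj : j = i₀
        · rw [hj, h0, h1]
        · have h2 : ∑ j, (((m₁ j : ℤ) - m j : ℤ) : ℂ) * l j = e * μ := by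
            rw [← he, ← Finset.sum_sub_distrib]
            exact Finset.sum_congr rfl fun j _ ↦ by push_cast; ring
          have := eq_zero_of_resonance hl hr hμ h2 hj
          omega
    have h3 : monomial m (coeff m f) ∈ I := by
      have : monomial m (coeff m f) =
          f - ∑ x ∈ f.support.erase m, C (coeff x f) * monomial x 1 := by
        conv_rhs => enter [1]; rw [f.as_sum]
        simp only [C_mul_monomial, mul_one]
        rw [← Finset.add_sum_erase _ _ hm, add_sub_cancel_right]
      rw [this]
      exact I.sub_mem hf (I.sum_mem fun x hx ↦ I.mul_mem_left _
        (key x (Finset.mem_of_mem_erase hx) (Finset.ne_of_mem_erase hx)))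
    exact hmon (mem_support_iff.1 hm) h3

/-- The zero locus of an ideal generated by monomials is a finite union of coordinate
subspaces. -/
theorem zeroLocus_of_monomial {T Ω : Type*} [CommRing T] [Field Ω] (θ : T →+* Ω)
    {I : Ideal (MvPolynomial (Fin n) T)}
    (hI : ∀ f ∈ I, ∀ m ∈ f.support, monomial m 1 ∈ I) :
    ∃ S : Finset (Submodule Ω (Fin n → Ω)),
      {z : Fin n → Ω | ∀ f ∈ I, eval₂ θ z f = 0} = ⋃ E ∈ S, (E : Set (Fin n → Ω)) := by
  classical
  let E (s : Finset (Fin n)) : Submodule Ω (Fin n → Ω) :=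
    { carrier := {z | ∀ i ∉ s, z i = 0}
      add_mem' := fun ha hb i hi ↦ by rw [Pi.add_apply, ha i hi, hb i hi, add_zero]
      zero_mem' := fun i _ ↦ rfl
      smul_mem' := fun c z hz i hi ↦ by rw [Pi.smul_apply, hz i hi, smul_zero] }
  -- The subspaces are indexed by the sets `s` of free coordinates such that every monomial of `I`
  -- involves a variable outside `s`. A zero `z` of `I` belongs to the one defined by its non-zero
  -- coordinates.
  refine ⟨(Finset.univ.filter fun s ↦ ∀ m, monomial m 1 ∈ I → ¬ m.support ⊆ s).image E, ?_⟩
  ext z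
  simp only [Set.mem_ofPred_eq, Finset.mem_image, Finset.mem_filter, Finset.mem_univ, true_and,
    Set.mem_iUnion, SetLike.mem_coe, exists_prop]
  constructor
  · intro hz
    refine ⟨_, ⟨Finset.univ.filter fun i ↦ z i ≠ 0, fun m hm hs ↦ ?_, rfl⟩, fun i hi ↦ ?_⟩
    · have := hz _ hm
      rw [eval₂_monomial, map_one, one_mul, Finsupp.prod, Finset.prod_eq_zero_iff] at this
      obtain ⟨i, hi, h⟩ := this
      exact (Finset.mem_filter.1 (hs hi)).2 ((pow_eq_zero_iff
        (Finsupp.mem_support_iff.1 hi)).1 h)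
    · simpa using hi
  · rintro ⟨_, ⟨s, hs, rfl⟩, hz⟩ f hf
    rw [eval₂_eq]
    refine Finset.sum_eq_zero fun m hm ↦ ?_
    obtain ⟨i, hi, his⟩ := Finset.not_subset.1 (hs m (hI f hf m hm))
    rw [Finset.prod_eq_zero hi, mul_zero]
    rw [hz i his, zero_pow (Finsupp.mem_support_iff.1 hi)]

end Diagonal

/-! ### Reduction of the prolongation to diagonal form along the separatrix -/

section Reduction

open MvPolynomial

/-- The elements of a ring of polynomials over `T` that have a multiple by a non-zero constant
in a given ideal. -/
def saturation {T σ : Type*} [CommRing T] [IsDomain T] (I : Ideal (MvPolynomial σ T)) :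
    Ideal (MvPolynomial σ T) where
  carrier := {f | ∃ d : T, d ≠ 0 ∧ C d * f ∈ I}
  add_mem' := by
    rintro f g ⟨d, hd, hf⟩ ⟨e, he, hg⟩
    refine ⟨d * e, mul_ne_zero hd he, ?_⟩
    have : C (d * e) * (f + g) = C e * (C d * f) + C d * (C e * g) := by rw [map_mul]; ring
    rw [this]
    exact I.add_mem (I.mul_mem_left _ hf) (I.mul_mem_left _ hg)
  zero_mem' := ⟨1, one_ne_zero, by simp⟩
  smul_mem' := by
    rintro a f ⟨d, hd, hf⟩
    refine ⟨d, hd, ?_⟩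
    rw [smul_eq_mul, mul_left_comm]
    exact I.mul_mem_left _ hf

theorem le_saturation {T σ : Type*} [CommRing T] [IsDomain T] (I : Ideal (MvPolynomial σ T)) :
    I ≤ saturation I := fun f hf ↦ ⟨1, one_ne_zero, by simpa using hf⟩

theorem mem_saturation_of_C_mul_mem {T σ : Type*} [CommRing T] [IsDomain T]
    {I : Ideal (MvPolynomial σ T)} {d : T} {f : MvPolynomial σ T} (hd : d ≠ 0)
    (h : C d * f ∈ saturation I) : f ∈ saturation I := by
  obtain ⟨e, he, h⟩ := h
  exact ⟨e * d, mul_ne_zero he hd, by rwa [map_mul, mul_assoc]⟩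

/-- If `b f` is in `I`, then so is `b² δ f = b δ(b f) - δ(b) (b f)`. -/
theorem derivation_mem_saturation {k T σ : Type*} [CommRing k] [CommRing T] [IsDomain T]
    [Algebra k T] {I : Ideal (MvPolynomial σ T)}
    (δ : Derivation k (MvPolynomial σ T) (MvPolynomial σ T)) (d : T → T)
    (hC : ∀ a, δ (C a) = C (d a)) (hI : ∀ f ∈ I, δ f ∈ I) {f : MvPolynomial σ T}
    (hf : f ∈ saturation I) : δ f ∈ saturation I := by
  obtain ⟨b, hb, h⟩ := hf
  refine ⟨b * b, mul_ne_zero hb hb, ?_⟩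
  have h1 := hI _ h
  rw [δ.leibniz, hC, smul_eq_mul, smul_eq_mul] at h1
  have : C (b * b) * δ f = C b * (C b * δ f + f * C (d b)) - C (d b) * (C b * f) := by
    rw [map_mul]; ring
  rw [this]
  exact I.sub_mem (I.mul_mem_left _ h1) (I.mul_mem_left _ h)

theorem derivation_mem_map {k R S : Type*} [CommRing k] [CommRing R] [CommRing S] [Algebra k R]
    [Algebra k S] {τ : R →+* S} {δ : Derivation k R R} {δ' : Derivation k S S}
    (h : ∀ f, δ' (τ f) = τ (δ f)) {I : Ideal R} (hI : ∀ f ∈ I, δ f ∈ I) {f : S}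
    (hf : f ∈ I.map τ) : δ' f ∈ I.map τ := by
  refine Submodule.span_induction (p := fun f _ ↦ δ' f ∈ I.map τ) ?_ ?_ ?_ ?_ hf
  · rintro _ ⟨g, hg, rfl⟩
    rw [h]
    exact Ideal.mem_map_of_mem _ (hI g hg)
  · rw [map_zero]; exact Ideal.zero_mem _
  · intro x y _ _ hx hy
    rw [map_add]; exact Ideal.add_mem _ hx hy
  · intro a x hx hx'
    rw [smul_eq_mul, δ'.leibniz, smul_eq_mul, smul_eq_mul]
    exact Ideal.add_mem _ (Ideal.mul_mem_left _ _ hx') (Ideal.mul_mem_right _ _ hx)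

variable {n : ℕ} {A Ω : Type*} [CommRing A] [Algebra ℂ A] [Field Ω]
  {c : PowerSeries ℂ} {l : Fin n → ℂ} {i₀ : Fin n} {μ : ℂ} {r : ℕ}

/-- The zero locus of an invariant ideal is a finite union of linear subspaces. -/
theorem zeroLocus_eq_iUnion_of_invariant {I : Ideal (MvPolynomial (Fin n) A)} (ξ : A → A)
    (δ : Derivation ℂ (MvPolynomial (Fin n) A) (MvPolynomial (Fin n) A))
    (hδC : ∀ f, δ (C f) = C (ξ f)) {B : Fin n → Fin n → A}
    (hδX : ∀ j, δ (X j) = -∑ i, C (B j i) * X i) (hI : ∀ f ∈ I, δ f ∈ I)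
    {a : Fin n → A} (ha : a ≠ 0) (haI : ∑ i, C (a i) * X i ∈ I)
    (haδ : δ (∑ i, C (a i) * X i) = 0)
    (hl : LinearIndependent ℤ l) (hr : r ≠ 0) (hμ : r * μ = l i₀)
    (hc0 : PowerSeries.coeff 0 c = 0) (hc1 : PowerSeries.coeff 1 c = μ)
    (Φ : A →ₐ[ℂ] PowerSeries ℂ) (hΦ : Function.Injective Φ)
    (hΦξ : ∀ f, Φ (ξ f) = c * PowerSeries.derivative ℂ (Φ f))
    (hB : ∀ i j, PowerSeries.coeff 0 (Φ (B i j)) = if i = j then l i else 0)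
    (θ : PowerSeries ℂ →+* Ω) (hθ : Function.Injective θ) :
    ∃ S : Finset (Submodule Ω (Fin n → Ω)),
      {z : Fin n → Ω | ∀ g ∈ I, eval₂ (θ.comp Φ.toRingHom) z g = 0} =
        ⋃ E ∈ S, (E : Set (Fin n → Ω)) := by
  classical
  -- These are the divisors in the recursion for the eigenvectors. A zero divisor would be a
  -- resonance; for `i = j` it would force `μ = 0`, hence `l i₀ = 0`.
  have hres : ∀ j, ∀ k : ℕ, k ≠ 0 → ∀ i, k * μ + l i - l j ≠ 0 := by
    intro j k hk i h
    have h1 : ∑ x, (((if x = j then 1 else 0) - if x = i then 1 else 0 : ℤ) : ℂ) * l x =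
        (k : ℤ) * μ := by
      simp only [Int.cast_sub, Int.cast_ite, Int.cast_one, Int.cast_zero, sub_mul, ite_mul,
        one_mul, zero_mul, Finset.sum_sub_distrib, Finset.sum_ite_eq', Finset.mem_univ, if_true,
        Int.cast_natCast]
      linear_combination -h
    by_cases hij : i = j
    · subst hij
      have hμ0 : μ = 0 := by
        have : (k : ℂ) * μ = 0 := by linear_combination h
        exact (mul_eq_zero.1 this).resolve_left (by exact_mod_cast hk)
      rw [hμ0, mul_zero] at hμ
      exact hl.ne_zero i₀ hμ.symm
    · have h2 := eq_zero_of_resonance hl hr hμ h1 (j := i)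
      have h3 := eq_zero_of_resonance hl hr hμ h1 (j := j)
      by_cases hi : i = i₀
      · have := h3 fun h ↦ hij (hi.trans h.symm)
        simp [Ne.symm hij] at this
      · have := h2 hi
        simp [hij] at this
  choose w hw0 hw using fun j ↦ PowerSeries.exists_eigenvector hc0 hc1 (fun i j ↦ Φ (B i j)) l hB j
    (hres j)
  -- The columns of `Q` are the eigenvectors. Its value at `t = 0` is the identity, so its
  -- determinant is not zero.
  let Q : Matrix (Fin n) (Fin n) (PowerSeries ℂ) := Matrix.of fun i j ↦ w j i
  have hQ (i j) : Q i j = w j i := rfl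
  have hdet : Q.det ≠ 0 := by
    intro h
    have h1 := congrArg (PowerSeries.constantCoeff (R := ℂ)) h
    rw [RingHom.map_det, map_zero] at h1
    have h2 : (PowerSeries.constantCoeff (R := ℂ)).mapMatrix Q = 1 := by
      ext i j
      rw [RingHom.mapMatrix_apply, Matrix.map_apply, hQ,
        ← PowerSeries.coeff_zero_eq_constantCoeff_apply, hw0, Matrix.one_apply]
    rw [h2, Matrix.det_one] at h1
    exact one_ne_zero h1
  -- The substitution by `Q` is the change of frame: it conjugates `δ` to the diagonal derivation
  -- `δ'`.
  let τ : MvPolynomial (Fin n) A →+* MvPolynomial (Fin n) (PowerSeries ℂ) :=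
    eval₂Hom ((C : _ →+* MvPolynomial (Fin n) (PowerSeries ℂ)).comp Φ.toRingHom)
      fun i ↦ ∑ j, C (Q i j) * X j
  have hτC (f) : τ (C f) = C (Φ f) := eval₂Hom_C _ _ _
  have hτX (i) : τ (X i) = ∑ j, C (Q i j) * X j := eval₂Hom_X' _ _ _
  obtain ⟨δ', hC, hX⟩ := MvPolynomial.exists_derivation (c • PowerSeries.derivative ℂ)
    fun j : Fin n ↦ -(C (PowerSeries.C (l j)) * X j)
  replace hC (a : PowerSeries ℂ) : δ' (C a) = C (c * PowerSeries.derivative ℂ a) := hC a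
  have hτδX (i) : δ' (τ (X i)) = τ (δ (X i)) := by
    rw [hτX, hδX, map_neg, map_sum, map_sum]
    simp only [map_mul, hτC, hτX, δ'.leibniz, hC, hX, smul_eq_mul, Finset.mul_sum]
    rw [Finset.sum_comm, ← Finset.sum_neg_distrib]
    refine Finset.sum_congr rfl fun j _ ↦ ?_
    have := congrArg (C : _ →+* MvPolynomial (Fin n) (PowerSeries ℂ)) (hw j i)
    simp only [map_add, map_mul, map_sum] at this
    simp only [← mul_assoc, ← Finset.sum_mul, hQ]
    linear_combination X j * this
  have hτδ (f) : δ' (τ f) = τ (δ f) := by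
    induction f using MvPolynomial.induction_on with
    | C a => rw [hδC, hτC, hτC, hC, hΦξ]
    | add p q hp hq => simp only [map_add, hp, hq]
    | mul_X p i hp =>
      simp only [map_mul, Derivation.leibniz, smul_eq_mul, hp, hτδX, map_add]
  let J := saturation (I.map τ)
  have hJ (f) (hf : f ∈ J) : δ' f ∈ J :=
    derivation_mem_saturation δ' _ hC (fun f hf ↦ derivation_mem_map hτδ hI hf) hf
  -- The linear form in the ideal is killed by `δ`. In the diagonal frame its coefficients satisfy
  -- `c (h j)' = l j * h j`, so `h j ≠ 0` forces `l j` to be an integral multiple of `μ`, which is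
  -- impossible for `j ≠ i₀`. What remains is a non-zero multiple of `X i₀`, and the saturation
  -- removes the factor.
  have hi₀ : X i₀ ∈ J := by
    let h (j) := ∑ i, Φ (a i) * Q i j
    have hτh : τ (∑ i, C (a i) * X i) = ∑ j, C (h j) * X j := by
      simp only [map_sum, map_mul, hτC, hτX, Finset.mul_sum, h, Finset.sum_mul]
      rw [Finset.sum_comm]
      exact Finset.sum_congr rfl fun j _ ↦ Finset.sum_congr rfl fun i _ ↦ (mul_assoc _ _ _).symm
    have hcoeff (j) : coeff (Finsupp.single j 1) (∑ j, C (h j) * X j) = h j := by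
      rw [coeff_sum, Finset.sum_eq_single j]
      · rw [coeff_C_mul, coeff_X, if_pos rfl, mul_one]
      · intro b _ hb
        rw [coeff_C_mul, coeff_X, if_neg, mul_zero]
        exact fun h ↦ hb (Finsupp.single_left_injective one_ne_zero h)
      · simp
    have hzero (j) (hj : j ≠ i₀) : h j = 0 := by
      by_contra hne
      have h1 : δ' (∑ j, C (h j) * X j) = 0 := by rw [← hτh, hτδ, haδ, map_zero]
      have h2 := coeff_diagonal_derivation δ' hC hX (∑ j, C (h j) * X j) (Finsupp.single j 1)
      have h3 : ∑ x, ((Finsupp.single j 1 : Fin n →₀ ℕ) x : ℂ) * l x = l j := by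
        rw [Finset.sum_eq_single j]
        · simp
        · intro b _ hb; simp [hb.symm]
        · simp
      rw [h1, coeff_zero, hcoeff, h3] at h2
      obtain ⟨e, he⟩ := PowerSeries.exists_eq_int_mul (b := 1) (ν := l j) hc0 hc1 one_ne_zero hne
        (by rw [Derivation.map_one_eq_zero]; linear_combination -h2)
      have h4 : ∑ x, (((if x = j then 1 else 0 : ℤ)) : ℂ) * l x = e * μ := by
        simp [he]
      have := eq_zero_of_resonance hl hr hμ h4 hj
      simp at this
    have hsum : ∑ j, C (h j) * X j = C (h i₀) * X i₀ := by
      refine Finset.sum_eq_single i₀ (fun j _ hj ↦ ?_) (by simp)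
      rw [hzero j hj, map_zero, zero_mul]
    have hne : h i₀ ≠ 0 := by
      intro h0
      have h1 : Matrix.vecMul (fun i ↦ Φ (a i)) Q = 0 := by
        ext1 j
        change ∑ i, Φ (a i) * Q i j = 0
        by_cases hj : j = i₀
        · rw [hj]; exact h0
        · exact hzero j hj
      have h2 := Matrix.eq_zero_of_vecMul_eq_zero hdet h1
      exact ha (funext fun i ↦ hΦ ((congrFun h2 i).trans (map_zero Φ).symm))
    refine ⟨h i₀, hne, ?_⟩
    rw [← hsum, ← hτh]
    exact Ideal.mem_map_of_mem _ haI
  have hmono : ∀ f ∈ J, ∀ m ∈ f.support, monomial m 1 ∈ J := fun f hf m hm ↦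
    monomial_mem_of_invariant hl hr hμ hc0 hc1 δ' hC hX hJ
      (fun d f hd h ↦ mem_saturation_of_C_mul_mem hd h) hi₀ hf hm
  obtain ⟨S, hS⟩ := zeroLocus_of_monomial θ hmono
  have heval (z : Fin n → Ω) (g) : eval₂ θ z (τ g) =
      eval₂ (θ.comp Φ.toRingHom) ((Q.map θ).mulVec z) g := by
    have : (eval₂Hom θ z).comp τ = eval₂Hom (θ.comp Φ.toRingHom) ((Q.map θ).mulVec z) := by
      refine MvPolynomial.ringHom_ext (fun f ↦ ?_) fun i ↦ ?_
      · rw [RingHom.comp_apply, hτC, eval₂Hom_C, eval₂Hom_C]; rfl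
      · rw [RingHom.comp_apply, hτX, eval₂Hom_X', map_sum]
        exact Finset.sum_congr rfl fun j _ ↦ by
          rw [map_mul, eval₂Hom_C, eval₂Hom_X']; rfl
    exact RingHom.congr_fun this g
  -- Saturating does not change the zeros in `Ω`, because `θ` is injective; so the zero locus of `I`
  -- is the image by `Q` of that of `J`.
  have hzero (z : Fin n → Ω) : (∀ f ∈ J, eval₂ θ z f = 0) ↔
      ∀ g ∈ I, eval₂ (θ.comp Φ.toRingHom) ((Q.map θ).mulVec z) g = 0 := by
    refine ⟨fun h g hg ↦ ?_, ?_⟩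
    · rw [← heval]
      exact h _ (le_saturation _ (Ideal.mem_map_of_mem _ hg))
    · rintro h f ⟨d, hd, hf⟩
      have h1 : I.map τ ≤ RingHom.ker (eval₂Hom θ z) :=
        Ideal.map_le_iff_le_comap.2 fun g hg ↦ (heval z g).trans (h g hg)
      have h2 : eval₂Hom θ z (C d * f) = 0 := h1 hf
      rw [map_mul, eval₂Hom_C] at h2
      exact (mul_eq_zero.1 h2).resolve_left ((map_ne_zero_iff θ hθ).2 hd)
  have hunit : IsUnit (Q.map θ).det := by
    have : (Q.map θ).det = θ Q.det := (RingHom.map_det θ Q).symm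
    rw [this]
    exact ((map_ne_zero_iff θ hθ).2 hdet).isUnit
  refine ⟨S.image (Submodule.map (Q.map θ).mulVecLin), ?_⟩
  ext z
  have hz : z = (Q.map θ).mulVec ((Q.map θ)⁻¹.mulVec z) := by
    rw [Matrix.mulVec_mulVec, Matrix.mul_nonsing_inv _ hunit, Matrix.one_mulVec]
  simp only [Set.mem_iUnion, Finset.mem_image, SetLike.mem_coe, exists_prop]
  have h1 : z ∈ {z : Fin n → Ω | ∀ g ∈ I, eval₂ (θ.comp Φ.toRingHom) z g = 0} ↔
      (Q.map θ)⁻¹.mulVec z ∈ ⋃ E ∈ S, (E : Set (Fin n → Ω)) := by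
    rw [← hS]
    refine Iff.trans ?_ (hzero _).symm
    rw [← hz]; rfl
  rw [h1]
  simp only [Set.mem_iUnion, SetLike.mem_coe, exists_prop]
  constructor
  · rintro ⟨E, hE, h⟩
    exact ⟨_, ⟨E, hE, rfl⟩, _, h, hz.symm⟩
  · rintro ⟨_, ⟨E, hE, rfl⟩, y, hy, rfl⟩
    refine ⟨E, hE, ?_⟩
    rw [Matrix.mulVecLin_apply, Matrix.mulVec_mulVec, Matrix.nonsing_inv_mul _ hunit,
      Matrix.one_mulVec]
    exact hy

end Reduction

/-! ### Linear subspaces defined over the algebraic closure -/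

section Galois

open MvPolynomial

/-- A finite union of subspaces, restricted to a subfield, is a finite union of subspaces. -/
theorem exists_iUnion_eq_preimage {k Ω : Type*} [Field k] [Field Ω] (φ : k →+* Ω) {n : ℕ}
    (S : Finset (Submodule Ω (Fin n → Ω))) : ∃ S' : Finset (Submodule k (Fin n → k)),
      {z : Fin n → k | φ ∘ z ∈ ⋃ E ∈ S, (E : Set (Fin n → Ω))} =
        ⋃ E ∈ S', (E : Set (Fin n → k)) := by
  classical
  let f : (Fin n → k) →ₛₗ[φ] (Fin n → Ω) :=
    { toFun := fun z ↦ φ ∘ z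
      map_add' := fun a b ↦ funext fun i ↦ map_add φ _ _
      map_smul' := fun a b ↦ funext fun i ↦ map_mul φ _ _ }
  refine ⟨S.image (Submodule.comap f), ?_⟩
  ext z
  simp only [Set.mem_iUnion, Finset.mem_image, SetLike.mem_coe, exists_prop, Set.mem_ofPred_eq]
  constructor
  · rintro ⟨E, hE, h⟩
    exact ⟨_, ⟨E, hE, rfl⟩, h⟩
  · rintro ⟨_, ⟨E, hE, rfl⟩, h⟩
    exact ⟨E, hE, h⟩

/-- A subspace of `k^n` is the image of a matrix which contains the identity as a submatrix. -/
theorem exists_matrix_of_submodule {k : Type*} [Field k] {n : ℕ} (E : Submodule k (Fin n → k)) :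
    ∃ (q : ℕ) (ι : Fin q → Fin n) (M : Matrix (Fin n) (Fin q) k),
      (∀ a b, M (ι a) b = if a = b then 1 else 0) ∧
      ∀ z, z ∈ E ↔ ∃ s, z = M.mulVec s := by
  let φ (i : Fin n) : Module.Dual k E := (LinearMap.proj i).comp E.subtype
  -- The coordinate forms restricted to `E` span its dual. A basis is chosen among them, and the
  -- corresponding rows form the identity in the frame of `E` dual to this basis.
  obtain ⟨q, hq, f, hf, hspan⟩ : ∃ q, q = Module.finrank k (Submodule.span k (Set.range φ)) ∧
      ∃ f : Fin q → Module.Dual k E, (∀ a, f a ∈ Set.range φ) ∧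
        Submodule.span k (Set.range f) = Submodule.span k (Set.range φ) := by
    obtain ⟨f, hf, hspan, -⟩ := Submodule.exists_fun_fin_finrank_span_eq k (Set.range φ)
    exact ⟨_, rfl, f, hf, hspan⟩
  have hbot : (Submodule.span k (Set.range φ)).dualCoannihilator = ⊥ := by
    refine (Submodule.eq_bot_iff _).2 fun z hz ↦ Subtype.ext (funext fun i ↦ ?_)
    exact (Submodule.mem_dualCoannihilator _).1 hz (φ i) (Submodule.subset_span ⟨i, rfl⟩)
  choose ι hι using hf
  have hdim : Module.finrank k E = Module.finrank k (Fin q → k) := by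
    rw [Module.finrank_fin_fun, hq, ← Subspace.finrank_add_finrank_dualCoannihilator_eq
      (Submodule.span k (Set.range φ)), hbot, finrank_bot, add_zero]
  let g : E →ₗ[k] (Fin q → k) := LinearMap.pi f
  have hg : Function.Injective g := by
    rw [← LinearMap.ker_eq_bot]
    refine (Submodule.eq_bot_iff _).2 fun z hz ↦ Subtype.ext (funext fun i ↦ ?_)
    have h1 : φ i ∈ Submodule.span k (Set.range f) := by
      rw [hspan]; exact Submodule.subset_span ⟨i, rfl⟩
    have h2 : Submodule.span k (Set.range f) ≤ LinearMap.ker (Module.Dual.eval k E z) := by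
      rw [Submodule.span_le]
      rintro _ ⟨a, rfl⟩
      exact congrFun (LinearMap.mem_ker.1 hz) a
    exact h2 h1
  let e := LinearEquiv.ofInjectiveOfFinrankEq g hg hdim
  have he (z) : e z = g z := rfl
  let M : Matrix (Fin n) (Fin q) k := Matrix.of fun i a ↦ (e.symm (Pi.single a 1)).1 i
  have hM (s : Fin q → k) : M.mulVec s = (e.symm s).1 := by
    have h1 : s = ∑ a, s a • Pi.single (M := fun _ : Fin q ↦ k) a 1 := by
      ext b; simp [Finset.sum_apply, Pi.single_apply]
    conv_rhs => rw [h1, map_sum]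
    ext i
    rw [AddSubmonoidClass.coe_finsetSum, Finset.sum_apply, Matrix.mulVec, dotProduct]
    exact Finset.sum_congr rfl fun a _ ↦ by
      rw [map_smul, mul_comm]; rfl
  refine ⟨q, ι, M, fun a b ↦ ?_, fun z ↦ ⟨fun hz ↦ ⟨e ⟨z, hz⟩, by rw [hM, e.symm_apply_apply]⟩, ?_⟩⟩
  · have h1 : g (e.symm (Pi.single b 1)) a = (e.symm (Pi.single b 1)).1 (ι a) := by
      change f a _ = φ (ι a) _
      rw [hι]
    change (e.symm (Pi.single b 1)).1 (ι a) = _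
    rw [← h1, ← he, e.apply_symm_apply, Pi.single_apply]
  · rintro ⟨s, rfl⟩
    rw [hM]
    exact (e.symm s).2

variable {k Ω : Type*} [Field k] [Field Ω] [Algebra k Ω] {n q : ℕ}

/-- The restriction of polynomials to the image of a matrix. -/
def restrictTo (k : Type*) [Field k] [Algebra k Ω] (M : Matrix (Fin n) (Fin q) Ω) :
    MvPolynomial (Fin n) k →ₐ[k] MvPolynomial (Fin q) Ω :=
  aeval fun i ↦ ∑ a, C (M i a) * X a

theorem eval_restrictTo (M : Matrix (Fin n) (Fin q) Ω) (s : Fin q → Ω)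
    (g : MvPolynomial (Fin n) k) :
    eval s (restrictTo k M g) = aeval (M.mulVec s) g := by
  have : ((aeval (R := k) (M.mulVec s)).toRingHom) =
      (eval s).comp (restrictTo k M).toRingHom := by
    refine MvPolynomial.ringHom_ext (fun a ↦ ?_) fun i ↦ ?_
    · simp [restrictTo]
    · simp [restrictTo, Matrix.mulVec, dotProduct]
  exact (RingHom.congr_fun this g).symm

/-- A prime ideal whose zero locus is a finite union of linear subspaces is the ideal of one of
them. -/
theorem exists_matrix_of_isPrime [IsAlgClosed Ω] {J : Ideal (MvPolynomial (Fin n) k)}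
    (hJ : J.IsPrime) {S : Finset (Submodule Ω (Fin n → Ω))}
    (hS : zeroLocus Ω J = ⋃ E ∈ S, (E : Set (Fin n → Ω))) :
    ∃ (q : ℕ) (ι : Fin q → Fin n) (M : Matrix (Fin n) (Fin q) Ω),
      (∀ a b, M (ι a) b = if a = b then 1 else 0) ∧ ∀ g, g ∈ J ↔ restrictTo k M g = 0 := by
  have h1 := vanishingIdeal_zeroLocus_eq_radical (K := Ω) J
  rw [hJ.radical] at h1
  -- By the Nullstellensatz `J` contains the finite intersection of the ideals of the subspaces;
  -- being prime, it contains one of them.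
  have h2 : S.inf (fun E ↦ vanishingIdeal k (E : Set (Fin n → Ω))) ≤ J := by
    rw [← h1]
    intro g hg z hz
    rw [hS] at hz
    simp only [Set.mem_iUnion, exists_prop] at hz
    obtain ⟨E, hE, hzE⟩ := hz
    exact (Finset.inf_le (f := fun E : Submodule Ω (Fin n → Ω) ↦
      vanishingIdeal k (E : Set (Fin n → Ω))) hE) hg z hzE
  obtain ⟨E, hE, hEJ⟩ := hJ.inf_le'.1 h2
  obtain ⟨q, ι, M, hM, hME⟩ := exists_matrix_of_submodule E
  refine ⟨q, ι, M, hM, fun g ↦ ⟨fun hg ↦ ?_, fun hg ↦ hEJ fun z hz ↦ ?_⟩⟩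
  · refine MvPolynomial.funext fun s ↦ ?_
    rw [eval_restrictTo, map_zero]
    rw [← h1] at hg
    refine hg _ ?_
    rw [hS]
    exact Set.mem_biUnion hE ((hME _).2 ⟨s, rfl⟩)
  · obtain ⟨s, rfl⟩ := (hME z).1 hz
    rw [← eval_restrictTo, hg, map_zero]

theorem exists_map_eq_of_fixed [IsGalois k Ω] {σ : Type*} {p : MvPolynomial σ Ω}
    (h : ∀ τ : Gal(Ω/k), MvPolynomial.map (τ : Ω →+* Ω) p = p) :
    ∃ p₀ : MvPolynomial σ k, MvPolynomial.map (algebraMap k Ω) p₀ = p := by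
  refine mem_range_map_iff_coeffs_subset.2 fun c hc ↦ ?_
  obtain ⟨m, -, rfl⟩ := mem_coeffs_iff.1 hc
  refine (InfiniteGalois.mem_range_algebraMap_iff_fixed _).2 fun τ ↦ ?_
  conv_rhs => rw [← h τ]
  rw [coeff_map]; rfl

/-- The equations, depending on a parameter, of the image of a matrix `M` such that the rows given
by `ι` form the identity. -/
def equations {R : Type*} [CommRing R] (ι : Fin q → Fin n) (M : Matrix (Fin n) (Fin q) R) (t : ℕ) :
    MvPolynomial (Fin n) R :=
  ∑ i : Fin n, C ((t : R) ^ (i : ℕ)) * (X i - ∑ a, C (M i a) * X (ι a))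

/-- The Plücker coordinates of the image of a matrix, as coefficients of a linear form. -/
def pluckerForm {R : Type*} [CommRing R] (M : Matrix (Fin n) (Fin q) R) :
    MvPolynomial (Fin q → Fin n) R :=
  ∑ I : Fin q → Fin n, C (∏ a, M (I a) a) * X I

theorem exists_finset_conjugates [Algebra.IsAlgebraic k Ω] (M : Matrix (Fin n) (Fin q) Ω) :
    ∃ O : Finset (Matrix (Fin n) (Fin q) Ω),
      ∀ M', M' ∈ O ↔ ∃ τ : Gal(Ω/k), M' = M.map τ := by
  have hfin : (Set.range fun τ : Gal(Ω/k) ↦ M.map τ).Finite := by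
    have h1 : (Set.univ.pi fun i ↦ Set.univ.pi fun a ↦
        ((minpoly k (M i a)).rootSet Ω : Set Ω) : Set (Fin n → Fin q → Ω)).Finite :=
      Set.Finite.pi fun i ↦ Set.Finite.pi fun a ↦ Polynomial.rootSet_finite _ _
    refine h1.subset ?_
    rintro _ ⟨τ, rfl⟩ i - a -
    rw [Polynomial.mem_rootSet]
    refine ⟨minpoly.ne_zero (Algebra.IsAlgebraic.isAlgebraic (R := k) (M i a)).isIntegral, ?_⟩
    change Polynomial.aeval (τ (M i a)) _ = 0
    rw [Polynomial.aeval_algHom_apply, minpoly.aeval, map_zero]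
  refine ⟨hfin.toFinset, fun M' ↦ ?_⟩
  rw [Set.Finite.mem_toFinset]
  exact ⟨fun ⟨τ, h⟩ ↦ ⟨τ, h.symm⟩, fun ⟨τ, h⟩ ↦ ⟨τ, h.symm⟩⟩

/-- A product over the Galois orbit of `M` of polynomials attached equivariantly to the matrices is
fixed by the group, so it descends to `k`. The product of the `equations` is in `J` since the factor
of `M` vanishes on the image of `M`. Varying `t` lets this single equation replace the whole system
of equations of a subspace. -/
theorem exists_conjugates [IsGalois k Ω] {J : Ideal (MvPolynomial (Fin n) k)} {ι : Fin q → Fin n}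
    {M : Matrix (Fin n) (Fin q) Ω} (hM : ∀ a b, M (ι a) b = if a = b then 1 else 0)
    (hJ : ∀ g, g ∈ J ↔ restrictTo k M g = 0) :
    ∃ O : Finset (Matrix (Fin n) (Fin q) Ω), O.Nonempty ∧
      (∀ M' ∈ O, (∀ a b, M' (ι a) b = if a = b then 1 else 0) ∧ ∀ g ∈ J, restrictTo k M' g = 0) ∧
      (∀ t, ∃ F ∈ J, MvPolynomial.map (algebraMap k Ω) F = ∏ M' ∈ O, equations ι M' t) ∧
      ∃ G : MvPolynomial (Fin q → Fin n) k, MvPolynomial.map (algebraMap k Ω) G = ∏ M' ∈ O, pluckerForm M' := by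
  obtain ⟨O, hO⟩ := exists_finset_conjugates (k := k) M
  have hMO : M ∈ O := (hO M).2 ⟨1, by ext; rfl⟩
  have hprod {σ : Type} (f : Matrix (Fin n) (Fin q) Ω → MvPolynomial σ Ω)
      (hf : ∀ (τ : Gal(Ω/k)) M', MvPolynomial.map (τ : Ω →+* Ω) (f M') = f (M'.map τ)) :
      ∃ p : MvPolynomial σ k, MvPolynomial.map (algebraMap k Ω) p = ∏ M' ∈ O, f M' := by
    refine exists_map_eq_of_fixed fun τ ↦ ?_
    rw [map_prod]
    simp only [hf]
    refine Finset.prod_bij (fun M' _ ↦ M'.map τ) (fun M' h ↦ ?_) (fun M' _ M'' _ h ↦ ?_)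
      (fun M' h ↦ ?_) fun _ _ ↦ rfl
    · obtain ⟨τ', rfl⟩ := (hO M').1 h
      exact (hO _).2 ⟨τ * τ', by ext; rfl⟩
    · ext i a
      exact τ.injective (congrFun (congrFun h i) a)
    · obtain ⟨τ', rfl⟩ := (hO M').1 h
      refine ⟨M.map (τ⁻¹ * τ' : Gal(Ω/k)), (hO _).2 ⟨_, rfl⟩, ?_⟩
      ext i a
      exact τ.apply_symm_apply _
  refine ⟨O, ⟨M, hMO⟩, fun M' h ↦ ?_, fun t ↦ ?_, hprod _ fun τ M' ↦ ?_⟩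
  · obtain ⟨τ, rfl⟩ := (hO M').1 h
    refine ⟨fun a b ↦ ?_, fun g hg ↦ ?_⟩
    · rw [Matrix.map_apply, hM]; split_ifs <;> simp
    · have h1 : (restrictTo k (M.map τ)).toRingHom =
          (MvPolynomial.map (τ : Ω →+* Ω)).comp (restrictTo k M).toRingHom := by
        refine MvPolynomial.ringHom_ext (fun a ↦ ?_) fun i ↦ ?_
        · simp [restrictTo, MvPolynomial.algebraMap_apply]
        · simp [restrictTo]
      refine (RingHom.congr_fun h1 g).trans ?_
      rw [RingHom.comp_apply]
      have h2 : (restrictTo k M).toRingHom g = 0 := (hJ g).1 hg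
      rw [h2, map_zero]
  · obtain ⟨F, hF⟩ := hprod (fun M' ↦ equations ι M' t) fun τ M' ↦ by
      simp [equations]
    refine ⟨F, (hJ F).2 ?_, hF⟩
    have h1 : restrictTo k M F = restrictTo Ω M (MvPolynomial.map (algebraMap k Ω) F) := by
      rw [restrictTo, restrictTo, aeval_map_algebraMap]
    rw [h1, hF, map_prod]
    refine Finset.prod_eq_zero hMO ?_
    simp only [equations, restrictTo, map_sum, map_mul, map_sub, aeval_X, algHom_C, hM]
    refine Finset.sum_eq_zero fun i _ ↦ ?_
    rw [mul_eq_zero]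
    right
    rw [sub_eq_zero]
    refine Finset.sum_congr rfl fun a _ ↦ ?_
    simp [MvPolynomial.algebraMap_eq]
  · simp [pluckerForm]

end Galois

/-! ### Taylor series -/

/-- The Taylor series of a function at the origin. -/
def taylorSeries (f : ℂ → ℂ) : PowerSeries ℂ :=
  PowerSeries.mk fun k ↦ iteratedDeriv k f 0 / k.factorial

theorem taylorSeries_congr {f g : ℂ → ℂ} (h : f =ᶠ[𝓝 0] g) : taylorSeries f = taylorSeries g := by
  ext k
  rw [taylorSeries, taylorSeries, PowerSeries.coeff_mk, PowerSeries.coeff_mk,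
    h.iteratedDeriv_eq k]

theorem taylorSeries_const (c : ℂ) : taylorSeries (fun _ ↦ c) = PowerSeries.C c := by
  ext k
  rw [taylorSeries, PowerSeries.coeff_mk, iteratedDeriv_const, PowerSeries.coeff_C]
  split_ifs with h
  · simp [h]
  · simp

theorem coeff_zero_taylorSeries (f : ℂ → ℂ) : PowerSeries.coeff 0 (taylorSeries f) = f 0 := by
  simp [taylorSeries]

theorem taylorSeries_add {f g : ℂ → ℂ} (hf : AnalyticAt ℂ f 0) (hg : AnalyticAt ℂ g 0) :
    taylorSeries (f + g) = taylorSeries f + taylorSeries g := by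
  ext k
  simp only [taylorSeries, PowerSeries.coeff_mk, map_add]
  rw [iteratedDeriv_add hf.contDiffAt hg.contDiffAt, add_div]

theorem taylorSeries_mul {f g : ℂ → ℂ} (hf : AnalyticAt ℂ f 0) (hg : AnalyticAt ℂ g 0) :
    taylorSeries (f * g) = taylorSeries f * taylorSeries g := by
  ext k
  rw [PowerSeries.coeff_mul, Finset.Nat.sum_antidiagonal_eq_sum_range_succ_mk]
  simp only [taylorSeries, PowerSeries.coeff_mk]
  rw [iteratedDeriv_mul hf.contDiffAt hg.contDiffAt, Finset.sum_div]
  refine Finset.sum_congr rfl fun i hi ↦ ?_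
  have hik : i ≤ k := Nat.lt_succ_iff.1 (Finset.mem_range.1 hi)
  rw [Nat.cast_choose ℂ hik]
  have h1 : (k.factorial : ℂ) ≠ 0 := by exact_mod_cast k.factorial_ne_zero
  have h2 : (i.factorial : ℂ) ≠ 0 := by exact_mod_cast i.factorial_ne_zero
  have h3 : ((k - i).factorial : ℂ) ≠ 0 := by exact_mod_cast (k - i).factorial_ne_zero
  field_simp

theorem taylorSeries_deriv (f : ℂ → ℂ) :
    taylorSeries (deriv f) = PowerSeries.derivative ℂ (taylorSeries f) := by
  ext k
  rw [PowerSeries.coeff_derivative, taylorSeries, taylorSeries, PowerSeries.coeff_mk,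
    PowerSeries.coeff_mk, iteratedDeriv_succ', Nat.factorial_succ]
  have h1 : (k.factorial : ℂ) ≠ 0 := by exact_mod_cast k.factorial_ne_zero
  have h2 : (k : ℂ) + 1 ≠ 0 := by exact_mod_cast k.succ_ne_zero
  push_cast
  field_simp

theorem eventually_eq_zero_of_taylorSeries {f : ℂ → ℂ} (hf : AnalyticAt ℂ f 0)
    (h : taylorSeries f = 0) : ∀ᶠ t in 𝓝 0, f t = 0 := by
  have h1 := hf.hasFPowerSeriesAt
  have h2 : (fun k ↦ iteratedDeriv k f 0 / (k.factorial : ℂ)) = 0 := by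
    funext k
    have := congrArg (PowerSeries.coeff k) h
    simpa [taylorSeries] using this
  rw [h2] at h1
  have h3 : FormalMultilinearSeries.ofScalars ℂ (0 : ℕ → ℂ) = 0 := by
    ext; simp [FormalMultilinearSeries.ofScalars]
  rw [h3] at h1
  exact h1.eventually_eq_zero

/-! ### Expansion of regular functions along the separatrix -/

namespace CharFoliation

variable {V : SmoothProjectiveVariety}

theorem Point.value_eq (P : Point V) {f : RatFun V} (hf : f ∈ localRing P.pt) :
    P.value f = P.eval ⟨f, hf⟩ := dif_pos hf

theorem Point.value_mul (P : Point V) {f g : RatFun V} (hf : f ∈ localRing P.pt)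
    (hg : g ∈ localRing P.pt) : P.value (f * g) = P.value f * P.value g := by
  rw [P.value_eq hf, P.value_eq hg, P.value_eq (mul_mem hf hg), ← map_mul]; rfl

theorem Point.value_add (P : Point V) {f g : RatFun V} (hf : f ∈ localRing P.pt)
    (hg : g ∈ localRing P.pt) : P.value (f + g) = P.value f + P.value g := by
  rw [P.value_eq hf, P.value_eq hg, P.value_eq (add_mem hf hg), ← map_add]; rfl

theorem Point.value_algebraMap (P : Point V) (c : ℂ) : P.value (algebraMap ℂ _ c) = c := by
  rw [P.value_eq (Subalgebra.algebraMap_mem _ c)]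
  exact P.eval.commutes c

theorem Point.value_ne_zero_iff (P : Point V) {f : RatFun V} (hf : f ∈ localRing P.pt) :
    P.value f ≠ 0 ↔ f ≠ 0 ∧ f⁻¹ ∈ localRing P.pt := by
  rw [P.value_eq hf]; exact P.eval_ne_zero_iff _

section Germ

variable {p : Point V} {γ : ℂ → Point V} {U : V.X.Opens}

/-- The function is a quotient `a / b` with `b` not zero at `p`, and `b` remains non-zero along the
curve near `0` by continuity. -/
theorem eventually_mem_localRing (hγ : γ 0 = p) (hU : IsAffineOpen U) (hp : p.pt ∈ U)
    (hev : ∀ᶠ t in 𝓝 0, (γ t).pt ∈ U)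
    (han : ∀ f ∈ regularFunctions U, AnalyticAt ℂ (fun t ↦ (γ t).value f) 0)
    {f : RatFun V} (hf : f ∈ localRing p.pt) :
    (∀ᶠ t in 𝓝 0, f ∈ localRing (γ t).pt) ∧ AnalyticAt ℂ (fun t ↦ (γ t).value f) 0 := by
  obtain ⟨a, ha, b, hb, hb0, hbp, rfl⟩ := (mem_localRing_iff hU hp).1 hf
  have hb1 : (γ 0).value b ≠ 0 := by
    rw [hγ]; exact (p.value_ne_zero_iff (regularFunctions_le hp hb)).2 ⟨hb0, hbp⟩
  have hinv : ∀ᶠ t in 𝓝 0, b⁻¹ ∈ localRing (γ t).pt := by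
    filter_upwards [hev, (han b hb).continuousAt.eventually_ne hb1] with t ht hne
    exact (((γ t).value_ne_zero_iff (regularFunctions_le ht hb)).1 hne).2
  have hmem : ∀ᶠ t in 𝓝 0, a / b ∈ localRing (γ t).pt := by
    filter_upwards [hev, hinv] with t ht hi
    rw [div_eq_mul_inv]
    exact mul_mem (regularFunctions_le ht ha) hi
  refine ⟨hmem, ((han a ha).div (han b hb) hb1).congr ?_⟩
  filter_upwards [hev, hmem, (han b hb).continuousAt.eventually_ne hb1] with t ht hm hne
  have hbt : (γ t).value b ≠ 0 := hne
  rw [Pi.div_apply, div_eq_iff hbt, ← (γ t).value_mul hm (regularFunctions_le ht hb),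
    div_mul_cancel₀ _ hb0]

/-- The Taylor series of regular functions along an analytic germ of curve. -/
def taylorHom (hγ : γ 0 = p) (hU : IsAffineOpen U) (hp : p.pt ∈ U)
    (hev : ∀ᶠ t in 𝓝 0, (γ t).pt ∈ U)
    (han : ∀ f ∈ regularFunctions U, AnalyticAt ℂ (fun t ↦ (γ t).value f) 0) :
    localRing p.pt →ₐ[ℂ] PowerSeries ℂ where
  toFun f := taylorSeries fun t ↦ (γ t).value f.1
  map_one' := by
    have h : (fun t ↦ (γ t).value (1 : localRing p.pt).1) = fun _ ↦ 1 := funext fun t ↦ by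
      rw [OneMemClass.coe_one, ← map_one (algebraMap ℂ (RatFun V)), Point.value_algebraMap]
    rw [h, taylorSeries_const, map_one]
  map_zero' := by
    have h : (fun t ↦ (γ t).value (0 : localRing p.pt).1) = fun _ ↦ 0 := funext fun t ↦ by
      rw [ZeroMemClass.coe_zero, ← map_zero (algebraMap ℂ (RatFun V)), Point.value_algebraMap]
    rw [h, taylorSeries_const, map_zero]
  map_mul' f g := by
    obtain ⟨hf, hf'⟩ := eventually_mem_localRing hγ hU hp hev han f.2
    obtain ⟨hg, hg'⟩ := eventually_mem_localRing hγ hU hp hev han g.2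
    rw [← taylorSeries_mul hf' hg']
    refine taylorSeries_congr ?_
    filter_upwards [hf, hg] with t ht ht'
    exact (γ t).value_mul ht ht'
  map_add' f g := by
    obtain ⟨hf, hf'⟩ := eventually_mem_localRing hγ hU hp hev han f.2
    obtain ⟨hg, hg'⟩ := eventually_mem_localRing hγ hU hp hev han g.2
    rw [← taylorSeries_add hf' hg']
    refine taylorSeries_congr ?_
    filter_upwards [hf, hg] with t ht ht'
    exact (γ t).value_add ht ht'
  commutes' c := by
    have h : (fun t ↦ (γ t).value (algebraMap ℂ (localRing p.pt) c).1) = fun _ ↦ c :=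
      funext fun t ↦ Point.value_algebraMap _ _
    rw [h, taylorSeries_const]; rfl

/-- A function with zero Taylor series vanishes on the curve near `0`. This is where the density of
the germ enters: the principal open set of a non-zero function meets every piece of the curve around
`0`. -/
theorem taylorHom_injective (hγ : γ 0 = p) (hU : IsAffineOpen U) (hp : p.pt ∈ U)
    (hev : ∀ᶠ t in 𝓝 0, (γ t).pt ∈ U)
    (han : ∀ f ∈ regularFunctions U, AnalyticAt ℂ (fun t ↦ (γ t).value f) 0)
    (hd : IsZariskiDenseGerm γ) : Function.Injective (taylorHom hγ hU hp hev han) := by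
  rw [injective_iff_map_eq_zero]
  intro f hf
  obtain ⟨h1, h2⟩ := eventually_mem_localRing hγ hU hp hev han f.2
  have h3 := eventually_eq_zero_of_taylorSeries h2 hf
  obtain ⟨a, ha, b, hb, hb0, hbp, hab⟩ := (mem_localRing_iff hU hp).1 f.2
  have h4 : ∀ᶠ t in 𝓝 0, (γ t).pt ∈ U ∧ (γ t).value a = 0 := by
    filter_upwards [hev, h1, h3] with t ht hm h0
    have : a = f.1 * b := by rw [hab, div_mul_cancel₀ _ hb0]
    rw [this, (γ t).value_mul hm (regularFunctions_le ht hb), h0, zero_mul]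
    exact ⟨ht, rfl⟩
  by_contra hne
  have ha0 : a ≠ 0 := fun h ↦ hne (Subtype.ext (by rw [hab, h, zero_div]; rfl))
  obtain ⟨D, -, -, hD, hDne⟩ := exists_principal_open hU ha ha0 ⟨_, hp⟩
  obtain ⟨_, hx, t, ht, rfl⟩ := (hd _ h4).inter_open_nonempty D D.isOpen hDne
  obtain ⟨htU, hta⟩ := (hD _).1 hx
  exact ((γ t).value_ne_zero_iff (regularFunctions_le htU ha)).2 ⟨ha0, hta⟩ ht.2

end Germ

end CharFoliation

/-- An endomorphism whose eigenvalues generate a `ℤ`-module of maximal rank is diagonalizable, with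
eigenvalues linearly independent over `ℤ`. -/
theorem exists_eigenbasis {E : Type*} [AddCommGroup E] [Module ℂ E] [FiniteDimensional ℂ E]
    (L : Module.End ℂ E) {n : ℕ} (hn : Module.finrank ℂ E = n)
    (hL : Module.finrank ℤ (Submodule.span ℤ {c : ℂ | L.HasEigenvalue c}) = n) :
    ∃ (l : Fin n → ℂ) (v : Module.Basis (Fin n) ℂ E), LinearIndependent ℤ l ∧
      ∀ i, L (v i) = l i • v i := by
  have hfin : {c : ℂ | L.HasEigenvalue c}.Finite := Module.End.finite_hasEigenvalue L
  have : Fintype {c : ℂ | L.HasEigenvalue c} := hfin.fintype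
  have hev : ∀ c : {c : ℂ | L.HasEigenvalue c}, ∃ v, L.HasEigenvector c.1 v := fun c ↦
    c.2.exists_hasEigenvector
  choose w hw using hev
  have hli : LinearIndependent ℂ w :=
    Module.End.eigenvectors_linearIndependent' L _ Subtype.val_injective w hw
  have hle : Fintype.card {c : ℂ | L.HasEigenvalue c} ≤ n := by
    rw [← hn]; exact hli.fintype_card_le_finrank
  have hrange : Set.range (Subtype.val : {c : ℂ | L.HasEigenvalue c} → ℂ) =
      {c : ℂ | L.HasEigenvalue c} := Subtype.range_coe
  -- There are at most `n` distinct eigenvalues and they span a module of rank `n`. Hence there are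
  -- exactly `n` and they are independent.
  have hliZ : LinearIndependent ℤ (Subtype.val : {c : ℂ | L.HasEigenvalue c} → ℂ) := by
    rw [linearIndependent_iff_card_le_finrank_span, Set.finrank, hrange, hL]
    exact hle
  have hcard : Fintype.card {c : ℂ | L.HasEigenvalue c} = n := by
    rw [linearIndependent_iff_card_eq_finrank_span, Set.finrank, hrange, hL] at hliZ
    exact hliZ
  let e : Fin n ≃ {c : ℂ | L.HasEigenvalue c} := (Fintype.equivFinOfCardEq hcard).symm
  have hli' := hli.comp e e.injective
  refine ⟨fun i ↦ (e i).1, basisOfLinearIndependentOfCardEqFinrank' _ hli' (by simp [hn]),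
    hliZ.comp e e.injective, fun i ↦ ?_⟩
  rw [coe_basisOfLinearIndependentOfCardEqFinrank']
  exact (hw (e i)).apply_eq_smul

/-! ### Linear changes of coordinates -/

namespace CharFoliation

variable {V : SmoothProjectiveVariety} {U : V.X.Opens} {n : ℕ}

namespace CoordSystem

variable (C : CoordSystem U n)

theorem sum_mul_sum_eq {K : Type*} [CommRing K] {R R' : Matrix (Fin n) (Fin n) K} (h : R * R' = 1)
    (a b : Fin n → K) : ∑ k, a k * b k = ∑ i, (∑ k, R i k * a k) * ∑ k, R' k i * b k := by
  have h1 : R.mulVec a ⬝ᵥ R'.transpose.mulVec b = a ⬝ᵥ b := by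
    rw [Matrix.dotProduct_mulVec, Matrix.vecMul_transpose, Matrix.mulVec_mulVec,
      mul_eq_one_comm.1 h, Matrix.one_mulVec]
  exact h1.symm

/-- A linear change of coordinates. -/
def linearChange (R R' : Matrix (Fin n) (Fin n) ℂ) (h : R * R' = 1) : CoordSystem U n where
  affine := C.affine
  nonempty := C.nonempty
  x i := ∑ k, R' k i • C.x k
  x_mem i := sum_mem fun k _ ↦ Subalgebra.smul_mem _ (C.x_mem k) _
  d i := ∑ k, R i k • C.d k
  d_mem i := sum_mem fun k _ ↦ SMulMemClass.smul_mem _ (C.d_mem k)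
  d_x i j := by
    have h1 (k) : C.d k (∑ k, R' k j • C.x k) = algebraMap ℂ _ (R' k j) := by
      rw [map_sum, Finset.sum_eq_single k]
      · rw [Derivation.map_smul, C.d_x, if_pos rfl, Algebra.algebraMap_eq_smul_one]
      · intro l _ hl
        rw [Derivation.map_smul, C.d_x, if_neg hl.symm, smul_zero]
      · simp
    have h2 := congrArg (algebraMap ℂ (RatFun V)) (congrFun (congrFun h i) j)
    rw [Matrix.mul_apply, Matrix.one_apply, map_sum] at h2
    rw [Derivation.sum_apply]
    simp only [Derivation.smul_apply, h1]
    refine Eq.trans (Finset.sum_congr rfl fun k _ ↦ ?_) (h2.trans ?_)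
    · rw [Algebra.smul_def, map_mul]
    · split_ifs <;> simp
  eq_sum D f := by
    rw [C.eq_sum, sum_mul_sum_eq (R := R.map (algebraMap ℂ (RatFun V)))
      (R' := R'.map (algebraMap ℂ (RatFun V))) (by
        rw [← Matrix.map_mul, h, Matrix.map_one _ (map_zero _) (map_one _)])]
    refine Finset.sum_congr rfl fun i _ ↦ ?_
    congr 1
    · rw [Derivation.sum_apply]
      exact Finset.sum_congr rfl fun k _ ↦ (Algebra.smul_def (R i k) (C.d k f)).symm
    · rw [map_sum]
      exact Finset.sum_congr rfl fun k _ ↦ by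
        rw [Derivation.map_smul, Algebra.smul_def]; rfl
  tangent_eq_sum P hP v f := by
    rw [C.tangent_eq_sum P hP, sum_mul_sum_eq h]
    refine Finset.sum_congr rfl fun i _ ↦ ?_
    congr 1
    · simp only [← smul_eq_mul, ← map_smul, ← map_sum]
      refine congrArg _ (Subtype.ext ?_)
      rw [AddSubmonoidClass.coe_finsetSum]
      exact (Derivation.sum_apply Finset.univ (fun k ↦ R i k • C.d k) f.1).symm
    · simp only [← smul_eq_mul, ← map_smul, ← map_sum]
      refine congrArg _ (Subtype.ext ?_)
      rw [AddSubmonoidClass.coe_finsetSum]; rfl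

/-- The linear coordinates on `T_P X`. -/
def tangentEquiv (P : Point V) (hP : P.pt ∈ U) : TangentSpace P ≃ₗ[ℂ] (Fin n → ℂ) where
  toFun v i := v.1 ⟨C.x i, regularFunctions_le hP (C.x_mem i)⟩
  map_add' _ _ := rfl
  map_smul' _ _ := rfl
  invFun a := ∑ i, a i • valueAt (C.d_mem i) P hP
  left_inv v := (C.tangent_eq P hP v).symm
  right_inv a := by
    ext j
    change (∑ i, a i • valueAt (C.d_mem i) P hP).1
      ⟨C.x j, regularFunctions_le hP (C.x_mem j)⟩ = a j
    rw [AddSubmonoidClass.coe_finsetSum, LinearMap.sum_apply, Finset.sum_eq_single j]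
    · change a j * (valueAt (C.d_mem j) P hP).1 _ = _
      rw [C.valueAt_d_x, if_pos rfl, mul_one]
    · intro i _ hi
      change a i * (valueAt (C.d_mem i) P hP).1 _ = _
      rw [C.valueAt_d_x, if_neg hi, mul_zero]
    · simp

theorem exists_coordSystem_of_basis (C : CoordSystem U n) (P : Point V) (hP : P.pt ∈ U)
    (v : Module.Basis (Fin n) ℂ (TangentSpace P)) :
    ∃ C' : CoordSystem U n, (∀ i, valueAt (C'.d_mem i) P hP = v i) := by
  let b : Module.Basis (Fin n) ℂ (Fin n → ℂ) := v.map (C.tangentEquiv P hP)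
  let R : Matrix (Fin n) (Fin n) ℂ := Matrix.of fun i k ↦ C.tangentEquiv P hP (v i) k
  have hunit : IsUnit R.det := by
    have h1 : LinearIndependent ℂ R.row := by
      have h2 : R.row = b := by
        funext i; ext k
        rw [Module.Basis.map_apply]; rfl
      rw [h2]; exact b.linearIndependent
    exact (Matrix.isUnit_iff_isUnit_det _).1 (Matrix.linearIndependent_rows_iff_isUnit.1 h1)
  refine ⟨C.linearChange R R⁻¹ (Matrix.mul_nonsing_inv _ hunit), fun i ↦ ?_⟩
  rw [C.tangent_eq P hP (v i)]
  refine Subtype.ext (LinearMap.ext fun f ↦ ?_)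
  rw [AddSubmonoidClass.coe_finsetSum, LinearMap.sum_apply]
  have h2 (k : Fin n) : (v i).1 ⟨C.x k, regularFunctions_le hP (C.x_mem k)⟩ = R i k := rfl
  change P.eval ⟨(∑ k, R i k • C.d k) f.1, _⟩ = ∑ k, (v i).1 _ * P.eval ⟨C.d k f.1, _⟩
  simp only [h2, ← smul_eq_mul, ← map_smul, ← map_sum]
  refine congrArg _ (Subtype.ext ?_)
  rw [AddSubmonoidClass.coe_finsetSum]
  exact Derivation.sum_apply Finset.univ (fun k ↦ R i k • C.d k) f.1

end CoordSystem

end CharFoliation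

/-! ### The formal restriction of the foliation to the separatrix -/

/-- Two derivations which are proportional on sufficiently many elements are proportional. -/
theorem mul_eq_mul_of_leibniz {R T : Type*} [CommRing R] [CommRing T] [IsDomain T] (Φ : R →+* T)
    (hΦ : Function.Injective Φ) {u w : R → T} (hu : ∀ f g, u (f * g) = Φ f * u g + Φ g * u f)
    (hw : ∀ f g, w (f * g) = Φ f * w g + Φ g * w f) (S : Set R)
    (hS : ∀ f, ∃ b ∈ S, b ≠ 0 ∧ b * f ∈ S) (h : ∀ f ∈ S, ∀ g ∈ S, u f * w g = u g * w f) (f g : R) :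
    u f * w g = u g * w f := by
  have h1 : ∀ f, ∀ g ∈ S, u f * w g = u g * w f := by
    intro f g hg
    obtain ⟨b, hb, hb0, hbf⟩ := hS f
    have e1 := h _ hbf g hg
    have e2 := h b hb g hg
    rw [hu, hw] at e1
    have hΦb : Φ b ≠ 0 := (map_ne_zero_iff Φ hΦ).2 hb0
    refine mul_left_cancel₀ hΦb ?_
    linear_combination e1 - Φ f * e2
  obtain ⟨b, hb, hb0, hbg⟩ := hS g
  have e1 := h1 f _ hbg
  have e2 := h1 f b hb
  rw [hu, hw] at e1
  have hΦb : Φ b ≠ 0 := (map_ne_zero_iff Φ hΦ).2 hb0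
  refine mul_left_cancel₀ hΦb ?_
  linear_combination e1 - Φ g * e2

/-- An invariant formal curve through a singular point is tangent to an eigenvector of the linear
part, and the vector field restricts to the curve. -/
theorem exists_formal_restriction {R : Type*} [CommRing R] [Algebra ℂ R] (ev : R →ₐ[ℂ] ℂ)
    (Φ : R →ₐ[ℂ] PowerSeries ℂ) (hΦ : Function.Injective Φ)
    (hΦev : ∀ f, PowerSeries.coeff 0 (Φ f) = ev f) (ξ : R → R) (hξ : ∀ f, ev (ξ f) = 0)
    (hrel : ∀ f g, Φ (ξ f) * PowerSeries.derivative ℂ (Φ g) =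
      Φ (ξ g) * PowerSeries.derivative ℂ (Φ f)) (hne : ∃ f, f ≠ 0 ∧ ev f = 0) :
    ∃ (v : R →ₗ[ℂ] ℂ) (r : ℕ) (c : PowerSeries ℂ) (a : ℂ), v ≠ 0 ∧ r ≠ 0 ∧
      (∀ f g, v (f * g) = ev f * v g + ev g * v f) ∧ (∀ f, v (ξ f) = a * v f) ∧
      PowerSeries.coeff 0 c = 0 ∧ r * PowerSeries.coeff 1 c = a ∧
      ∀ f, Φ (ξ f) = c * PowerSeries.derivative ℂ (Φ f) := by
  classical
  -- The integer `r` is the least order along the curve of the functions which vanish at the point.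
  -- The coefficient of `t ^ r` is then a derivation at the point, the tangent direction `v`.
  have hex : ∃ N, ∃ f, ev f = 0 ∧ PowerSeries.coeff N (Φ f) ≠ 0 := by
    obtain ⟨f, hf, hf0⟩ := hne
    by_contra! h
    refine hf (hΦ ?_)
    rw [map_zero]
    ext N
    rw [h N f hf0, map_zero]
  obtain ⟨g₀, hg₀, hg₀'⟩ := Nat.find_spec hex
  have hmin : ∀ k < Nat.find hex, ∀ f, ev f = 0 → PowerSeries.coeff k (Φ f) = 0 := by
    intro k hk f hf
    have := Nat.find_min hex hk
    push Not at this
    exact this f hf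
  generalize Nat.find hex = r at hg₀' hmin
  have hr : r ≠ 0 := by
    rintro rfl
    rw [hΦev] at hg₀'
    exact hg₀' hg₀
  have hφ (f) : ∃ φ, Φ f = PowerSeries.C (ev f) + PowerSeries.X ^ r * φ := by
    have : PowerSeries.X ^ r ∣ Φ (f - algebraMap ℂ R (ev f)) :=
      PowerSeries.X_pow_dvd_iff.2 fun k hk ↦ hmin k hk _ (by simp)
    obtain ⟨φ, hφ⟩ := this
    refine ⟨φ, ?_⟩
    rw [map_sub, AlgHom.commutes] at hφ
    rw [← hφ]
    change _ = _ + (_ - PowerSeries.C (ev f))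
    ring
  choose φ hφ using hφ
  have hcr (z : PowerSeries ℂ) (b : ℂ) : PowerSeries.coeff r (PowerSeries.C b +
      PowerSeries.X ^ r * z) = PowerSeries.coeff 0 z := by
    have h1 := PowerSeries.coeff_X_pow_mul z r 0
    rw [zero_add] at h1
    rw [map_add, h1, PowerSeries.coeff_C, if_neg hr, zero_add]
  let v : R →ₗ[ℂ] ℂ := (PowerSeries.coeff r).comp Φ.toLinearMap
  have hvdef (f) : v f = PowerSeries.coeff r (Φ f) := rfl
  have hv (f) : v f = PowerSeries.coeff 0 (φ f) := by rw [hvdef, hφ, hcr]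
  have hξφ (f) : Φ (ξ f) = PowerSeries.X ^ r * φ (ξ f) := by
    rw [hφ, hξ, map_zero, zero_add]
  -- This is the quotient of `t d/dt (Φ f)` by `t ^ r`; its constant term is `r` times `v f`.
  let u (f) := PowerSeries.C (r : ℂ) * φ f + PowerSeries.X * PowerSeries.derivative ℂ (φ f)
  have hu0 (f) : PowerSeries.coeff 0 (u f) = r * v f := by
    rw [hv]; simp [u]
  have hu (f) : PowerSeries.X * PowerSeries.derivative ℂ (Φ f) = PowerSeries.X ^ r * u f := by
    have hC : (PowerSeries.C (r : ℂ) : PowerSeries ℂ) = (r : PowerSeries ℂ) := map_natCast _ r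
    obtain ⟨s, rfl⟩ := Nat.exists_eq_add_one_of_ne_zero hr
    rw [hφ f, map_add, Derivation.leibniz, Derivation.leibniz_pow, PowerSeries.derivative_X,
      PowerSeries.derivative_C]
    simp only [u, hC, smul_eq_mul, nsmul_eq_mul, Nat.add_sub_cancel]
    ring
  have hm (a b : PowerSeries ℂ) : PowerSeries.coeff 0 (a * b) =
      PowerSeries.coeff 0 a * PowerSeries.coeff 0 b := by simp
  have hX : (PowerSeries.X : PowerSeries ℂ) ^ r ≠ 0 := pow_ne_zero _ PowerSeries.X_ne_zero
  have hrelu (f g) : φ (ξ f) * u g = φ (ξ g) * u f := by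
    have h1 := hrel f g
    rw [hξφ f, hξφ g] at h1
    refine mul_left_cancel₀ hX (mul_left_cancel₀ hX ?_)
    linear_combination PowerSeries.X * h1 - PowerSeries.X ^ r * φ (ξ f) * hu g +
      PowerSeries.X ^ r * φ (ξ g) * hu f
  have hrelv (f g) : v (ξ f) * v g = v (ξ g) * v f := by
    have h1 := congrArg (PowerSeries.coeff 0) (hrelu f g)
    simp only [hm] at h1
    rw [hu0, hu0, ← hv, ← hv] at h1
    have hr' : (r : ℂ) ≠ 0 := by exact_mod_cast hr
    refine mul_left_cancel₀ hr' ?_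
    linear_combination h1
  have hvg₀ : v g₀ ≠ 0 := hg₀'
  have hr' : (r : ℂ) ≠ 0 := by exact_mod_cast hr
  have hu₀ : PowerSeries.constantCoeff (R := ℂ) (u g₀) ≠ 0 := by
    rw [← PowerSeries.coeff_zero_eq_constantCoeff_apply, hu0]
    exact mul_ne_zero hr' hvg₀
  have hinv : u g₀ * (u g₀)⁻¹ = 1 := PowerSeries.mul_inv_cancel _ hu₀
  -- The relation `Φ (ξ g₀) = c * (Φ g₀)'` forces this value of `c`, where `u g₀` is invertible
  -- because `v g₀ ≠ 0`. Proportionality extends the relation to all functions. The factor `r` in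
  -- the constant term of `u g₀` explains why the linear coefficient of `c` is `a / r` and not `a`.
  refine ⟨v, r, PowerSeries.X * (φ (ξ g₀) * (u g₀)⁻¹), v (ξ g₀) / v g₀, fun h ↦ hvg₀ ?_, hr,
    fun f g ↦ ?_, fun f ↦ ?_, by simp, ?_, fun f ↦ ?_⟩
  · rw [h]; rfl
  · have e : Φ (f * g) = PowerSeries.C (ev f * ev g) + PowerSeries.X ^ r *
        (PowerSeries.C (ev f) * φ g + PowerSeries.C (ev g) * φ f +
          PowerSeries.X ^ r * (φ f * φ g)) := by
      rw [map_mul, hφ f, hφ g, map_mul]; ring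
    rw [hvdef, e, hcr, hv, hv]
    simp [hr]
  · rw [div_mul_eq_mul_div, eq_div_iff hvg₀, hrelv]
  · rw [← zero_add 1, PowerSeries.coeff_succ_X_mul]
    have h1 : PowerSeries.coeff 0 (φ (ξ g₀) * (u g₀)⁻¹) * PowerSeries.coeff 0 (u g₀) =
        PowerSeries.coeff 0 (φ (ξ g₀)) := by
      rw [← hm, mul_assoc, mul_comm _ (u g₀), hinv, mul_one]
    rw [hu0, ← hv] at h1
    rw [eq_div_iff hvg₀]
    linear_combination h1
  · rw [hξφ]
    linear_combination -(PowerSeries.X ^ r * φ (ξ f)) * hinv +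
      PowerSeries.X ^ r * (u g₀)⁻¹ * hrelu f g₀ - φ (ξ g₀) * (u g₀)⁻¹ * hu f

namespace CharFoliation

variable {V : SmoothProjectiveVariety}

theorem CoordSystem.exists_le (x : V.X) {W : V.X.Opens} (hx : x ∈ W) :
    ∃ (U : V.X.Opens) (n : ℕ) (_ : CoordSystem U n), x ∈ U ∧ U ≤ W := by
  obtain ⟨U, n, hxU, ⟨C⟩⟩ := exists_coordSystem x
  obtain ⟨a, ha, ha0, hax, haW⟩ := exists_principal_open_le C.affine hxU hx
  obtain ⟨D, hDaff, hDU, hD, hDne⟩ := exists_principal_open C.affine ha ha0 ⟨x, hxU⟩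
  exact ⟨D, n, C.restrict hDaff hDne hDU, (hD x).2 ⟨hxU, hax⟩, fun y hy ↦
    haW y ((hD y).1 hy).1 ((hD y).1 hy).2⟩

/-- The separatrix is described by the generator of index `j` and functions regular on `U`. Another
generator differs by a factor regular at `p`, and both sides obey the Leibniz rule along `Φ`, which
extends proportionality to the fractions in the local ring. -/
theorem IsSeparatrix.derivative_mul_eq {F : Foliation V} {p : Point V} {γ : ℂ → Point V}
    (hγ : γ 0 = p) {j : F.ι} {U : V.X.Opens} (hU : IsAffineOpen U) (hUj : U ≤ F.U j) (hp : p.pt ∈ U)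
    (hev : ∀ᶠ t in 𝓝 0, (γ t).pt ∈ U)
    (han : ∀ f ∈ regularFunctions U, AnalyticAt ℂ (fun t ↦ (γ t).value f) 0)
    (hrel : ∀ f ∈ regularFunctions U, ∀ g ∈ regularFunctions U, ∀ᶠ t in 𝓝 0,
      deriv (fun s ↦ (γ s).value f) t * (γ t).value (F.gen j g) =
        deriv (fun s ↦ (γ s).value g) t * (γ t).value (F.gen j f))
    (hd : IsZariskiDenseGerm γ) (i : F.ι) (hi : p.pt ∈ F.U i) (f g : localRing p.pt) :
    taylorHom hγ hU hp hev han ⟨F.gen i f.1, F.gen_mem i _ hi _ f.2⟩ *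
        PowerSeries.derivative ℂ (taylorHom hγ hU hp hev han g) =
      taylorHom hγ hU hp hev han ⟨F.gen i g.1, F.gen_mem i _ hi _ g.2⟩ *
        PowerSeries.derivative ℂ (taylorHom hγ hU hp hev han f) := by
  have hinj := taylorHom_injective hγ hU hp hev han hd
  set Φ := taylorHom hγ hU hp hev han with hΦ
  have hΦ' (f) : Φ f = taylorSeries fun t ↦ (γ t).value f.1 := rfl
  obtain ⟨h, hh, -, hij⟩ := F.compat i j
  have hhp := regularFunctions_le (U := F.U i ⊓ F.U j) (x := p.pt) ⟨hi, hUj hp⟩ hh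
  let η (f : localRing p.pt) : localRing p.pt := ⟨F.gen j f.1, F.gen_mem j _ (hUj hp) _ f.2⟩
  have hξ (f : localRing p.pt) : (⟨F.gen i f.1, F.gen_mem i _ hi _ f.2⟩ : localRing p.pt) =
      ⟨h, hhp⟩ * η f := by
    refine Subtype.ext ?_
    change F.gen i f.1 = h * F.gen j f.1
    rw [hij]; rfl
  rw [hξ, hξ, map_mul, map_mul, mul_assoc, mul_assoc]
  congr 1
  refine mul_eq_mul_of_leibniz Φ.toRingHom hinj (u := fun f ↦ Φ (η f))
    (w := fun f ↦ PowerSeries.derivative ℂ (Φ f)) (fun f g ↦ ?_) (fun f g ↦ ?_)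
    {f | f.1 ∈ regularFunctions U} (fun f ↦ ?_) (fun f hf g hg ↦ ?_) f g
  · have : η (f * g) = f * η g + g * η f := Subtype.ext ((F.gen j).leibniz f.1 g.1)
    change Φ (η (f * g)) = Φ f * Φ (η g) + Φ g * Φ (η f)
    rw [this, map_add, map_mul, map_mul]
  · change PowerSeries.derivative ℂ (Φ (f * g)) = Φ f * _ + Φ g * _
    rw [map_mul, Derivation.leibniz]; rfl
  · obtain ⟨a, ha, b, hb, hb0, hbp, hab⟩ := (mem_localRing_iff hU hp).1 f.2
    refine ⟨⟨b, regularFunctions_le hp hb⟩, hb, fun h ↦ hb0 (congrArg Subtype.val h), ?_⟩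
    change b * f.1 ∈ regularFunctions U
    rw [hab, mul_div_cancel₀ _ hb0]
    exact ha
  · obtain ⟨-, h1⟩ := eventually_mem_localRing hγ hU hp hev han f.2
    obtain ⟨-, h2⟩ := eventually_mem_localRing hγ hU hp hev han g.2
    obtain ⟨-, h3⟩ := eventually_mem_localRing hγ hU hp hev han (η f).2
    obtain ⟨-, h4⟩ := eventually_mem_localRing hγ hU hp hev han (η g).2
    have h5 := taylorSeries_congr (f := deriv (fun s ↦ (γ s).value f.1) *
        fun t ↦ (γ t).value (η g).1) (g := deriv (fun s ↦ (γ s).value g.1) *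
        fun t ↦ (γ t).value (η f).1) (hrel f.1 hf g.1 hg)
    rw [taylorSeries_mul h1.deriv h4, taylorSeries_mul h2.deriv h3, taylorSeries_deriv,
      taylorSeries_deriv] at h5
    change Φ (η f) * PowerSeries.derivative ℂ (Φ g) = Φ (η g) * PowerSeries.derivative ℂ (Φ f)
    rw [mul_comm, mul_comm (Φ (η g))]
    exact h5.symm

/-- At a non-resonant singularity, with a Zariski dense separatrix: coordinates which diagonalize
the linear part, and the formal restriction of the foliation to the separatrix. -/
theorem exists_formal_separatrix (F : Foliation V) (p : Point V) (hp : F.IsNonResonant p)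
    (hsep : ∃ γ : ℂ → Point V, F.IsSeparatrix p γ ∧ IsZariskiDenseGerm γ) :
    ∃ (i : F.ι) (U : V.X.Opens) (n : ℕ) (C : CoordSystem U n) (hξ : F.gen i ∈ vectorFields U)
      (Φ : regularFunctions U →ₐ[ℂ] PowerSeries ℂ) (l : Fin n → ℂ) (i₀ : Fin n) (r : ℕ)
      (c : PowerSeries ℂ), U ≤ F.U i ∧ Function.Injective Φ ∧ LinearIndependent ℤ l ∧ r ≠ 0 ∧
      r * PowerSeries.coeff 1 c = l i₀ ∧ PowerSeries.coeff 0 c = 0 ∧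
      (∀ f : regularFunctions U, Φ ⟨F.gen i f.1, apply_mem_regularFunctions hξ f.2⟩ =
        c * PowerSeries.derivative ℂ (Φ f)) ∧
      ∀ j k, PowerSeries.coeff 0 (Φ ⟨C.d j (F.gen i (C.x k)), apply_mem_regularFunctions (C.d_mem j)
        (apply_mem_regularFunctions hξ (C.x_mem k))⟩) = if j = k then l j else 0 := by
  obtain ⟨hsing, -, i, hi, h0, hbij, hfin⟩ := hp
  obtain ⟨γ, ⟨hγ, -, j, U', hU', hUj, hp', hev, han, hrel⟩, hd⟩ := hsep
  obtain ⟨U, n, C₁, hpU, hU⟩ := CoordSystem.exists_le p.pt hi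
  have hξ := vectorFields_mono hU (F.gen_mem i)
  set L := linearPart (F.gen_mem i) p hi h0 with hL
  have hfd : FiniteDimensional ℂ (TangentSpace p) :=
    Module.Finite.equiv (C₁.tangentEquiv p hpU).symm
  have hdim : Module.finrank ℂ (TangentSpace p) = n := by
    rw [(C₁.tangentEquiv p hpU).finrank_eq, Module.finrank_fin_fun]
  obtain ⟨l, b, hl, hb⟩ := exists_eigenbasis L hdim (hfin.trans hdim)
  obtain ⟨C, hC⟩ := C₁.exists_coordSystem_of_basis p hpU b
  have hsingf (f : localRing p.pt) : p.eval ⟨F.gen i f.1, F.gen_mem i _ hi _ f.2⟩ = 0 :=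
    LinearMap.congr_fun (congrArg Subtype.val h0) f
  -- Otherwise every function regular at `p` would be constant, the coordinates in particular, and
  -- the generator would be zero.
  have hne : ∃ f : localRing p.pt, f ≠ 0 ∧ p.eval f = 0 := by
    by_contra! h
    refine F.gen_ne_zero i (Derivation.ext fun f ↦ ?_)
    rw [C.eq_sum]
    refine Finset.sum_eq_zero fun k _ ↦ ?_
    let xk : localRing p.pt := ⟨C.x k, regularFunctions_le hpU (C.x_mem k)⟩
    have h1 : xk - algebraMap ℂ _ (p.eval xk) = 0 := by
      by_contra hne
      exact h _ hne (by simp)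
    have h2 : C.x k = algebraMap ℂ _ (p.eval xk) := congrArg Subtype.val (sub_eq_zero.1 h1)
    rw [h2, Derivation.map_algebraMap, mul_zero]
  obtain ⟨v, r, c, a, hv0, hr, hv, hva, hc0, hc1, hc⟩ := exists_formal_restriction p.eval
    (taylorHom hγ hU' hp' hev han) (taylorHom_injective hγ hU' hp' hev han hd)
    (fun f ↦ by
      change PowerSeries.coeff 0 (taylorSeries fun t ↦ (γ t).value f.1) = _
      rw [coeff_zero_taylorSeries, hγ, p.value_eq])
    (fun f ↦ ⟨F.gen i f.1, F.gen_mem i _ hi _ f.2⟩) hsingf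
    (IsSeparatrix.derivative_mul_eq hγ hU' hUj hp' hev han hrel hd i hi) hne
  let v' : TangentSpace p := ⟨v, hv⟩
  have hLv : L v' = a • v' := Subtype.ext (LinearMap.ext fun f ↦ hva f)
  -- The tangent direction `v'` is an eigenvector; any basis vector on which it has a non-zero
  -- component has the same eigenvalue.
  obtain ⟨i₀, hi₀⟩ : ∃ i₀, b.repr v' i₀ ≠ 0 := by
    by_contra! h
    refine hv0 (congrArg Subtype.val (b.repr.injective (a₁ := v') (a₂ := 0) ?_))
    rw [map_zero]; exact Finsupp.ext h
  have ha : a = l i₀ := by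
    have h1 : b.repr (L v') i₀ = l i₀ * b.repr v' i₀ := by
      have h2 : L v' = ∑ x, (b.repr v' x * l x) • b x := by
        conv_lhs => rw [← b.sum_repr v', map_sum]
        exact Finset.sum_congr rfl fun x _ ↦ by rw [map_smul, hb, smul_smul]
      rw [h2, b.repr_sum_self (fun x ↦ b.repr v' x * l x), mul_comm]
    rw [hLv, map_smul, Finsupp.smul_apply, smul_eq_mul] at h1
    exact mul_right_cancel₀ hi₀ h1
  have hle : regularFunctions U ≤ localRing p.pt := fun f hf ↦ regularFunctions_le hpU hf
  let inc : regularFunctions U →ₐ[ℂ] localRing p.pt := Subalgebra.inclusion hle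
  refine ⟨i, U, n, C, hξ, (taylorHom hγ hU' hp' hev han).comp inc, l, i₀, r, c, hU,
    (taylorHom_injective hγ hU' hp' hev han hd).comp (Subalgebra.inclusion_injective hle),
    hl, hr, hc1.trans ha, hc0, fun f ↦ hc (inc f), fun j k ↦ ?_⟩
  change PowerSeries.coeff 0 (taylorSeries fun t ↦ (γ t).value (C.d j (F.gen i (C.x k)))) = _
  have hxk := F.gen_mem i _ hi _ (regularFunctions_le hpU (C.x_mem k))
  rw [coeff_zero_taylorSeries, hγ, p.value_eq (C.d_mem j _ hpU _ hxk)]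
  change (valueAt (C.d_mem j) p hpU).1 ⟨F.gen i (C.x k), hxk⟩ = _
  have h2 : (L (b j)).1 ⟨C.x k, regularFunctions_le hpU (C.x_mem k)⟩ =
      (b j).1 ⟨F.gen i (C.x k), hxk⟩ := rfl
  rw [hC, ← h2, hb]
  change l j * (b j).1 _ = _
  rw [← hC, C.valueAt_d_x]
  split_ifs <;> simp

end CharFoliation

/-! ### The generic fibre of `Y` is a union of linear subspaces -/

namespace CharFoliation

variable {V : SmoothProjectiveVariety}

/-- The algebraic closure of the field of rational functions. -/
abbrev RatFunClosure (V : SmoothProjectiveVariety) : Type := AlgebraicClosure (RatFun V)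

instance : CharZero (RatFun V) := 
  charZero_of_injective_algebraMap (algebraMap ℂ (RatFun V)).injective

/-- The union of subspaces is first obtained over `Ω`, an algebraic closure of the field of
fractions of `ℂ⟦t⟧`. The injection `Φ` makes `Ω` an extension of `ℂ(X)`, so the algebraic closure of
`ℂ(X)` embeds in it, and linearity is inherited by the points with coordinates in this subfield. -/
theorem exists_zeroLocus_genericIdeal_eq (F : Foliation V) (p : Point V) (hp : F.IsNonResonant p)
    (hsep : ∃ γ : ℂ → Point V, F.IsSeparatrix p γ ∧ IsZariskiDenseGerm γ)
    {Y : Set (CotangentBundle V)} (hYsub : Y ⊆ F.characteristicVariety)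
    (hYinv : F.IsProlongationInvariant Y) :
    ∃ (i : F.ι) (U : V.X.Opens) (n : ℕ) (C : CoordSystem U n), U ≤ F.U i ∧
      ∃ S : Finset (Submodule (RatFunClosure V) (Fin n → RatFunClosure V)),
        MvPolynomial.zeroLocus (RatFunClosure V) (C.genericIdeal Y) =
          ⋃ E ∈ S, (E : Set (Fin n → RatFunClosure V)) := by
  obtain ⟨i, U, n, C, hξ, Φ, l, i₀, r, c, hU, hΦ, hl, hr, hc1, hc0, hΦξ, hB⟩ :=
    exists_formal_separatrix F p hp hsep
  refine ⟨i, U, n, C, hU, ?_⟩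
  obtain ⟨δ, hδC, hδX, hδ⟩ := C.exists_derivation_symbol hξ
  let Ω := AlgebraicClosure (FractionRing (PowerSeries ℂ))
  let θ : PowerSeries ℂ →+* Ω := (algebraMap (FractionRing (PowerSeries ℂ)) Ω).comp
    (algebraMap (PowerSeries ℂ) (FractionRing (PowerSeries ℂ)))
  have hθ : Function.Injective θ := (algebraMap (FractionRing (PowerSeries ℂ)) Ω).injective.comp
    (IsFractionRing.injective (PowerSeries ℂ) (FractionRing (PowerSeries ℂ)))
  let a (k : Fin n) : regularFunctions U :=
    ⟨F.gen i (C.x k), apply_mem_regularFunctions hξ (C.x_mem k)⟩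
  have ha : a ≠ 0 := by
    intro h
    refine F.gen_ne_zero i (Derivation.ext fun f ↦ ?_)
    rw [C.eq_sum]
    refine Finset.sum_eq_zero fun k _ ↦ ?_
    have : F.gen i (C.x k) = 0 := congrArg Subtype.val (congrFun h k)
    rw [this, mul_zero]
  -- A hamiltonian is a first integral of its own hamiltonian vector field; here this is `[ξ, ξ] =
  -- 0`.
  have haδ : δ (C.linearForm hξ) = 0 := by
    have h1 := hδ (MvPolynomial.X (Sum.inr ⟨F.gen i, hξ⟩))
    rw [C.symbol_inr, prolongation, MvPolynomial.mkDerivation_X, Sum.elim_inr, C.symbol_inr] at h1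
    rw [← h1, CoordSystem.linearForm]
    refine Finset.sum_eq_zero fun k _ ↦ ?_
    have : (⟨⁅F.gen i, F.gen i⁆ (C.x k), apply_mem_regularFunctions
        ((vectorFields U).lie_mem hξ hξ) (C.x_mem k)⟩ : regularFunctions U) = 0 :=
      Subtype.ext (by
        change ⁅F.gen i, F.gen i⁆ (C.x k) = 0
        rw [lie_self]; rfl)
    rw [this, map_zero, zero_mul]
  obtain ⟨S, hS⟩ := zeroLocus_eq_iUnion_of_invariant (I := C.vanishing Y)
    (fun f ↦ ⟨F.gen i f.1, apply_mem_regularFunctions hξ f.2⟩) δ hδC hδX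
    (fun f hf ↦ C.derivation_mem_vanishing hYinv hU hξ δ hδ hf) ha
    (C.linearForm_mem_vanishing hYsub hU hξ) haδ hl hr hc1 hc0 rfl Φ hΦ hΦξ hB θ hθ
  have := isFractionRing_regularFunctions C.affine C.nonempty
  let φ : RatFun V →+* Ω := IsFractionRing.lift (A := regularFunctions U)
    (g := θ.comp Φ.toRingHom) (hθ.comp hΦ)
  have hφ (f : regularFunctions U) : φ f.1 = θ (Φ f) := IsFractionRing.lift_algebraMap _ f
  let _ : Algebra (RatFun V) Ω := φ.toAlgebra
  let ψ : RatFunClosure V →ₐ[RatFun V] Ω := IsAlgClosed.lift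
  obtain ⟨S', hS'⟩ := exists_iUnion_eq_preimage ψ.toRingHom S
  refine ⟨S', ?_⟩
  rw [← hS', ← hS]
  have heval (z : Fin n → RatFunClosure V) (g : MvPolynomial (Fin n) (regularFunctions U)) :
      ψ (MvPolynomial.aeval z (MvPolynomial.map (algebraMap (regularFunctions U) (RatFun V)) g)) =
        MvPolynomial.eval₂ (θ.comp Φ.toRingHom) (ψ.toRingHom ∘ z) g := by
    have : (ψ.toRingHom.comp (MvPolynomial.aeval (R := RatFun V) z).toRingHom).comp
        (MvPolynomial.map (algebraMap (regularFunctions U) (RatFun V))) =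
        MvPolynomial.eval₂Hom (θ.comp Φ.toRingHom) (ψ.toRingHom ∘ z) := by
      refine MvPolynomial.ringHom_ext (fun f ↦ ?_) fun j ↦ ?_
      · rw [MvPolynomial.eval₂Hom_C, RingHom.comp_apply, MvPolynomial.map_C]
        change ψ (MvPolynomial.aeval z (MvPolynomial.C f.1)) = _
        rw [MvPolynomial.aeval_C, AlgHom.commutes]
        exact hφ f
      · rw [MvPolynomial.eval₂Hom_X', RingHom.comp_apply, MvPolynomial.map_X]
        change ψ (MvPolynomial.aeval z (MvPolynomial.X j)) = _
        rw [MvPolynomial.aeval_X]; rfl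
    exact RingHom.congr_fun this g
  ext z
  change (∀ g ∈ C.genericIdeal Y, MvPolynomial.aeval z g = 0) ↔
    ∀ g ∈ C.vanishing Y, MvPolynomial.eval₂ (θ.comp Φ.toRingHom) (ψ.toRingHom ∘ z) g = 0
  simp only [← heval, map_eq_zero]
  refine ⟨fun h g hg ↦ h _ (Ideal.mem_map_of_mem _ hg), fun h ↦ ?_⟩
  have : C.genericIdeal Y ≤ RingHom.ker (MvPolynomial.aeval (R := RatFun V) z) :=
    Ideal.map_le_iff_le_comap.2 h
  exact fun g hg ↦ this hg

end CharFoliation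

/-! ### Specialization of algebraic functions -/

/-- By lying-over there is a prime of `B` above the kernel of `φ`. Its residue ring is a field
integral over `ℂ`, hence equal to `ℂ`. -/
theorem exists_extension_of_isIntegral {A B : Type*} [CommRing A] [CommRing B] [Algebra ℂ A]
    [Algebra A B] [Algebra.IsIntegral A B] (hinj : Function.Injective (algebraMap A B))
    (φ : A →ₐ[ℂ] ℂ) : ∃ ψ : B →+* ℂ, ∀ a, ψ (algebraMap A B a) = φ a := by
  let _ : Algebra ℂ B := ((algebraMap A B).comp (algebraMap ℂ A)).toAlgebra
  have htower : IsScalarTower ℂ A B := IsScalarTower.of_algebraMap_eq fun _ ↦ rfl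
  have hs : Function.Surjective φ := fun c ↦ ⟨algebraMap ℂ _ c, by simp⟩
  have hm : (RingHom.ker φ).IsMaximal := RingHom.ker_isMaximal_of_surjective _ hs
  obtain ⟨Q, hQ, hQA⟩ := Ideal.exists_ideal_over_maximal_of_isIntegral (S := B) (RingHom.ker φ) (by
    rw [(RingHom.injective_iff_ker_eq_bot _).1 hinj]; exact bot_le)
  let _ : Field (B ⧸ Q) := Ideal.Quotient.field Q
  have hA (a : A) : Ideal.Quotient.mk Q (algebraMap A B a) = algebraMap ℂ (B ⧸ Q) (φ a) := by
    have h1 : a - algebraMap ℂ A (φ a) ∈ RingHom.ker φ := by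
      rw [RingHom.mem_ker, map_sub, AlgHom.commutes]; simp
    rw [← hQA, Ideal.mem_comap] at h1
    have h2 := Ideal.Quotient.eq_zero_iff_mem.2 h1
    rw [map_sub, map_sub, sub_eq_zero] at h2
    exact h2
  have hint : Algebra.IsIntegral ℂ (B ⧸ Q) := ⟨fun z ↦ by
    obtain ⟨b, rfl⟩ := Ideal.Quotient.mk_surjective z
    obtain ⟨f, hf, hfb⟩ := Algebra.IsIntegral.isIntegral (R := A) b
    refine ⟨f.map φ.toRingHom, hf.map _, ?_⟩
    rw [Polynomial.eval₂_map]
    have h1 : (algebraMap ℂ (B ⧸ Q)).comp φ.toRingHom =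
        (Ideal.Quotient.mk Q).comp (algebraMap A B) := RingHom.ext fun a ↦ (hA a).symm
    rw [h1, ← Polynomial.hom_eval₂, hfb, map_zero]⟩
  have hbij := IsAlgClosed.algebraMap_bijective_of_isIntegral (k := ℂ) (K := B ⧸ Q)
  let e := RingEquiv.ofBijective (algebraMap ℂ (B ⧸ Q)) hbij
  refine ⟨e.symm.toRingHom.comp (Ideal.Quotient.mk Q), fun a ↦ ?_⟩
  rw [RingHom.comp_apply, hA]
  exact e.symm_apply_apply _

theorem isIntegral_of_coeff_mem {k Ω : Type*} [Field k] [Field Ω] [Algebra k Ω] {R : Type*}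
    [CommRing R] [Algebra R k] (A : Subalgebra R k) {z : Ω} (hz : IsIntegral k z)
    (h : ∀ c ∈ (minpoly k z).coeffs, c ∈ A) : IsIntegral A z := by
  have h1 : minpoly k z ∈ Polynomial.lifts (algebraMap A k) := by
    rw [Polynomial.lifts_iff_coeff_lifts]
    intro m
    by_cases h0 : (minpoly k z).coeff m = 0
    · exact ⟨0, by rw [h0, map_zero]⟩
    · exact ⟨⟨_, h _ (Polynomial.coeff_mem_coeffs h0)⟩, rfl⟩
  obtain ⟨g, hg, -, hgm⟩ := Polynomial.lifts_and_natDegree_eq_and_monic h1 (minpoly.monic hz)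
  refine ⟨g, hgm, ?_⟩
  have h2 := minpoly.aeval k z
  rw [← hg, Polynomial.aeval_map_algebraMap] at h2
  exact h2

section Fibre

open MvPolynomial

variable {A B : Type*} [CommRing A] [CommRing B] [Algebra A B] {n q : ℕ}

theorem eval_equations {R : Type*} [CommRing R] (ι : Fin q → Fin n) (M : Matrix (Fin n) (Fin q) R)
    (t : ℕ) (z : Fin n → R) : eval z (equations ι M t) =
      ∑ i : Fin n, (t : R) ^ (i : ℕ) * (z i - ∑ a, M i a * z (ι a)) := by
  simp [equations]

theorem map_equations {R S : Type*} [CommRing R] [CommRing S] (f : R →+* S) (ι : Fin q → Fin n)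
    (M : Matrix (Fin n) (Fin q) R) (t : ℕ) :
    MvPolynomial.map f (equations ι M t) = equations ι (M.map f) t := by
  simp [equations]

theorem map_pluckerForm {R S : Type*} [CommRing R] [CommRing S] (f : R →+* S)
    (M : Matrix (Fin n) (Fin q) R) :
    MvPolynomial.map f (pluckerForm M) = pluckerForm (M.map f) := by
  simp [pluckerForm]

/-- If a product of polynomials in `t` vanishes for many values of `t`, one of them is zero. -/
theorem exists_eq_zero_of_prod_eq_zero {κ : Type*} (O : Finset κ) (w : κ → Fin n → ℂ)
    (h : ∀ t < O.card * n + 1, ∏ M ∈ O, ∑ i : Fin n, (t : ℂ) ^ (i : ℕ) * w M i = 0) :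
    ∃ M ∈ O, w M = 0 := by
  classical
  -- The vector `w M` is read as the coefficients of a polynomial of degree at most `n`. The product
  -- has degree at most `O.card * n` and one more root than that, so it is zero and one factor is
  -- zero.
  let p (M : κ) : Polynomial ℂ := ∑ i : Fin n, Polynomial.C (w M i) * Polynomial.X ^ (i : ℕ)
  have hp (M) (t : ℂ) : (p M).eval t = ∑ i : Fin n, t ^ (i : ℕ) * w M i := by
    simp only [p, Polynomial.eval_finsetSum, Polynomial.eval_mul, Polynomial.eval_C,
      Polynomial.eval_pow, Polynomial.eval_X]
    exact Finset.sum_congr rfl fun i _ ↦ mul_comm _ _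
  have hdeg (M) : (p M).natDegree ≤ n := Polynomial.natDegree_sum_le_of_forall_le _ _ fun i _ ↦
    (Polynomial.natDegree_C_mul_X_pow_le _ _).trans i.2.le
  have hprod : ∏ M ∈ O, p M = 0 := by
    refine Polynomial.eq_zero_of_natDegree_lt_card_of_eval_eq_zero' _
      ((Finset.range (O.card * n + 1)).image (Nat.cast : ℕ → ℂ)) (fun t ht ↦ ?_) ?_
    · obtain ⟨t, ht', rfl⟩ := Finset.mem_image.1 ht
      rw [Polynomial.eval_prod]
      simp only [hp]
      exact h t (Finset.mem_range.1 ht')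
    · rw [Finset.card_image_of_injective _ Nat.cast_injective, Finset.card_range]
      refine Nat.lt_succ_of_le ((Polynomial.natDegree_prod_le _ _).trans ?_)
      refine (Finset.sum_le_card_nsmul _ _ n fun M _ ↦ hdeg M).trans ?_
      rw [smul_eq_mul]
  obtain ⟨M, hM, h0⟩ := Finset.prod_eq_zero_iff.1 hprod
  refine ⟨M, hM, funext fun j ↦ ?_⟩
  have h1 := congrArg (fun f ↦ Polynomial.coeff f (j : ℕ)) h0
  simp only [p, Polynomial.finsetSum_coeff, Polynomial.coeff_C_mul, Polynomial.coeff_X_pow,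
    Polynomial.coeff_zero] at h1
  rw [Finset.sum_eq_single j] at h1
  · simpa using h1
  · intro i _ hi
    rw [if_neg (fun h ↦ hi (Fin.ext h.symm)), mul_zero]
  · simp

/-- Both inclusions specialize by `ψ` an identity over `B`. The polynomials of `I` vanish
identically on the parametrized subspaces; conversely, at a zero of `I` the products of the
equations vanish for enough parameters `t` to single out one subspace. -/
theorem zeroLocus_eq_iUnion_range {I : Ideal (MvPolynomial (Fin n) A)} {ι : Fin q → Fin n}
    {O : Finset (Matrix (Fin n) (Fin q) B)}
    (h₁ : ∀ M ∈ O, ∀ g ∈ I, aeval (fun i ↦ ∑ a, C (M i a) * X a : Fin n → MvPolynomial (Fin q) B) g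
      = 0)
    (h₂ : ∀ t < O.card * n + 1, ∃ F ∈ I, MvPolynomial.map (algebraMap A B) F =
      ∏ M ∈ O, equations ι M t)
    (φ : A →+* ℂ) (ψ : B →+* ℂ) (hψ : ∀ a, ψ (algebraMap A B a) = φ a) (z : Fin n → ℂ) :
    (∀ g ∈ I, eval₂ φ z g = 0) ↔ ∃ M ∈ O, z ∈ LinearMap.range (M.map ψ).mulVecLin := by
  have hφ : φ = ψ.comp (algebraMap A B) := RingHom.ext fun a ↦ (hψ a).symm
  constructor
  · intro h
    obtain ⟨M, hM, hw⟩ := exists_eq_zero_of_prod_eq_zero O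
      (fun M i ↦ z i - ∑ a, ψ (M i a) * z (ι a)) fun t ht ↦ by
        obtain ⟨F, hF, hFt⟩ := h₂ t ht
        have h1 := congrArg (fun f ↦ eval z (MvPolynomial.map ψ f)) hFt
        simp only [map_prod, map_equations, eval_equations] at h1
        rw [MvPolynomial.map_map, ← hφ, MvPolynomial.eval_map, h F hF] at h1
        exact h1.symm
    refine ⟨M, hM, fun a ↦ z (ι a), ?_⟩
    ext i
    exact (sub_eq_zero.1 (congrFun hw i)).symm
  · rintro ⟨M, hM, s, rfl⟩ g hg
    have h1 : eval₂Hom φ ((M.map ψ).mulVecLin s) = ((eval₂Hom ψ s).comp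
        (aeval (R := A) (fun i ↦ ∑ a, C (M i a) * X a :
          Fin n → MvPolynomial (Fin q) B)).toRingHom) := by
      refine MvPolynomial.ringHom_ext (fun a ↦ ?_) fun i ↦ ?_
      · rw [eval₂Hom_C, RingHom.comp_apply]
        change _ = eval₂Hom ψ s (aeval _ (C a))
        rw [aeval_C, MvPolynomial.algebraMap_apply, eval₂Hom_C, hψ]
      · rw [eval₂Hom_X', RingHom.comp_apply]
        change _ = eval₂Hom ψ s (aeval _ (X i))
        rw [aeval_X, map_sum]
        simp only [map_mul, eval₂Hom_C, eval₂Hom_X']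
        rfl
    have h2 := RingHom.congr_fun h1 g
    rw [RingHom.comp_apply] at h2
    have h3 : (aeval (R := A) (fun i ↦ ∑ a, C (M i a) * X a :
          Fin n → MvPolynomial (Fin q) B)).toRingHom g = 0 := h₁ M hM g hg
    rw [h3, map_zero] at h2
    exact h2

end Fibre

namespace CharFoliation

variable {V : SmoothProjectiveVariety} {U : V.X.Opens} {n : ℕ}

/-- The ring of algebraic functions that are integral over `𝒪(U)`. -/
abbrev integralFunctions (U : V.X.Opens) : Subalgebra (regularFunctions U) (RatFunClosure V) :=
  integralClosure (regularFunctions U) (RatFunClosure V)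

/-- A presentation of `Y` over `U` as a union of images of matrices with coefficients in the ring of
algebraic functions integral over `𝒪(U)`, which contain the identity and are everywhere distinct. -/
structure LinearModel (C : CoordSystem U n) (Y : Set (CotangentBundle V)) (q : ℕ) where
  /-- the indices of the rows which form the identity -/
  ι : Fin q → Fin n
  /-- the matrices -/
  O : Finset (Matrix (Fin n) (Fin q) (integralFunctions U))
  nonempty : O.Nonempty
  rows : ∀ M ∈ O, ∀ a b, M (ι a) b = if a = b then 1 else 0
  vanish : ∀ M ∈ O, ∀ g ∈ C.vanishing Y, MvPolynomial.aeval
    (fun i ↦ ∑ a, MvPolynomial.C (M i a) * MvPolynomial.X a :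
      Fin n → MvPolynomial (Fin q) (integralFunctions U)) g = 0
  exists_equation : ∀ t < O.card * n + 1, ∃ F ∈ C.vanishing Y,
    MvPolynomial.map (algebraMap (regularFunctions U) (integralFunctions U)) F =
      ∏ M ∈ O, equations ι M t
  exists_plucker : ∃ G : MvPolynomial (Fin q → Fin n) (regularFunctions U),
    MvPolynomial.map (algebraMap (regularFunctions U) (integralFunctions U)) G =
      ∏ M ∈ O, pluckerForm M
  distinct : ∀ M ∈ O, ∀ M' ∈ O, M ≠ M' → ∃ i a, IsUnit (M i a - M' i a)

theorem exists_open_of_finset (hU : IsAffineOpen U) (hne : (U : Set V.X).Nonempty)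
    (S : Finset (RatFun V)) : ∃ W : V.X.Opens, IsAffineOpen W ∧ (W : Set V.X).Nonempty ∧ W ≤ U ∧
      ∀ s ∈ S, s ∈ regularFunctions W := by
  have := isFractionRing_regularFunctions hU hne
  obtain ⟨b, hb⟩ := IsLocalization.exist_integer_multiples_of_finset
    (nonZeroDivisors (regularFunctions U)) S
  have hb0 : b.1.1 ≠ 0 := fun h ↦ nonZeroDivisors.ne_zero b.2 (Subtype.ext h)
  obtain ⟨D, hDaff, hDU, hD, hDne⟩ := exists_principal_open hU b.1.2 hb0 hne
  refine ⟨D, hDaff, hDne, hDU, fun s hs ↦ ?_⟩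
  obtain ⟨a, ha⟩ := hb s hs
  refine (mem_regularFunctions_principal hU b.1.2 hb0 hne hD).2 ⟨1, ?_⟩
  rw [pow_one]
  have : b.1.1 * s = a.1 := ha.symm
  rw [this]
  exact a.2

theorem exists_map_algebraMap_eq {σ : Type*} {p : MvPolynomial σ (RatFun V)}
    (h : ∀ c ∈ p.coeffs, c ∈ regularFunctions U) : ∃ p₀ : MvPolynomial σ (regularFunctions U),
      MvPolynomial.map (algebraMap (regularFunctions U) (RatFun V)) p₀ = p :=
  MvPolynomial.mem_range_map_iff_coeffs_subset.2 fun c hc ↦ ⟨⟨c, h c hc⟩, rfl⟩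

/-- Only finitely many rational functions have to become regular: the coefficients of the product
equations and of the Plücker product, and those of the minimal polynomials that make the entries of
the conjugates, and the inverses of their differences, integral. -/
theorem exists_linearModel (C : CoordSystem U n) {Y : Set (CotangentBundle V)}
    (hY : IsIrreducible Y) (hd : Dominates Y) {q : ℕ} {ι : Fin q → Fin n}
    {M : Matrix (Fin n) (Fin q) (RatFunClosure V)}
    (hM : ∀ a b, M (ι a) b = if a = b then 1 else 0)
    (hJ : ∀ g, g ∈ C.genericIdeal Y ↔ restrictTo (RatFun V) M g = 0) :
    ∃ (W : V.X.Opens) (hW : IsAffineOpen W) (hne : (W : Set V.X).Nonempty) (h : W ≤ U),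
      Nonempty (LinearModel (C.restrict hW hne h) Y q) := by
  classical
  obtain ⟨O, hOne, hO, hF, G, hG⟩ := exists_conjugates hM hJ
  choose F hFJ hF using hF
  have hint (z : RatFunClosure V) : IsIntegral (RatFun V) z := Algebra.IsIntegral.isIntegral z
  let S₁ := (Finset.range (O.card * n + 1)).biUnion fun t ↦ (F t).coeffs
  let S₂ := O.biUnion fun M ↦ Finset.univ.biUnion fun i ↦ Finset.univ.biUnion fun a ↦
    (minpoly (RatFun V) (M i a)).coeffs
  -- Integrality of the inverses makes the non-zero differences of entries units, so distinct
  -- conjugates have distinct specializations at every point. When a difference is zero its inverse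
  -- is `0`, which does no harm.
  let S₃ := O.biUnion fun M ↦ O.biUnion fun M' ↦ Finset.univ.biUnion fun i ↦
    Finset.univ.biUnion fun a ↦ (minpoly (RatFun V) (M i a - M' i a)⁻¹).coeffs
  obtain ⟨W, hW, hne, h, hS⟩ := exists_open_of_finset C.affine C.nonempty
    (S₁ ∪ G.coeffs ∪ S₂ ∪ S₃)
  simp only [Finset.mem_union] at hS
  refine ⟨W, hW, hne, h, ?_⟩
  have hJ' := C.genericIdeal_restrict hW hne h hY hd
  set C' := C.restrict hW hne h with hC'
  have hmem₂ (M) (hM : M ∈ O) (i a) : M i a ∈ integralFunctions W :=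
    isIntegral_of_coeff_mem (regularFunctions W) (hint _) fun c hc ↦ hS c (Or.inl (Or.inr
      (Finset.mem_biUnion.2 ⟨M, hM, Finset.mem_biUnion.2 ⟨i, Finset.mem_univ _,
        Finset.mem_biUnion.2 ⟨a, Finset.mem_univ _, hc⟩⟩⟩)))
  have hmem₃ (M) (hM : M ∈ O) (M') (hM' : M' ∈ O) (i a) :
      (M i a - M' i a)⁻¹ ∈ integralFunctions W :=
    isIntegral_of_coeff_mem (regularFunctions W) (hint _) fun c hc ↦ hS c (Or.inr
      (Finset.mem_biUnion.2 ⟨M, hM, Finset.mem_biUnion.2 ⟨M', hM', Finset.mem_biUnion.2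
        ⟨i, Finset.mem_univ _, Finset.mem_biUnion.2 ⟨a, Finset.mem_univ _, hc⟩⟩⟩⟩))
  let lift (M : Matrix (Fin n) (Fin q) (RatFunClosure V)) :
      Matrix (Fin n) (Fin q) (integralFunctions W) :=
    Matrix.of fun i a ↦ if hm : M i a ∈ integralFunctions W then ⟨M i a, hm⟩ else 0
  have hlift (M) (hM : M ∈ O) (i a) : (lift M i a).1 = M i a := by
    change (if hm : M i a ∈ integralFunctions W then (⟨M i a, hm⟩ : integralFunctions W)
      else 0).1 = _
    rw [dif_pos (hmem₂ M hM i a)]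
  have hmap (M) (hM : M ∈ O) :
      (lift M).map (algebraMap (integralFunctions W) (RatFunClosure V)) = M := by
    ext i a; exact hlift M hM i a
  have hinjOn : Set.InjOn lift O := fun M hM M' hM' h ↦ by
    rw [← hmap M hM, ← hmap M' hM', h]
  have hinj {σ : Type} : Function.Injective (MvPolynomial.map (σ := σ)
      (algebraMap (integralFunctions W) (RatFunClosure V))) :=
    MvPolynomial.map_injective _ Subtype.val_injective
  have hmapmap {σ : Type} (p : MvPolynomial σ (regularFunctions W)) :
      MvPolynomial.map (algebraMap (integralFunctions W) (RatFunClosure V))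
        (MvPolynomial.map (algebraMap (regularFunctions W) (integralFunctions W)) p) =
      MvPolynomial.map (algebraMap (RatFun V) (RatFunClosure V))
        (MvPolynomial.map (algebraMap (regularFunctions W) (RatFun V)) p) := by
    rw [MvPolynomial.map_map, MvPolynomial.map_map]; rfl
  have hcard : (O.image lift).card = O.card := Finset.card_image_of_injOn hinjOn
  refine ⟨⟨ι, O.image lift, hOne.image _, ?_, ?_, ?_, ?_, ?_⟩⟩
  · intro M' hM'
    obtain ⟨M, hM, rfl⟩ := Finset.mem_image.1 hM'
    intro a b
    refine Subtype.ext ?_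
    rw [hlift M hM, (hO M hM).1 a b]
    split_ifs <;> rfl
  · intro M' hM' g hg
    obtain ⟨M, hM, rfl⟩ := Finset.mem_image.1 hM'
    apply hinj
    have h1 := (hO M hM).2 _ (hJ' ▸ (C'.map_mem_genericIdeal_iff hY hd).2 hg)
    rw [map_zero, ← h1]
    have h2 : (MvPolynomial.map (algebraMap (integralFunctions W) (RatFunClosure V))).comp
        (MvPolynomial.aeval (R := regularFunctions W)
          (fun i ↦ ∑ a, MvPolynomial.C (lift M i a) * MvPolynomial.X a :
          Fin n → MvPolynomial (Fin q) (integralFunctions W))).toRingHom =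
        (restrictTo (RatFun V) M).toRingHom.comp
          (MvPolynomial.map (algebraMap (regularFunctions W) (RatFun V))) := by
      refine MvPolynomial.ringHom_ext (fun f ↦ ?_) fun i ↦ ?_
      · rw [RingHom.comp_apply, RingHom.comp_apply, MvPolynomial.map_C]
        change MvPolynomial.map _ (MvPolynomial.aeval _ (MvPolynomial.C f)) =
          restrictTo (RatFun V) M (MvPolynomial.C _)
        rw [restrictTo, MvPolynomial.aeval_C, MvPolynomial.aeval_C, MvPolynomial.algebraMap_apply,
          MvPolynomial.map_C, MvPolynomial.algebraMap_apply]; rfl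
      · rw [RingHom.comp_apply, RingHom.comp_apply, MvPolynomial.map_X]
        change MvPolynomial.map _ (MvPolynomial.aeval _ (MvPolynomial.X i)) =
          restrictTo (RatFun V) M (MvPolynomial.X i)
        rw [restrictTo, MvPolynomial.aeval_X, MvPolynomial.aeval_X, map_sum]
        refine Finset.sum_congr rfl fun a _ ↦ ?_
        rw [map_mul, MvPolynomial.map_C, MvPolynomial.map_X, ← hlift M hM]; rfl
    exact RingHom.congr_fun h2 g
  · intro t ht
    rw [hcard] at ht
    obtain ⟨F₀, hF₀⟩ := exists_map_algebraMap_eq (U := W) (p := F t) fun c hc ↦ hS c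
      (Or.inl (Or.inl (Or.inl (Finset.mem_biUnion.2 ⟨t, Finset.mem_range.2 ht, hc⟩))))
    refine ⟨F₀, (C'.map_mem_genericIdeal_iff hY hd).1 (by rw [hF₀, hJ']; exact hFJ t), hinj ?_⟩
    rw [hmapmap, hF₀, hF, Finset.prod_image hinjOn, map_prod]
    refine Finset.prod_congr rfl fun M hM ↦ ?_
    rw [map_equations, hmap M hM]
  · obtain ⟨G₀, hG₀⟩ := exists_map_algebraMap_eq (U := W) (p := G) fun c hc ↦ hS c
      (Or.inl (Or.inl (Or.inr hc)))
    refine ⟨G₀, hinj ?_⟩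
    rw [hmapmap, hG₀, hG, Finset.prod_image hinjOn, map_prod]
    refine Finset.prod_congr rfl fun M hM ↦ ?_
    rw [map_pluckerForm, hmap M hM]
  · intro N hN N' hN' hne
    obtain ⟨M, hM, rfl⟩ := Finset.mem_image.1 hN
    obtain ⟨M', hM', rfl⟩ := Finset.mem_image.1 hN'
    have h1 : ∃ i a, M i a ≠ M' i a := by
      by_contra! h
      exact hne (congrArg lift (Matrix.ext h))
    obtain ⟨i, a, hia⟩ := h1
    refine ⟨i, a, IsUnit.of_mul_eq_one ⟨_, hmem₃ M hM M' hM' i a⟩ (Subtype.ext ?_)⟩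
    change ((lift M i a).1 - (lift M' i a).1) * _ = 1
    rw [hlift M hM, hlift M' hM']
    exact mul_inv_cancel₀ (sub_ne_zero.2 hia)

end CharFoliation

/-! ### Matrices that contain the identity -/

section Rows

variable {R K : Type*} [CommRing R] [Field K] {n q : ℕ} {ι : Fin q → Fin n}

theorem Matrix.mulVec_of_rows {M : Matrix (Fin n) (Fin q) R}
    (hM : ∀ a b, M (ι a) b = if a = b then 1 else 0) (s : Fin q → R) (a : Fin q) :
    M.mulVec s (ι a) = s a := by
  simp [Matrix.mulVec, dotProduct, hM]

theorem Matrix.finrank_range_of_rows {M : Matrix (Fin n) (Fin q) K}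
    (hM : ∀ a b, M (ι a) b = if a = b then 1 else 0) :
    Module.finrank K (LinearMap.range M.mulVecLin) = q := by
  have hinj : Function.Injective M.mulVecLin := fun s t h ↦ funext fun a ↦ by
    rw [← M.mulVec_of_rows hM s a, ← M.mulVec_of_rows hM t a]
    exact congrFun h (ι a)
  rw [LinearMap.finrank_range_of_inj hinj, Module.finrank_fin_fun]

/-- The identity rows recover the parameter from a vector of the image, so each column can come only
from the same column of the other matrix. -/
theorem Matrix.eq_of_range_le_of_rows {M M' : Matrix (Fin n) (Fin q) R}
    (hM : ∀ a b, M (ι a) b = if a = b then 1 else 0)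
    (hM' : ∀ a b, M' (ι a) b = if a = b then 1 else 0)
    (h : LinearMap.range M.mulVecLin ≤ LinearMap.range M'.mulVecLin) : M = M' := by
  ext i b
  obtain ⟨t, ht⟩ := h ⟨Pi.single b 1, rfl⟩
  have ht' : M'.mulVec t = M.mulVec (Pi.single b 1) := ht
  have h1 : t = Pi.single b 1 := funext fun a ↦ by
    rw [← M'.mulVec_of_rows hM' t a, ht', M.mulVec_of_rows hM]
  have h2 := congrFun ht' i
  rw [h1] at h2
  simpa using h2.symm

end Rows

/-! ### The fibres of `Y` at complex points -/

namespace CharFoliation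

variable {V : SmoothProjectiveVariety} {U : V.X.Opens} {n : ℕ}

theorem CoordSystem.evalPoly_eq_eval₂ (C : CoordSystem U n) (e : CotangentBundle V)
    (he : e.base.pt ∈ U) (g : MvPolynomial (Fin n) (regularFunctions U)) :
    C.evalPoly e he g =
      MvPolynomial.eval₂ (e.base.evalOn he).toRingHom (C.cotangentEquiv e.base he e.covector) g :=
  rfl

namespace LinearModel

variable {C : CoordSystem U n} {Y : Set (CotangentBundle V)} {q : ℕ} (m : LinearModel C Y q)

/-- The subspace of the cotangent space at `P` defined by a matrix, after specialization. -/
def conormal (C : CoordSystem U n) (P : Point V) (hP : P.pt ∈ U) (ψ : integralFunctions U →+* ℂ)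
    (M : Matrix (Fin n) (Fin q) (integralFunctions U)) : Submodule ℂ (CotangentSpace P) :=
  (LinearMap.range (M.map ψ).mulVecLin).map (C.cotangentEquiv P hP).symm.toLinearMap

theorem mem_conormal (P : Point V) (hP : P.pt ∈ U) (ψ : integralFunctions U →+* ℂ)
    (M : Matrix (Fin n) (Fin q) (integralFunctions U)) (η : CotangentSpace P) :
    η ∈ conormal C P hP ψ M ↔
      C.cotangentEquiv P hP η ∈ LinearMap.range (M.map ψ).mulVecLin := by
  rw [conormal, Submodule.mem_map]
  constructor
  · rintro ⟨z, hz, rfl⟩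
    simpa using hz
  · intro h
    exact ⟨_, h, by simp⟩

variable (P : Point V) (hP : P.pt ∈ U)

theorem exists_specialization : ∃ ψ : integralFunctions U →+* ℂ,
    ∀ f, ψ (algebraMap (regularFunctions U) (integralFunctions U) f) = P.evalOn hP f :=
  exists_extension_of_isIntegral (fun _ _ h ↦ Subtype.ext ((algebraMap (RatFun V)
    (RatFunClosure V)).injective (congrArg Subtype.val h))) _

variable (ψ : integralFunctions U →+* ℂ)

theorem rows_map {M : Matrix (Fin n) (Fin q) (integralFunctions U)} (hM : M ∈ m.O) (a b : Fin q) :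
    (M.map ψ) (m.ι a) b = if a = b then 1 else 0 := by
  rw [Matrix.map_apply, m.rows M hM]
  split_ifs <;> simp

theorem finrank_conormal {M : Matrix (Fin n) (Fin q) (integralFunctions U)} (hM : M ∈ m.O) :
    Module.finrank ℂ (conormal C P hP ψ M) = q := by
  rw [conormal, LinearEquiv.finrank_map_eq, Matrix.finrank_range_of_rows (m.rows_map ψ hM)]

/-- A difference of entries that is a unit has non-zero image under `ψ`, and the subspace determines
the specialized matrix because of the identity rows. -/
theorem conormal_injOn : Set.InjOn (conormal C P hP ψ)
    (m.O : Set (Matrix (Fin n) (Fin q) (integralFunctions U))) := by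
  intro M hM M' hM' h
  by_contra hne
  obtain ⟨i, a, hu⟩ := m.distinct M hM M' hM' hne
  have h1 := Submodule.map_injective_of_injective
    (f := (C.cotangentEquiv P hP).symm.toLinearMap) (C.cotangentEquiv P hP).symm.injective h
  have h2 := Matrix.eq_of_range_le_of_rows (m.rows_map ψ hM) (m.rows_map ψ hM') h1.le
  have h3 : ψ (M i a) = ψ (M' i a) := congrFun (congrFun h2 i) a
  refine (hu.map ψ).ne_zero ?_
  exact (RingHom.map_sub ψ _ _).trans (sub_eq_zero.2 h3)

theorem mem_fiber_iff (hY : IsClosed Y)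
    (hψ : ∀ f, ψ (algebraMap (regularFunctions U) (integralFunctions U) f) = P.evalOn hP f)
    (η : CotangentSpace P) : η ∈ fiber Y P ↔ ∃ M ∈ m.O, η ∈ conormal C P hP ψ M := by
  simp only [mem_conormal]
  rw [← zeroLocus_eq_iUnion_range (I := C.vanishing Y) m.vanish m.exists_equation
    (P.evalOn hP).toRingHom ψ hψ]
  exact ⟨fun h g hg ↦ hg _ h hP, fun h ↦ C.mem_of_isClosed hY (e := ⟨P, η⟩) hP h⟩

theorem fiber_eq (hY : IsClosed Y)
    (hψ : ∀ f, ψ (algebraMap (regularFunctions U) (integralFunctions U) f) = P.evalOn hP f) :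
    fiber Y P = ⋃ Λ ∈ conormal C P hP ψ ''
      (m.O : Set (Matrix (Fin n) (Fin q) (integralFunctions U))), (Λ : Set (CotangentSpace P)) := by
  ext η
  rw [m.mem_fiber_iff P hP ψ hY hψ]
  simp

theorem exists_fiber_eq (m : LinearModel C Y q) (P : Point V) (hP : P.pt ∈ U) (hY : IsClosed Y) :
    ∃ S : Set (Submodule ℂ (CotangentSpace P)),
    S.Finite ∧ S.Nonempty ∧ (∀ Λ ∈ S, Module.finrank ℂ Λ = q) ∧
      fiber Y P = ⋃ Λ ∈ S, (Λ : Set (CotangentSpace P)) := by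
  obtain ⟨ψ, hψ⟩ := exists_specialization P hP
  refine ⟨_, m.O.finite_toSet.image _, (Finset.coe_nonempty.2 m.nonempty).image _, ?_, m.fiber_eq P hP ψ hY hψ⟩
  rintro _ ⟨M, hM, rfl⟩
  exact m.finrank_conormal P hP ψ hM

end LinearModel

end CharFoliation

/-! ### Products of decomposable forms -/

section Decomposable

variable {K E : Type*} [Field K] [AddCommGroup E] [Module K E]

/-- Pairing with the exterior product of linear forms dual to the `v i` gives the determinant of the
identity. -/
theorem exteriorPower.ιMulti_ne_zero {q : ℕ} {v : Fin q → E} (hv : LinearIndependent K v) :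
    exteriorPower.ιMulti K q v ≠ 0 := by
  obtain ⟨g, hg⟩ := (Fintype.linearCombination K v).exists_leftInverse_of_injective
    (LinearMap.ker_eq_bot.2 hv.fintypeLinearCombination_injective)
  have h1 (i : Fin q) : g (v i) = Pi.single i 1 := by
    have := LinearMap.congr_fun hg (Pi.single i 1)
    rwa [LinearMap.comp_apply, Fintype.linearCombination_apply_single, one_smul] at this
  intro h
  have h2 := exteriorPower.pairingDual_ιMulti_ιMulti
    (fun j ↦ (LinearMap.proj j : (Fin q → K) →ₗ[K] K).comp g) v
  have h3 : Matrix.of (fun i j ↦ ((LinearMap.proj j : (Fin q → K) →ₗ[K] K).comp g) (v i)) =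
      (1 : Matrix (Fin q) (Fin q) K) := by
    ext i j
    rw [Matrix.of_apply, LinearMap.comp_apply, h1, LinearMap.proj_apply, Matrix.one_apply,
      Pi.single_apply]
    simp only [eq_comm]
  rw [h3, Matrix.det_one, h, map_zero] at h2
  exact zero_ne_one h2

/-- This recovers a subspace from the decomposable form it defines, as the set of vectors whose
exterior product with the form is zero. -/
theorem exteriorPower.mem_span_iff {q : ℕ} {v : Fin q → E} (hv : LinearIndependent K v) (x : E) :
    x ∈ Submodule.span K (Set.range v) ↔
      ExteriorAlgebra.ι K x * (exteriorPower.ιMulti K q v : ExteriorAlgebra K E) = 0 := by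
  have h1 : ExteriorAlgebra.ι K x * (exteriorPower.ιMulti K q v : ExteriorAlgebra K E) =
      (exteriorPower.ιMulti K (q + 1) (Fin.cons x v : Fin (q + 1) → E) : ExteriorAlgebra K E) := by
    rw [exteriorPower.ιMulti_apply_coe, exteriorPower.ιMulti_apply_coe,
      ExteriorAlgebra.ιMulti_succ_apply]
    rfl
  rw [h1]
  constructor
  · intro hx
    rw [ZeroMemClass.coe_eq_zero]
    refine AlternatingMap.map_linearDependent _ _ fun h ↦ ?_
    exact (linearIndependent_finCons.1 h).2 hx
  · intro h
    by_contra hx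
    exact exteriorPower.ιMulti_ne_zero (linearIndependent_finCons.2 ⟨hv, hx⟩)
      ((ZeroMemClass.coe_eq_zero (S' := ⋀[K]^(q + 1) E)).1 h)

theorem exteriorPower.span_le_of_ιMulti_eq_smul {q : ℕ} {v w : Fin q → E}
    (hv : LinearIndependent K v) (hw : LinearIndependent K w) {c : K}
    (h : exteriorPower.ιMulti K q w = c • exteriorPower.ιMulti K q v) :
    Submodule.span K (Set.range v) = Submodule.span K (Set.range w) := by
  have hc : c ≠ 0 := by
    rintro rfl
    exact exteriorPower.ιMulti_ne_zero hw (by rw [h, zero_smul])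
  ext x
  rw [exteriorPower.mem_span_iff hv, exteriorPower.mem_span_iff hw, h, Submodule.coe_smul,
    mul_smul_comm, smul_eq_zero_iff_right hc]

/-- A substitute for unique factorization. If no `w i` were a multiple of `v j`, then, the field
being infinite, some linear form would vanish at `v j` and at none of the `w i`; evaluating both
products with it gives a contradiction. -/
theorem SymmetricAlgebra.exists_mem_span_of_prod_eq [Infinite K] {κ κ' : Type*} [Fintype κ]
    [Fintype κ'] {v : κ → E} {w : κ' → E}
    (h : ∏ j, SymmetricAlgebra.ι K E (v j) = ∏ j, SymmetricAlgebra.ι K E (w j)) (j : κ) :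
    ∃ i, w i ∈ Submodule.span K {v j} := by
  by_contra! hne
  obtain ⟨f, hf⟩ := Module.exists_dual_forall_apply_ne_zero (K := K)
    (fun i ↦ (Submodule.span K {v j}).mkQ (w i)) fun i ↦ by
      rw [Submodule.mkQ_apply, Ne, Submodule.Quotient.mk_eq_zero]; exact hne i
  have h1 := congrArg (SymmetricAlgebra.lift (f.comp (Submodule.span K {v j}).mkQ)) h
  simp only [map_prod, SymmetricAlgebra.lift_ι_apply, LinearMap.comp_apply] at h1
  rw [Finset.prod_eq_zero (Finset.mem_univ j)] at h1
  · exact Finset.prod_ne_zero_iff.2 (fun i _ ↦ hf i) h1.symm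
  · rw [Submodule.mkQ_apply, (Submodule.Quotient.mk_eq_zero _).2 (Submodule.mem_span_singleton_self _),
      map_zero]

theorem AlternatingMap.map_sum_smul {N : Type*} [AddCommMonoid N] [Module K N] {n q : ℕ}
    (f : E [⋀^Fin q]→ₗ[K] N) (e : Fin n → E) (c : Fin n → Fin q → K) :
    f (fun a ↦ ∑ i, c i a • e i) =
      ∑ I : Fin q → Fin n, (∏ a, c (I a) a) • f fun a ↦ e (I a) :=
  (f.toMultilinearMap.map_sum fun a i ↦ c i a • e i).trans
    (Finset.sum_congr rfl fun _ _ ↦ f.toMultilinearMap.map_smul_univ _ _)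

/-- This is the multilinear expansion of the exterior product of the columns. The sum runs over all
maps `I`, not only the increasing ones, which avoids minors and signs. -/
theorem eval₂_pluckerForm {N R S : Type*} [AddCommMonoid N] [Module K N] [CommRing R] [CommSemiring S]
    [Algebra K S] {n q : ℕ} (l : N →ₗ[K] S) (f : E [⋀^Fin q]→ₗ[K] N) (e : Fin n → E)
    (ψ : R →+* K) (M : Matrix (Fin n) (Fin q) R) :
    MvPolynomial.eval₂ ((algebraMap K S).comp ψ) (fun I ↦ l (f fun a ↦ e (I a)))
      (pluckerForm M) = l (f fun a ↦ ∑ i, ψ (M i a) • e i) := by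
  rw [f.map_sum_smul, map_sum, pluckerForm, MvPolynomial.eval₂_sum]
  refine Finset.sum_congr rfl fun I _ ↦ ?_
  rw [MvPolynomial.eval₂_mul, MvPolynomial.eval₂_C, MvPolynomial.eval₂_X, map_smul,
    Algebra.smul_def, RingHom.comp_apply, map_prod]

theorem eval₂_eq_prod_of_map_eq {N A R S : Type*} [AddCommMonoid N] [Module K N] [CommRing A]
    [CommRing R] [Algebra A R] [CommSemiring S] [Algebra K S] {n q : ℕ} (l : N →ₗ[K] S)
    (f : E [⋀^Fin q]→ₗ[K] N) (e : Fin n → E) (φ : A →+* K) (ψ : R →+* K)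
    (hψ : ∀ a, ψ (algebraMap A R a) = φ a) {G : MvPolynomial (Fin q → Fin n) A}
    {O : Finset (Matrix (Fin n) (Fin q) R)}
    (hG : MvPolynomial.map (algebraMap A R) G = ∏ M ∈ O, pluckerForm M) :
    MvPolynomial.eval₂ ((algebraMap K S).comp φ) (fun I ↦ l (f fun a ↦ e (I a))) G =
      ∏ M ∈ O, l (f fun a ↦ ∑ i, ψ (M i a) • e i) := by
  have hφ : φ = ψ.comp (algebraMap A R) := RingHom.ext fun a ↦ (hψ a).symm
  rw [hφ, ← RingHom.comp_assoc, ← MvPolynomial.eval₂_map, hG, ← MvPolynomial.coe_eval₂Hom, map_prod]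
  simp only [MvPolynomial.coe_eval₂Hom, eval₂_pluckerForm]

/-- The polynomial in the forms `dx_{i₁} ∧ ⋯ ∧ dx_{i_q}` with given coefficients. -/
def formPolynomial {A : Type*} [CommRing A] {n q : ℕ} (x : Fin n → A)
    (G : MvPolynomial (Fin q → Fin n) A) : MvPolynomial (A ⊕ (Fin q → A)) K :=
  ∑ m ∈ G.support, MvPolynomial.X (Sum.inl (G.coeff m)) *
    ∏ I ∈ m.support, MvPolynomial.X (Sum.inr fun a ↦ x (I a)) ^ m I

theorem aeval_formPolynomial {A R : Type*} [CommRing A] [CommRing R] [Algebra A R] {n q : ℕ}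
    (φ : A →+* K) (d : A → E) (x : Fin n → A) (ψ : R →+* K)
    (hψ : ∀ a, ψ (algebraMap A R a) = φ a) {G : MvPolynomial (Fin q → Fin n) A}
    {O : Finset (Matrix (Fin n) (Fin q) R)}
    (hG : MvPolynomial.map (algebraMap A R) G = ∏ M ∈ O, pluckerForm M) :
    MvPolynomial.aeval (Sum.elim (fun f ↦ algebraMap K (SymmetricAlgebra K (⋀[K]^q E)) (φ f))
      (fun g ↦ SymmetricAlgebra.ι K (⋀[K]^q E) (exteriorPower.ιMulti K q fun a ↦ d (g a))))
      (formPolynomial (K := K) x G) = ∏ j, SymmetricAlgebra.ι K (⋀[K]^q E)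
        (exteriorPower.ιMulti K q fun a ↦ ∑ i, ψ ((O.equivFin.symm j).1 i a) • d (x i)) := by
  rw [Equiv.prod_comp O.equivFin.symm fun M : O ↦ SymmetricAlgebra.ι K (⋀[K]^q E)
    (exteriorPower.ιMulti K q fun a ↦ ∑ i, ψ (M.1 i a) • d (x i)),
    Finset.prod_coe_sort O fun M ↦ SymmetricAlgebra.ι K (⋀[K]^q E)
    (exteriorPower.ιMulti K q fun a ↦ ∑ i, ψ (M i a) • d (x i))]
  refine Eq.trans ?_ (eval₂_eq_prod_of_map_eq (SymmetricAlgebra.ι K (⋀[K]^q E))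
    (exteriorPower.ιMulti K q) (fun i ↦ d (x i)) φ ψ hψ hG)
  simp only [formPolynomial, map_sum, map_mul, map_prod, map_pow, MvPolynomial.aeval_X,
    MvPolynomial.eval₂_eq, Sum.elim_inl, Sum.elim_inr, RingHom.comp_apply]

end Decomposable

/-! ### The multi-distribution -/

namespace CharFoliation

variable {V : SmoothProjectiveVariety} {U : V.X.Opens} {n : ℕ}

/-- Each factor of one product is proportional to a factor of the other, and proportional
decomposable forms have the same conormal space. So the conormal spaces do not depend on the
factorization. -/
theorem IsProductOfDecomposables.range_subset {q k k' : ℕ} {P : Point V}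
    {ϖ : SymmetricAlgebra ℂ (⋀[ℂ]^q (CotangentSpace P))}
    {L : Fin k → Submodule ℂ (CotangentSpace P)} {L' : Fin k' → Submodule ℂ (CotangentSpace P)}
    (h : IsProductOfDecomposables ϖ L) (h' : IsProductOfDecomposables ϖ L') :
    Set.range L ⊆ Set.range L' := by
  rintro _ ⟨j, rfl⟩
  obtain ⟨-, η, hη, hϖ⟩ := h
  obtain ⟨-, η', hη', hϖ'⟩ := h'
  obtain ⟨i, hi⟩ := SymmetricAlgebra.exists_mem_span_of_prod_eq (hϖ.symm.trans hϖ') j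
  obtain ⟨c, hc⟩ := Submodule.mem_span_singleton.1 hi
  refine ⟨i, ?_⟩
  rw [← (hη j).2, ← (hη' i).2]
  exact (exteriorPower.span_le_of_ιMulti_eq_smul (hη j).1 (hη' i).1 hc.symm).symm

theorem MultiDistribution.conormalSpaces_eq {q : ℕ} (D : MultiDistribution V q) (P : Point V)
    (hP : P.pt ∈ D.U) {k : ℕ} {L : Fin k → Submodule ℂ (CotangentSpace P)} (hk : k = D.k)
    (hL : IsProductOfDecomposables (evalForm P hP D.form) L) :
    D.conormalSpaces P hP = Set.range L := by
  subst hk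
  ext Λ
  constructor
  · rintro ⟨L', hL', j, rfl⟩
    exact hL'.range_subset hL ⟨j, rfl⟩
  · rintro ⟨j, rfl⟩
    exact ⟨L, hL, j, rfl⟩

namespace CoordSystem

variable (C : CoordSystem U n)

/-- The differentials of the coordinates. -/
def dx (P : Point V) (hP : P.pt ∈ U) (i : Fin n) : CotangentSpace P :=
  differential P ⟨C.x i, regularFunctions_le hP (C.x_mem i)⟩

end CoordSystem

namespace LinearModel

variable {C : CoordSystem U n} {Y : Set (CotangentBundle V)} {q : ℕ} (m : LinearModel C Y q)
  (P : Point V) (hP : P.pt ∈ U) (ψ : integralFunctions U →+* ℂ)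

theorem span_eq_conormal (M : Matrix (Fin n) (Fin q) (integralFunctions U)) :
    Submodule.span ℂ (Set.range fun a ↦ ∑ i, ψ (M i a) • C.dx P hP i) = conormal C P hP ψ M := by
  have h1 : (fun a ↦ ∑ i, ψ (M i a) • C.dx P hP i) =
      (C.cotangentEquiv P hP).symm ∘ (M.map ψ).col := funext fun a ↦
    (C.cotangentEquiv_symm_apply P hP _).symm
  rw [conormal, Matrix.range_mulVecLin, h1, Set.range_comp, Submodule.map_span]
  rfl

theorem isProductOfDecomposables {G : MvPolynomial (Fin q → Fin n) (regularFunctions U)}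
    (hG : MvPolynomial.map (algebraMap (regularFunctions U) (integralFunctions U)) G =
      ∏ M ∈ m.O, pluckerForm M)
    (hψ : ∀ f, ψ (algebraMap (regularFunctions U) (integralFunctions U) f) = P.evalOn hP f) :
    IsProductOfDecomposables (evalForm P hP (formPolynomial (fun i ↦ ⟨C.x i, C.x_mem i⟩) G))
      (fun j ↦ conormal C P hP ψ (m.O.equivFin.symm j).1) := by
  refine ⟨fun j j' h ↦ m.O.equivFin.symm.injective (Subtype.ext
    (m.conormal_injOn P hP ψ (m.O.equivFin.symm j).2 (m.O.equivFin.symm j').2 h)),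
    fun j a ↦ ∑ i, ψ ((m.O.equivFin.symm j).1 i a) • C.dx P hP i, fun j ↦ ⟨?_, ?_⟩, ?_⟩
  · rw [linearIndependent_iff_card_eq_finrank_span, Set.finrank, span_eq_conormal,
      m.finrank_conormal P hP ψ (m.O.equivFin.symm j).2, Fintype.card_fin]
  · exact span_eq_conormal P hP ψ _
  · exact aeval_formPolynomial (P.evalOn hP).toRingHom
      (fun f ↦ differential P ⟨f.1, regularFunctions_le hP f.2⟩) _ ψ hψ hG

/-- The Plücker product of the conjugates, with the forms `dx_I` put for its variables, has regular
coefficients although its factors are only algebraic over `𝒪(U)`. At each point, a specialization of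
the algebraic functions factors it. -/
theorem exists_multiDistribution (m : LinearModel C Y q) (hY : IsClosed Y) :
    ∃ D : MultiDistribution V q, ∀ (P : Point V) (hP : P.pt ∈ D.U),
      fiber Y P = ⋃ Λ ∈ D.conormalSpaces P hP, (Λ : Set (CotangentSpace P)) := by
  obtain ⟨G, hG⟩ := m.exists_plucker
  let D : MultiDistribution V q :=
    { U := U
      affine := C.affine
      nonempty := C.nonempty
      k := m.O.card
      k_pos := m.nonempty.card_pos
      form := formPolynomial (fun i ↦ ⟨C.x i, C.x_mem i⟩) G
      decomposable := fun P hP ↦ by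
        obtain ⟨ψ, hψ⟩ := exists_specialization P hP
        exact ⟨_, m.isProductOfDecomposables P hP ψ hG hψ⟩ }
  refine ⟨D, fun P hP ↦ ?_⟩
  obtain ⟨ψ, hψ⟩ := exists_specialization P hP
  rw [D.conormalSpaces_eq P hP rfl (m.isProductOfDecomposables P hP ψ hG hψ),
    m.fiber_eq P hP ψ hY hψ]
  refine congrArg (fun S : Set (Submodule ℂ (CotangentSpace P)) ↦
    ⋃ Λ ∈ S, (Λ : Set (CotangentSpace P))) ?_
  ext Λ
  constructor
  · rintro ⟨M, hM, rfl⟩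
    exact ⟨m.O.equivFin ⟨M, hM⟩, by simp⟩
  · rintro ⟨j, rfl⟩
    exact ⟨_, (m.O.equivFin.symm j).2, rfl⟩

end LinearModel

theorem Foliation.isTangentTo_of_fiber_eq {F : Foliation V} {Y : Set (CotangentBundle V)}
    (hY : Y ⊆ F.characteristicVariety) {q : ℕ} {D : MultiDistribution V q}
    (hD : ∀ (P : Point V) (hP : P.pt ∈ D.U),
      fiber Y P = ⋃ Λ ∈ D.conormalSpaces P hP, (Λ : Set (CotangentSpace P))) :
    F.IsTangentTo D := by
  intro P hP Λ hΛ η hη i hPi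
  have h1 : η ∈ fiber Y P := by
    rw [hD P hP]
    exact Set.mem_biUnion hΛ hη
  exact F.apply_covector_eq_zero_of_mem (e := ⟨P, η⟩) (hY h1) hPi

end CharFoliation

/-! ### The bounds on `q` -/

namespace CharFoliation

variable {V : SmoothProjectiveVariety} {U : V.X.Opens} {n : ℕ}

theorem exists_point_mem {W : V.X.Opens} (hne : (W : Set V.X).Nonempty) :
    ∃ P : Point V, P.pt ∈ W := by
  obtain ⟨x, hx⟩ := hne
  obtain ⟨U, n, C, -, hUW⟩ := CoordSystem.exists_le x hx
  have := finiteType_regularFunctions C.affine C.nonempty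
  obtain ⟨φ, -⟩ := Ideal.IsPrime.exists_algHom_ne_zero (Ideal.isPrime_bot (α := regularFunctions U))
    (g := 1) (by simp)
  obtain ⟨P, hP, -⟩ := exists_point C.affine C.nonempty φ
  exact ⟨P, hUW hP⟩

namespace CoordSystem

theorem finrank_cotangentSpace (C : CoordSystem U n) (P : Point V) (hP : P.pt ∈ U) :
    Module.finrank ℂ (CotangentSpace P) = n := by
  rw [(C.cotangentEquiv P hP).finrank_eq, Module.finrank_fin_fun]

theorem finiteDimensional_cotangentSpace (C : CoordSystem U n) (P : Point V) (hP : P.pt ∈ U) :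
    FiniteDimensional ℂ (CotangentSpace P) :=
  (C.cotangentEquiv P hP).symm.finiteDimensional

/-- A local section of the cotangent bundle whose values lie in the closed set `Y` over a dense open
set has all its values in `Y`. This reaches the points over which the fibre of `Y` is not known. -/
theorem mem_of_section (C : CoordSystem U n) {Y : Set (CotangentBundle V)} (hY : IsClosed Y)
    {W : V.X.Opens} (hW : (W : Set V.X).Nonempty) {e : CotangentBundle V} (he : e.base.pt ∈ U)
    (σ : Fin n → regularFunctions U)
    (hσ : ∀ i, e.base.evalOn he (σ i) = C.cotangentEquiv e.base he e.covector i)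
    (h : ∀ (Q : Point V) (hQ : Q.pt ∈ U), Q.pt ∈ W →
      (C.cotangentEquiv Q hQ).symm (fun i ↦ Q.evalOn hQ (σ i)) ∈ fiber Y Q) : e ∈ Y := by
  refine C.mem_of_isClosed hY he fun g hg ↦ ?_
  have hcomp (Q : Point V) (hQ : Q.pt ∈ U) : Q.evalOn hQ (MvPolynomial.eval σ g) =
      MvPolynomial.eval₂ (Q.evalOn hQ).toRingHom (fun i ↦ Q.evalOn hQ (σ i)) g :=
    (MvPolynomial.eval₂_comp_left (Q.evalOn hQ).toRingHom (RingHom.id _) σ g).trans (by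
      rw [RingHom.comp_id]; rfl)
  by_contra hne
  have h1 : MvPolynomial.eval σ g ≠ 0 := by
    intro h0
    refine hne ?_
    rw [evalPoly_eq_eval₂, ← funext hσ, ← hcomp, h0, map_zero]
  obtain ⟨D, -, -, hD, hDne⟩ := exists_principal_open C.affine (MvPolynomial.eval σ g).2
    (fun h0 ↦ h1 (Subtype.ext h0)) C.nonempty
  obtain ⟨Q, hQD, hQW⟩ := exists_point_mem (W := D ⊓ W)
    (nonempty_preirreducible_inter D.isOpen W.isOpen hDne hW)
  obtain ⟨hQ, hQ'⟩ := (hD _).1 hQD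
  refine (Q.evalOn_ne_zero_iff hQ (MvPolynomial.eval σ g)).2
    ⟨fun h0 ↦ h1 (Subtype.ext h0), hQ'⟩ ?_
  rw [hcomp]
  have h2 := hg _ (h Q hQ hQW) hQ
  rw [evalPoly_eq_eval₂, LinearEquiv.apply_symm_apply] at h2
  exact h2

theorem exists_nonsingular (C : CoordSystem U n) {ξ : RatVectorField V} (hξ : ξ ∈ vectorFields U)
    (h0 : ξ ≠ 0) : ∃ W : V.X.Opens, (W : Set V.X).Nonempty ∧ W ≤ U ∧
      ∀ (Q : Point V) (hQ : Q.pt ∈ U), Q.pt ∈ W → valueAt hξ Q hQ ≠ 0 := by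
  have h1 : ∃ j, ξ (C.x j) ≠ 0 := by
    by_contra! h
    exact h0 (Derivation.ext fun f ↦ by simp [C.eq_sum ξ f, h])
  obtain ⟨j, hj⟩ := h1
  obtain ⟨D, -, hDU, hD, hDne⟩ := exists_principal_open C.affine
    (apply_mem_regularFunctions hξ (C.x_mem j)) hj C.nonempty
  refine ⟨D, hDne, hDU, fun Q hQ hQD h ↦ ?_⟩
  refine (Q.evalOn_ne_zero_iff hQ ⟨_, apply_mem_regularFunctions hξ (C.x_mem j)⟩).2
    ⟨hj, ((hD _).1 hQD).2⟩ ?_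
  exact LinearMap.congr_fun (congrArg Subtype.val h) ⟨C.x j, regularFunctions_le hQ (C.x_mem j)⟩

end CoordSystem

/-- The fibres of `Y` over `U` are non-empty unions of subspaces of dimension `q`. -/
def HasLinearFibers (Y : Set (CotangentBundle V)) (U : V.X.Opens) (q : ℕ) : Prop :=
  ∀ P : Point V, P.pt ∈ U → ∃ S : Set (Submodule ℂ (CotangentSpace P)), S.Finite ∧ S.Nonempty ∧
    (∀ Λ ∈ S, Module.finrank ℂ Λ = q) ∧ fiber Y P = ⋃ Λ ∈ S, (Λ : Set (CotangentSpace P))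

/-- Over `W` the fibres are zero, so the linear coordinates vanish on `Y` there, hence everywhere
since `Y` is irreducible and dominant. Conversely `Y` is closed and contains the zero section over
`W`. -/
theorem HasLinearFibers.eq_zeroSection {Y : Set (CotangentBundle V)} {W : V.X.Opens}
    (h : HasLinearFibers Y W 0) (hW : (W : Set V.X).Nonempty) (hY : IsClosed Y)
    (hYirr : IsIrreducible Y) (hd : Dominates Y) : Y = zeroSection V := by
  have hfib (Q : Point V) (hQ : Q.pt ∈ W) (η : CotangentSpace Q) : η ∈ fiber Y Q ↔ η = 0 := by
    obtain ⟨U, n, hQU, ⟨C⟩⟩ := exists_coordSystem (V := V) Q.pt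
    have := C.finiteDimensional_cotangentSpace Q hQU
    obtain ⟨S, -, ⟨Λ₀, hΛ₀⟩, hS, hf⟩ := h Q hQ
    rw [hf]
    simp only [Set.mem_iUnion, exists_prop]
    constructor
    · rintro ⟨Λ, hΛ, hη⟩
      rw [Submodule.finrank_eq_zero.1 (hS Λ hΛ)] at hη
      exact hη
    · rintro rfl
      exact ⟨Λ₀, hΛ₀, Λ₀.zero_mem⟩
  ext e
  obtain ⟨U, n, he, ⟨C⟩⟩ := exists_coordSystem (V := V) e.base.pt
  constructor
  · intro heY
    obtain ⟨x, hxU, hxW⟩ := nonempty_preirreducible_inter U.isOpen W.isOpen C.nonempty hW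
    obtain ⟨U', n', C', hx, hU'⟩ := CoordSystem.exists_le (W := U ⊓ W) x ⟨hxU, hxW⟩
    refine (C.cotangentEquiv e.base he).injective (funext fun i ↦ ?_)
    rw [map_zero]
    have h1 : MvPolynomial.X i ∈ C.vanishing Y := by
      rw [← C.res_mem_vanishing_iff C'.affine C'.nonempty (hU'.trans inf_le_left) hYirr hd]
      intro e' heY' he'
      rw [C.evalPoly_res, C.evalPoly_X, (hfib e'.base (hU' he').2 e'.covector).1 heY']
      rfl
    exact (C.evalPoly_X e he i).symm.trans (h1 e heY he)
  · intro h0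
    refine C.mem_of_section hY hW he 0 (fun i ↦ ?_) fun Q hQ hQW ↦ ?_
    · rw [show e.covector = 0 from h0, map_zero]
      exact map_zero _
    · rw [hfib Q hQW, LinearEquiv.map_eq_zero_iff]
      exact funext fun i ↦ map_zero _

theorem HasLinearFibers.fiber_subset {F : Foliation V} {Y : Set (CotangentBundle V)}
    (hYsub : Y ⊆ F.characteristicVariety) (Q : Point V) {i : F.ι} (hQ : Q.pt ∈ F.U i)
    {S : Set (Submodule ℂ (CotangentSpace Q))}
    (hS : fiber Y Q = ⋃ Λ ∈ S, (Λ : Set (CotangentSpace Q))) {Λ : Submodule ℂ (CotangentSpace Q)}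
    (hΛ : Λ ∈ S) :
    Λ ≤ LinearMap.ker (Module.Dual.eval ℂ _ (valueAt (F.gen_mem i) Q hQ)) := fun η hη ↦ by
  have h1 : η ∈ fiber Y Q := by
    rw [hS]
    exact Set.mem_biUnion hΛ hη
  exact F.apply_covector_eq_zero_of_mem (e := ⟨Q, η⟩) (hYsub h1) hQ

theorem CoordSystem.finrank_annihilator (C : CoordSystem U n) (Q : Point V) (hQ : Q.pt ∈ U)
    {v : TangentSpace Q} (hv : v ≠ 0) :
    Module.finrank ℂ (LinearMap.ker (Module.Dual.eval ℂ _ v)) + 1 = n := by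
  have := C.finiteDimensional_cotangentSpace Q hQ
  rw [← C.finrank_cotangentSpace Q hQ]
  exact Module.Dual.finrank_ker_add_one_of_ne_zero fun h ↦
    hv ((Module.forall_dual_apply_eq_zero_iff ℂ v).1 fun f ↦ LinearMap.congr_fun h f)

/-- At non-singular points the fibre lies in the hyperplane of covectors that annihilate the
foliation. If `q = n - 1` it is this whole hyperplane over `W`. Each covector annihilating the
foliation at a non-singular point extends to a local section with the same property, so `Y` would be
the whole characteristic variety. -/
theorem HasLinearFibers.add_two_le {F : Foliation V} {Y : Set (CotangentBundle V)}
    {q : ℕ} (h : HasLinearFibers Y U q) (C : CoordSystem U n) {i : F.ι} (hU : U ≤ F.U i)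
    (hY : IsClosed Y) (hYsub : Y ⊆ F.characteristicVariety) (hYne : Y ≠ F.characteristicVariety) :
    q + 2 ≤ n := by
  obtain ⟨W, hW, hWU, hreg⟩ := C.exists_nonsingular
    (vectorFields_mono hU (F.gen_mem i)) (F.gen_ne_zero i)
  have hle (Q : Point V) (hQ : Q.pt ∈ W) {S : Set (Submodule ℂ (CotangentSpace Q))}
      (hS : fiber Y Q = ⋃ Λ ∈ S, (Λ : Set (CotangentSpace Q))) {Λ} (hΛ : Λ ∈ S) :=
    HasLinearFibers.fiber_subset hYsub Q (hU (hWU hQ)) hS hΛ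
  have hlt : q + 1 ≤ n := by
    obtain ⟨Q, hQ⟩ := exists_point_mem hW
    have := C.finiteDimensional_cotangentSpace Q (hWU hQ)
    obtain ⟨S, -, ⟨Λ, hΛ⟩, hSq, hS⟩ := h Q (hWU hQ)
    rw [← C.finrank_annihilator Q (hWU hQ) (hreg Q (hWU hQ) hQ), ← hSq Λ hΛ]
    exact Nat.add_le_add_right (Submodule.finrank_mono (hle Q hQ hS hΛ)) 1
  by_contra hn
  have hqn : q + 1 = n := by omega
  refine hYne (hYsub.antisymm (closure_minimal ?_ hY))
  rintro e ⟨hsing, hann⟩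
  simp only [Foliation.IsSingular, not_forall] at hsing
  obtain ⟨j, hej, hsing⟩ := hsing
  obtain ⟨U', n', C', he, hU'⟩ := CoordSystem.exists_le e.base.pt hej
  have hξ : F.gen j ∈ vectorFields U' := vectorFields_mono hU' (F.gen_mem j)
  let a (k : Fin n') : regularFunctions U' := ⟨_, apply_mem_regularFunctions hξ (C'.x_mem k)⟩
  have hval (Q : Point V) (hQ : Q.pt ∈ U') (η : CotangentSpace Q) :
      η (valueAt hξ Q hQ) = ∑ k, Q.evalOn hQ (a k) * C'.cotangentEquiv Q hQ η k := by
    conv_lhs => rw [C'.tangent_eq Q hQ (valueAt hξ Q hQ), map_sum]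
    refine Finset.sum_congr rfl fun k _ ↦ ?_
    rw [map_smul]; rfl
  have h1 : ∃ k, e.base.evalOn he (a k) ≠ 0 := by
    by_contra! h0
    refine hsing ((Module.forall_dual_apply_eq_zero_iff ℂ _).1 fun η ↦ ?_)
    refine (hval _ he η).trans (Finset.sum_eq_zero fun k _ ↦ ?_)
    rw [h0 k, zero_mul]
  obtain ⟨k₀, hk₀⟩ := h1
  set y := C'.cotangentEquiv e.base he e.covector with hy
  set c := e.base.evalOn he (a k₀) with hc
  let s : regularFunctions U' := ∑ k, algebraMap ℂ _ (y k) * a k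
  have hs : e.base.evalOn he s = 0 := by
    rw [map_sum, ← hann j hej]
    refine Eq.trans (Finset.sum_congr rfl fun k _ ↦ ?_) (hval e.base he e.covector).symm
    rw [map_mul, AlgHom.commutes, mul_comm]; rfl
  -- The covector `y` with constant coefficients is scaled by `a k₀` and corrected in the coordinate
  -- `k₀`, so that it annihilates the foliation everywhere. At the base point of `e` the correction
  -- `s` is zero and `a k₀` equals `c`, so the value there is `y`.
  let σ (k : Fin n') : regularFunctions U' :=
    algebraMap ℂ _ c⁻¹ * (algebraMap ℂ _ (y k) * a k₀ - if k = k₀ then s else 0)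
  have hσ (Q : Point V) (hQ : Q.pt ∈ U') (k : Fin n') : Q.evalOn hQ (σ k) =
      c⁻¹ * (y k * Q.evalOn hQ (a k₀) - if k = k₀ then Q.evalOn hQ s else 0) := by
    simp only [σ, map_mul, map_sub, AlgHom.commutes]
    split_ifs <;> simp
  refine C'.mem_of_section hY hW he σ (fun k ↦ ?_) fun Q hQ hQW ↦ ?_
  · rw [hσ, hs, ← hc, ite_self, sub_zero, mul_comm (y k), inv_mul_cancel_left₀ hk₀]
  · obtain ⟨S, -, ⟨Λ, hΛ⟩, hSq, hS⟩ := h Q (hWU hQW)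
    have := C.finiteDimensional_cotangentSpace Q (hWU hQW)
    have h2 := Submodule.eq_of_le_of_finrank_eq (hle Q hQW hS hΛ) (by
      have := C.finrank_annihilator Q (hWU hQW) (hreg Q (hWU hQW) hQW)
      rw [hSq Λ hΛ]
      exact Nat.add_right_cancel (hqn.trans this.symm))
    rw [hS]
    refine Set.mem_biUnion hΛ ?_
    rw [SetLike.mem_coe, h2]
    refine F.apply_covector_eq_zero (e := ⟨Q, _⟩) (hU' hQ) (hU (hWU hQW)) ?_
    refine (hval Q hQ _).trans ?_
    have h3 : Q.evalOn hQ s = ∑ k, y k * Q.evalOn hQ (a k) := by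
      simp only [s, map_sum, map_mul, AlgHom.commutes]; rfl
    have h4 (k : Fin n') : Q.evalOn hQ (a k) * C'.cotangentEquiv Q hQ
        ((C'.cotangentEquiv Q hQ).symm fun k ↦ Q.evalOn hQ (σ k)) k =
        c⁻¹ * (Q.evalOn hQ (a k₀) * (y k * Q.evalOn hQ (a k))) -
          if k = k₀ then c⁻¹ * (Q.evalOn hQ (a k₀) * Q.evalOn hQ s) else 0 := by
      rw [LinearEquiv.apply_symm_apply, hσ]
      split_ifs with hk
      · rw [hk]; ring
      · ring
    refine (Finset.sum_congr rfl fun k _ ↦ h4 k).trans ?_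
    rw [Finset.sum_sub_distrib, Finset.sum_ite_eq', if_pos (Finset.mem_univ _), h3,
      Finset.mul_sum, Finset.mul_sum, sub_self]

end CharFoliation

/-! ### The dimension of `Y` -/

theorem trdeg_quotient_eq {k A R B : Type} [Field k] [CommRing A] [CommRing R] [CommRing B]
    [IsDomain B] [Algebra k A] [Algebra k R] [Algebra k B] [Algebra A R] [Algebra A B]
    [IsScalarTower k A R] [IsScalarTower k A B] (f : R →ₐ[A] B) {I : Ideal R}
    (hI : ∀ r, r ∈ I ↔ f r = 0) (h : ∀ b : B, IsAlgebraic f.range b) :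
    Algebra.trdeg k (R ⧸ I) = Algebra.trdeg k B := by
  obtain rfl : I = RingHom.ker f := Ideal.ext hI
  have e : (R ⧸ RingHom.ker f) ≃ₐ[k] f.range :=
    (Ideal.quotientKerEquivRange f).restrictScalars k
  have : Algebra.IsAlgebraic f.range B := ⟨h⟩
  have : FaithfulSMul k f.range :=
    (faithfulSMul_iff_algebraMap_injective _ _).2 (algebraMap k _).injective
  have h1 := _root_.trdeg_add_eq k f.range (A := B)
  rw [_root_.trdeg_eq_zero (R := f.range), add_zero] at h1
  rw [e.trdeg_eq, h1]

theorem isAlgebraic_of_mul_eq {A B : Type*} [CommRing A] [IsDomain A] [CommRing B] [Algebra A B]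
    {x : B} {a b : A} (hb : b ≠ 0) (h : algebraMap A B b * x = algebraMap A B a) :
    IsAlgebraic A x := by
  refine ⟨Polynomial.C b * Polynomial.X - Polynomial.C a, fun h0 ↦ hb ?_, by simp [h]⟩
  have := congrArg (fun p ↦ Polynomial.coeff p 1) h0
  simpa [Polynomial.coeff_C] using this

theorem trdeg_quotient_eq_of_fractions {k R B : Type} [Field k] [CommRing R] [CommRing B]
    [IsDomain B] [Algebra k R] [Algebra k B] (f : R →ₐ[k] B) {I : Ideal R}
    (hI : ∀ r, r ∈ I ↔ f r = 0)
    (h : ∀ b : B, b ∈ Algebra.adjoin k {x | ∃ r s, f s ≠ 0 ∧ f s * x = f r}) :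
    Algebra.trdeg k (R ⧸ I) = Algebra.trdeg k B := by
  refine trdeg_quotient_eq f hI fun b ↦ ?_
  have h1 : Algebra.adjoin k {x | ∃ r s, f s ≠ 0 ∧ f s * x = f r} ≤
      (Subalgebra.algebraicClosure f.range B).restrictScalars k := by
    refine Algebra.adjoin_le ?_
    rintro x ⟨r, s, hs, hx⟩
    exact isAlgebraic_of_mul_eq (a := (⟨f r, ⟨r, rfl⟩⟩ : f.range))
      (b := (⟨f s, ⟨s, rfl⟩⟩ : f.range)) (fun h0 ↦ hs (congrArg Subtype.val h0)) hx
  exact h1 (h b)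

/-- A space of points of a `ℂ`-algebra of finite type, with the Zariski topology, has the same
dimension as the algebra. -/
theorem topologicalKrullDim_eq_ringKrullDim {B T : Type*} [CommRing B] [Algebra ℂ B]
    [Algebra.FiniteType ℂ B] [TopologicalSpace T] (ev : T → B →ₐ[ℂ] ℂ)
    (hsurj : Function.Surjective ev) (hopen : ∀ s, IsOpen {e | ev e s ≠ 0})
    (hbasis : ∀ O : Set T, IsOpen O → ∀ e ∈ O, ∃ s, ev e s ≠ 0 ∧ ∀ e', ev e' s ≠ 0 → e' ∈ O) :
    topologicalKrullDim T = ringKrullDim B := by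
  have hclosed (p : Ideal B) : IsClosed {e | ∀ s ∈ p, ev e s = 0} := by
    have : {e | ∀ s ∈ p, ev e s = 0} = ⋂ s ∈ p, {e | ev e s ≠ 0}ᶜ := by
      ext e; simp
    rw [this]
    exact isClosed_biInter fun s _ ↦ (hopen s).isClosed_compl
  have hexists {p : Ideal B} (hp : p.IsPrime) {s : B} (hs : s ∉ p) :
      ∃ e, (∀ a ∈ p, ev e a = 0) ∧ ev e s ≠ 0 := by
    obtain ⟨φ, h1, h2⟩ := hp.exists_algHom_ne_zero hs
    obtain ⟨e, rfl⟩ := hsurj φ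
    exact ⟨e, h1, h2⟩
  have hirr {p : Ideal B} (hp : p.IsPrime) : IsIrreducible {e | ∀ s ∈ p, ev e s = 0} := by
    refine ⟨?_, ?_⟩
    · obtain ⟨e, he, -⟩ := hexists hp (s := 1) fun h ↦ hp.ne_top ((Ideal.eq_top_iff_one _).2 h)
      exact ⟨e, he⟩
    · rintro O₁ O₂ hO₁ hO₂ ⟨e₁, he₁, heO₁⟩ ⟨e₂, he₂, heO₂⟩
      obtain ⟨s₁, hs₁, hsO₁⟩ := hbasis O₁ hO₁ e₁ heO₁
      obtain ⟨s₂, hs₂, hsO₂⟩ := hbasis O₂ hO₂ e₂ heO₂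
      obtain ⟨e, he, hne⟩ := hexists hp (s := s₁ * s₂) fun h ↦
        (hp.mem_or_mem h).elim (fun h ↦ hs₁ (he₁ _ h)) fun h ↦ hs₂ (he₂ _ h)
      rw [map_mul] at hne
      exact ⟨e, he, hsO₁ _ (left_ne_zero_of_mul hne), hsO₂ _ (right_ne_zero_of_mul hne)⟩
  let I (Z : Set T) : Ideal B :=
    { carrier := {s | ∀ e ∈ Z, ev e s = 0}
      add_mem' := fun ha hb e he ↦ by rw [map_add, ha e he, hb e he, add_zero]
      zero_mem' := fun e _ ↦ map_zero _
      smul_mem' := fun c s hs e he ↦ by rw [smul_eq_mul, map_mul, hs e he, mul_zero] }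
  have hprime {Z : Set T} (hZ : IsIrreducible Z) : (I Z).IsPrime := by
    refine ⟨fun h ↦ ?_, fun {s t} hst ↦ ?_⟩
    · obtain ⟨e, he⟩ := hZ.nonempty
      have h1 : (1 : B) ∈ I Z := h ▸ Submodule.mem_top
      simpa using h1 e he
    · by_contra! h
      obtain ⟨hs, ht⟩ := h
      have h1 : ∃ e ∈ Z, ev e s ≠ 0 := by by_contra! h; exact hs h
      have h2 : ∃ e ∈ Z, ev e t ≠ 0 := by by_contra! h; exact ht h
      obtain ⟨e, he, hes, het⟩ := hZ.2 _ _ (hopen s) (hopen t) h1 h2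
      exact mul_ne_zero hes het (by rw [← map_mul]; exact hst e he)
  -- Primes correspond to irreducible closed sets with the order reversed. One composite is the
  -- identity by the Nullstellensatz, the other because the sets `ev e s ≠ 0` form a basis.
  let Φ : PrimeSpectrum B ≃o (TopologicalSpace.IrreducibleCloseds T)ᵒᵈ :=
    { toFun := fun p ↦ OrderDual.toDual
        ⟨{e | ∀ s ∈ p.asIdeal, ev e s = 0}, hirr p.2, hclosed _⟩
      invFun := fun Z ↦ ⟨I (OrderDual.ofDual Z).carrier, hprime (OrderDual.ofDual Z).isIrreducible⟩
      left_inv := fun p ↦ by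
        refine PrimeSpectrum.ext (le_antisymm (fun s hs ↦ ?_) fun s hs e he ↦ he s hs)
        by_contra hsp
        obtain ⟨e, he, hne⟩ := hexists p.2 hsp
        exact hne (hs e he)
      right_inv := fun Z ↦ by
        refine congrArg OrderDual.toDual (TopologicalSpace.IrreducibleCloseds.ext
          (Set.Subset.antisymm (fun e he ↦ ?_) fun e he s hs ↦ hs e he))
        by_contra heZ
        obtain ⟨s, hs, hsZ⟩ := hbasis _ (OrderDual.ofDual Z).isClosed.isOpen_compl e heZ
        exact hs (he s fun e' he' ↦ by_contra fun hne ↦ hsZ e' hne he')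
      map_rel_iff' := fun {p p'} ↦ by
        refine ⟨fun h s hs ↦ ?_, fun h e he s hs ↦ he s (h hs)⟩
        by_contra hsp
        obtain ⟨e, he, hne⟩ := hexists p'.2 hsp
        exact hne (h he s hs) }
  rw [ringKrullDim, Order.krullDim_eq_of_orderIso Φ, Order.krullDim_orderDual]
  rfl

namespace CharFoliation

variable {V : SmoothProjectiveVariety} {U : V.X.Opens} {n : ℕ}

namespace CoordSystem

variable (C : CoordSystem U n) {Y : Set (CotangentBundle V)}

theorem exists_evalPoly_eq (φ : MvPolynomial (Fin n) (regularFunctions U) →ₐ[ℂ] ℂ) :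
    ∃ (e : CotangentBundle V) (he : e.base.pt ∈ U), C.evalPoly e he = φ := by
  obtain ⟨P, hP, h⟩ := exists_point C.affine C.nonempty
    (φ.comp (IsScalarTower.toAlgHom ℂ (regularFunctions U) (MvPolynomial (Fin n) _)))
  refine ⟨⟨P, (C.cotangentEquiv P hP).symm fun i ↦ φ (MvPolynomial.X i)⟩, hP, ?_⟩
  refine AlgHom.coe_ringHom_injective (MvPolynomial.ringHom_ext (fun a ↦ ?_) fun i ↦ ?_)
  · exact (C.evalPoly_C _ hP a).trans (congrArg (fun ψ ↦ ψ a) h)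
  · refine (C.evalPoly_X ⟨P, _⟩ hP i).trans ?_
    rw [← cotangentEquiv_apply, LinearEquiv.apply_symm_apply]
    rfl

theorem topologicalKrullDim_eq (hY : IsClosed Y) :
    topologicalKrullDim {e : Y | e.1.base.pt ∈ U} =
      ringKrullDim (MvPolynomial (Fin n) (regularFunctions U) ⧸ C.vanishing Y) := by
  have := finiteType_regularFunctions C.affine C.nonempty
  have : Algebra.FiniteType ℂ (MvPolynomial (Fin n) (regularFunctions U)) :=
    Algebra.FiniteType.trans (S := regularFunctions U) inferInstance inferInstance
  refine topologicalKrullDim_eq_ringKrullDim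
    (B := MvPolynomial (Fin n) (regularFunctions U) ⧸ C.vanishing Y) (fun e : {e : Y | e.1.base.pt ∈ U} ↦
    Ideal.Quotient.liftₐ (C.vanishing Y)
    (C.evalPoly e.1.1 e.2) fun a ha ↦ ha _ e.1.2 e.2) (fun φ ↦ ?_) (fun s ↦ ?_)
    fun O hO e heO ↦ ?_
  · obtain ⟨e, he, h⟩ := C.exists_evalPoly_eq (φ.comp (Ideal.Quotient.mkₐ ℂ (C.vanishing Y)))
    have heY : e ∈ Y := C.mem_of_isClosed hY he fun g hg ↦ by
      rw [h, AlgHom.comp_apply, Ideal.Quotient.mkₐ_eq_mk, Ideal.Quotient.eq_zero_iff_mem.2 hg,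
        map_zero]
    refine ⟨⟨⟨e, heY⟩, he⟩, Ideal.Quotient.algHom_ext _ ?_⟩
    rw [← h]
    rfl
  · obtain ⟨s, rfl⟩ := Ideal.Quotient.mk_surjective s
    have h1 := (C.isOpen_evalPoly_ne_zero s).preimage (continuous_subtype_val.comp
      continuous_subtype_val : Continuous fun e : {e : Y | e.1.base.pt ∈ U} ↦ e.1.1)
    convert h1 using 1
    ext e
    exact ⟨fun h ↦ ⟨e.2, h⟩, fun ⟨_, h⟩ ↦ h⟩
  · obtain ⟨O', hO', rfl⟩ := isOpen_induced_iff.1 hO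
    obtain ⟨O'', hO'', rfl⟩ := isOpen_induced_iff.1 hO'
    obtain ⟨s, hs, hsO⟩ := C.exists_evalPoly_ne_zero_subset hO'' heO e.2
    exact ⟨Ideal.Quotient.mk _ s, hs, fun e' he' ↦ hsO e'.1.1 e'.2 he'⟩

/-- Restriction to the image of `M` embeds the coordinate ring of `Y` in the polynomials in `q`
variables over the algebraic closure of `ℂ(X)`. These are algebraic over the image: constants are
algebraic over `𝒪(U)`, and the variable `X a` is the image of `X (ι a)`. -/
theorem trdeg_eq_of_restrictTo (hY : IsIrreducible Y) (hd : Dominates Y) {q : ℕ}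
    {ι : Fin q → Fin n} {M : Matrix (Fin n) (Fin q) (RatFunClosure V)}
    (hM : ∀ a b, M (ι a) b = if a = b then 1 else 0)
    (hJ : ∀ g, g ∈ C.genericIdeal Y ↔ restrictTo (RatFun V) M g = 0) :
    Algebra.trdeg ℂ (MvPolynomial (Fin n) (regularFunctions U) ⧸ C.vanishing Y) = (n + q : ℕ) := by
  have hfr := isFractionRing_regularFunctions C.affine C.nonempty
  have : Algebra.IsAlgebraic (regularFunctions U) (RatFun V) :=
    (IsFractionRing.comap_isAlgebraic_iff (K := RatFun V)).2 inferInstance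
  have : Algebra.IsAlgebraic (regularFunctions U) (RatFunClosure V) :=
    Algebra.IsAlgebraic.trans (regularFunctions U) (RatFun V) (RatFunClosure V)
  let f : MvPolynomial (Fin n) (regularFunctions U) →ₐ[regularFunctions U]
      MvPolynomial (Fin q) (RatFunClosure V) :=
    ((restrictTo (RatFun V) M).restrictScalars (regularFunctions U)).comp
      (MvPolynomial.mapAlgHom (Algebra.ofId (regularFunctions U) (RatFun V)))
  have hf (g) : g ∈ C.vanishing Y ↔ f g = 0 := by
    rw [← C.map_mem_genericIdeal_iff hY hd, hJ]; rfl
  have hinj : Function.Injective (algebraMap (regularFunctions U) f.range) := fun a b h ↦ by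
    have h1 := congrArg Subtype.val h
    change MvPolynomial.C (algebraMap (RatFun V) (RatFunClosure V) a.1) =
      MvPolynomial.C (algebraMap (RatFun V) (RatFunClosure V) b.1) at h1
    exact Subtype.ext ((algebraMap (RatFun V) (RatFunClosure V)).injective
      (MvPolynomial.C_injective _ _ h1))
  have halg (b : MvPolynomial (Fin q) (RatFunClosure V)) : IsAlgebraic f.range b := by
    change b ∈ Subalgebra.algebraicClosure f.range (MvPolynomial (Fin q) (RatFunClosure V))
    induction b using MvPolynomial.induction_on with
    | C ω =>
      have h1 : IsAlgebraic (regularFunctions U) ω := Algebra.IsAlgebraic.isAlgebraic ω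
      have h2 : IsAlgebraic (regularFunctions U)
        (MvPolynomial.C ω : MvPolynomial (Fin q) (RatFunClosure V)) := h1.algebraMap
      exact h2.extendScalars hinj
    | add p p' hp hp' => exact add_mem hp hp'
    | mul_X p a hp =>
      refine mul_mem hp ?_
      have h1 : f (MvPolynomial.X (ι a)) = MvPolynomial.X a := by
        change restrictTo (RatFun V) M (MvPolynomial.map _ (MvPolynomial.X (ι a))) = _
        rw [MvPolynomial.map_X, restrictTo, MvPolynomial.aeval_X]
        simp [hM]
      exact (Subalgebra.algebraicClosure f.range (MvPolynomial (Fin q) (RatFunClosure V))).algebraMap_mem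
        ⟨MvPolynomial.X a, ⟨_, h1⟩⟩
  rw [trdeg_quotient_eq (k := ℂ) f hf halg]
  have h1 := _root_.trdeg_add_eq ℂ (RatFun V) (A := RatFunClosure V)
  rw [_root_.trdeg_eq_zero (R := RatFun V), C.trdeg_eq, add_zero] at h1
  rw [← _root_.trdeg_add_eq ℂ (RatFunClosure V), ← h1, MvPolynomial.trdeg_of_isDomain]
  simp

/-- The coordinate rings of `Y` in two systems of coordinates are isomorphic. -/
theorem nonempty_quotient_algEquiv {m : ℕ} (C' : CoordSystem U m) :
    Nonempty ((MvPolynomial (Fin n) (regularFunctions U) ⧸ C.vanishing Y) ≃ₐ[ℂ]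
      (MvPolynomial (Fin m) (regularFunctions U) ⧸ C'.vanishing Y)) := by
  -- Both rings are quotients of `SymbolExpr U` by the ideal of the expressions that vanish on `Y`,
  -- in which no coordinates appear.
  have hker {m : ℕ} (C : CoordSystem U m) :
      RingHom.ker ((Ideal.Quotient.mkₐ ℂ (C.vanishing Y)).comp C.symbol) =
        Ideal.span {g | ∀ e ∈ Y, ∀ he : e.base.pt ∈ U, evalSymbol e he g = 0} := by
    refine le_antisymm (fun g hg ↦ Ideal.subset_span fun e heY he ↦ ?_)
      (Ideal.span_le.2 fun g hg ↦ ?_)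
    · rw [← C.evalPoly_symbol]
      exact Ideal.Quotient.eq_zero_iff_mem.1 hg e heY he
    · refine Ideal.Quotient.eq_zero_iff_mem.2 fun e heY he ↦ ?_
      exact (C.evalPoly_symbol e he g).trans (hg e heY he)
  have hs {m : ℕ} (C : CoordSystem U m) : Function.Surjective
      ((Ideal.Quotient.mkₐ ℂ (C.vanishing Y)).comp C.symbol) :=
    (Ideal.Quotient.mkₐ_surjective ℂ _).comp C.symbol_surjective
  exact ⟨(Ideal.quotientKerAlgEquivOfSurjective (hs C)).symm.trans
    ((Ideal.quotientEquivAlgOfEq ℂ ((hker C).trans (hker C').symm)).trans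
      (Ideal.quotientKerAlgEquivOfSurjective (hs C')))⟩

/-- Shrinking the base only adjoins fractions of functions on `U`, and these are algebraic over the
original coordinate ring. -/
theorem trdeg_quotient_restrict {W : V.X.Opens} (hW : IsAffineOpen W)
    (hne : (W : Set V.X).Nonempty) (h : W ≤ U) (hY : IsIrreducible Y) (hd : Dominates Y) :
    Algebra.trdeg ℂ (MvPolynomial (Fin n) (regularFunctions U) ⧸ C.vanishing Y) =
      Algebra.trdeg ℂ (MvPolynomial (Fin n) (regularFunctions W) ⧸
        (C.restrict hW hne h).vanishing Y) := by
  have hfr := isFractionRing_regularFunctions C.affine C.nonempty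
  have hP := (C.restrict hW hne h).vanishing_isPrime_of_dominates hY hd
  let r : MvPolynomial (Fin n) (regularFunctions U) →ₐ[ℂ]
      MvPolynomial (Fin n) (regularFunctions W) :=
    MvPolynomial.mapAlgHom (Subalgebra.inclusion (regularFunctions_mono h))
  let f := (Ideal.Quotient.mkₐ ℂ ((C.restrict hW hne h).vanishing Y)).comp r
  refine trdeg_quotient_eq_of_fractions f (fun g ↦ ?_) fun b ↦ ?_
  · rw [← C.res_mem_vanishing_iff hW hne h hY hd]
    exact Ideal.Quotient.eq_zero_iff_mem.symm
  · obtain ⟨b, rfl⟩ := Ideal.Quotient.mk_surjective b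
    induction b using MvPolynomial.induction_on with
    | C c =>
      obtain ⟨⟨a, b⟩, hab⟩ := IsLocalization.surj (nonZeroDivisors (regularFunctions U)) c.1
      have hab' : c.1 * b.1.1 = a.1 := hab
      have hb0 : b.1.1 ≠ 0 := fun h0 ↦ nonZeroDivisors.ne_zero b.2 (Subtype.ext h0)
      have hC (a : regularFunctions U) : f (MvPolynomial.C a) = Ideal.Quotient.mk _
          (MvPolynomial.C ⟨a.1, regularFunctions_mono h a.2⟩) := by
        change Ideal.Quotient.mk _ (MvPolynomial.map _ (MvPolynomial.C a)) = _
        rw [MvPolynomial.map_C]; rfl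
      refine Algebra.subset_adjoin ⟨MvPolynomial.C a, MvPolynomial.C b.1, fun h1 ↦ hb0 ?_, ?_⟩
      · rw [hC] at h1
        exact congrArg Subtype.val (((C.restrict hW hne h).C_mem_vanishing_iff hd).1
          (Ideal.Quotient.eq_zero_iff_mem.1 h1))
      · rw [hC, hC, ← map_mul, ← map_mul]
        refine congrArg (fun c ↦ Ideal.Quotient.mk _ (MvPolynomial.C c)) (Subtype.ext ?_)
        exact (mul_comm _ _).trans hab'
    | add p p' hp hp' => rw [map_add]; exact add_mem hp hp'
    | mul_X p i hp =>
      rw [map_mul]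
      refine mul_mem hp (Algebra.subset_adjoin ⟨MvPolynomial.X i, 1, ?_, ?_⟩)
      · rw [map_one]; exact one_ne_zero
      · rw [map_one, one_mul]
        change _ = Ideal.Quotient.mk _ (MvPolynomial.map _ (MvPolynomial.X i))
        rw [MvPolynomial.map_X]

/-- The linear description is available only in the coordinates `C`, whereas `Y` must be covered by
all charts. Each chart meets `U`, and the transcendence degree is compared over an affine open set
contained in both. -/
theorem topologicalKrullDim_eq_add (hYc : IsClosed Y) (hY : IsIrreducible Y) (hd : Dominates Y)
    {q : ℕ} {ι : Fin q → Fin n} {M : Matrix (Fin n) (Fin q) (RatFunClosure V)}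
    (hM : ∀ a b, M (ι a) b = if a = b then 1 else 0)
    (hJ : ∀ g, g ∈ C.genericIdeal Y ↔ restrictTo (RatFun V) M g = 0) :
    topologicalKrullDim Y = (n + q : ℕ) := by
  have : Nonempty Y := hY.nonempty.to_subtype
  refine topologicalKrullDim_eq_of_cover fun e ↦ ?_
  obtain ⟨U', m, he, ⟨C'⟩⟩ := exists_coordSystem (V := V) e.1.base.pt
  refine ⟨{e : Y | e.1.base.pt ∈ U'},
    C'.isOpen_base_mem.preimage continuous_subtype_val, he, ?_⟩
  have := finiteType_regularFunctions C'.affine C'.nonempty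
  have : Algebra.FiniteType ℂ (MvPolynomial (Fin m) (regularFunctions U')) :=
    Algebra.FiniteType.trans (S := regularFunctions U') inferInstance inferInstance
  have := C'.vanishing_isPrime_of_dominates hY hd
  obtain ⟨x, hxU, hxU'⟩ := nonempty_preirreducible_inter U.isOpen U'.isOpen C.nonempty C'.nonempty
  obtain ⟨W, _, D, -, hW⟩ := CoordSystem.exists_le (W := U ⊓ U') x ⟨hxU, hxU'⟩
  rw [C'.topologicalKrullDim_eq hYc]
  refine ringKrullDim_eq_of_trdeg_eq (k := ℂ) (A := MvPolynomial (Fin m) (regularFunctions U') ⧸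
    C'.vanishing Y) ?_
  have h1 := D.affine
  have h2 := D.nonempty
  rw [C'.trdeg_quotient_restrict h1 h2 (hW.trans inf_le_right) hY hd]
  obtain ⟨E⟩ := (C'.restrict h1 h2 (hW.trans inf_le_right)).nonempty_quotient_algEquiv (Y := Y)
    (C.restrict h1 h2 (hW.trans inf_le_left))
  refine (AlgEquiv.trdeg_eq (A' := MvPolynomial (Fin n) (regularFunctions W) ⧸
    (C.restrict h1 h2 (hW.trans inf_le_left)).vanishing Y) E).trans ?_
  exact (C.restrict h1 h2 (hW.trans inf_le_left)).trdeg_eq_of_restrictTo hY hd hM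
    (by rwa [C.genericIdeal_restrict h1 h2 _ hY hd])

end CoordSystem

end CharFoliation

end

/-! ### The theorem -/

theorem mainTheorem3 (V : CharFoliation.SmoothProjectiveVariety)
    (F : CharFoliation.Foliation V)
    (Y : Set (CharFoliation.CotangentBundle V))
    (hYclosed : IsClosed Y) (hYirr : IsIrreducible Y)
    (hYsub : Y ⊆ F.characteristicVariety) (hYne : Y ≠ F.characteristicVariety)
    (hYdom : CharFoliation.Dominates Y) (hYzero : Y ≠ CharFoliation.zeroSection V)
    (p : CharFoliation.Point V) (hp : F.IsNonResonant p)
    (hsep : ∃ γ : ℂ → CharFoliation.Point V,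
      F.IsSeparatrix p γ ∧ CharFoliation.IsZariskiDenseGerm γ)
    (hYinv : F.IsProlongationInvariant Y) :
    ∃ n q : ℕ, topologicalKrullDim V.X = n ∧ topologicalKrullDim Y = (n + q : ℕ) ∧
      1 ≤ q ∧ q + 2 ≤ n ∧
      -- the generic fibre is a finite union of linear spaces of the same dimension
      (∃ W : V.X.Opens, (W : Set V.X).Nonempty ∧
        ∀ P : CharFoliation.Point V, P.pt ∈ W →
          ∃ S : Set (Submodule ℂ (CharFoliation.CotangentSpace P)), S.Finite ∧ S.Nonempty ∧
            (∀ Λ ∈ S, Module.finrank ℂ Λ = q) ∧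
            CharFoliation.fiber Y P = ⋃ Λ ∈ S, (Λ : Set (CharFoliation.CotangentSpace P))) ∧
      -- these linear spaces define a multi-distribution, to which the foliation is tangent
      ∃ M : CharFoliation.MultiDistribution V q, F.IsTangentTo M ∧
        ∀ (P : CharFoliation.Point V) (hP : P.pt ∈ M.U),
          CharFoliation.fiber Y P =
            ⋃ Λ ∈ M.conormalSpaces P hP, (Λ : Set (CharFoliation.CotangentSpace P)) := by
  obtain ⟨i, U, n, C, hU, S, hS⟩ := CharFoliation.exists_zeroLocus_genericIdeal_eq F p hp hsep
    hYsub hYinv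
  obtain ⟨q, ι, M, hM, hJ⟩ := exists_matrix_of_isPrime (C.genericIdeal_isPrime hYirr hYdom) hS
  obtain ⟨W, hW, hne, hWU, ⟨m⟩⟩ := CharFoliation.exists_linearModel C hYirr hYdom hM hJ
  have hfib : CharFoliation.HasLinearFibers Y W q := fun P hP ↦ m.exists_fiber_eq P hP hYclosed
  obtain ⟨D, hD⟩ := m.exists_multiDistribution hYclosed
  refine ⟨n, q, CharFoliation.topologicalKrullDim_eq C,
    C.topologicalKrullDim_eq_add hYclosed hYirr hYdom hM hJ, Nat.one_le_iff_ne_zero.2 ?_,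
    hfib.add_two_le (C.restrict hW hne hWU) (hWU.trans hU) hYclosed hYsub hYne,
    ⟨W, hne, hfib⟩, D, CharFoliation.Foliation.isTangentTo_of_fiber_eq hYsub hD, hD⟩
  rintro rfl
  exact hYzero (hfib.eq_zeroSection hne hYclosed hYirr hYdom)
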